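/- Let $K$ be a global field, $S$ a non-empty set of places of $K$ containing the infinite (archimedean) ones, $\mathcal{O}=\mathcal{O}_{K,S}$ the ring of $S$-integers, $\ell$ an odd prime different from the characteristic of $K$, and $\zeta$ a primitive $\ell$-th root of unity in an extension of $K$ such that $t=\zeta+\zeta^{-1}\in K$ (hence $t\in\mathcal{O}$). Put $\Psi(T)=T^2-tT+1$, $K(\Psi)=K[T]/(\Psi)$, $R=\mathcal{O}[T]/(\Psi)$, and identify $\bigwedge^2_K K(\Psi)$ with $K$ by $1\wedge T\mapsto 1$. Let $\operatorname{Nm}_1:R^\times\to\mathcal{O}^\times$ be the norm map on units. Let $\mathcal{C}_\ell$ be the set of $\mathrm{SL}_2(\mathcal{O})$-conjugacy classes of elements of order $\ell$ in $\mathrm{SL}_2(\mathcal{O})$ with characteristic polynomial $\Psi$, and $\mathcal{K}_\ell$ the set of conjugacy classes of subgroups of order $\ell$ of $\mathrm{SL}_2(\mathcal{O})$. An oriented relative ideal is a pair $(\mathfrak a,a)$ of a fractional $R$-ideal $\mathfrak a\subseteq K(\Psi)$ and a generator $a\neq 0$ of the image of $\bigwedge^2_{\mathcal{O}}\mathfrak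 a$ in $\bigwedge^2_KK(\Psi)=K$; $(\mathfrak a,a)\sim(\mathfrak b,b)$ if $\tau\mathfrak a=\mathfrak b$ and $N_{K(\Psi)/K}(\tau)a=b$ for some $\tau\in K(\Psi)^\times$; the class of $(\mathfrak a,a)$ is denoted $[\mathfrak a,a]$. There is a bijection between $\mathcal{C}_\ell$ and the set of classes $[\mathfrak a,a]$ such that the class of $\rho$ corresponds to $[\mathfrak a,a]$ if and only if $\rho$ is the matrix of multiplication by $T$ in some $\mathcal{O}$-basis $x_1,x_2$ of $\mathfrak a$ with $x_1\wedge x_2=a$. We use it to identify both sets. A subgroup $\Gamma\subseteq\mathrm{SL}_2(\mathcal{O})$ is said to have a dihedral overgroup if it is contained in a subgroup of $\mathrm{SL}_2(\mathcal{O})$ whose image in $\mathrm{PSL}_2(\mathcal{O})=\mathrm{SL}_2(\mathcal{O})/\text{centre}$ is a finite dihedral group. For an abelian group $U$, we say that the normalizer $N(\Gamma)$ of $\Gamma$ in $\mathrm{SL}_2(\mathcal{O})$ is an inverting extension of $\mathbb{Z}/2$ by $U$ if there is an exact sequence $1\to U\to N(\Gamma)\to\mathbb{Z}/2\mathbb{Z}\to1$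 such that every element of $N(\Gamma)$ outside $U$ acts on $U$ by inversion and has square $-1$ (so for $\operatorname{char}K=2$ this is $U\rtimes\mathbb{Z}/2\mathbb{Z}$, and for $\operatorname{char}K\ne2$ the extension is non-split). (1) Assume (R1): $\zeta\notin K$, and the prime $((\zeta-\zeta^{-1})^2)$ of $\mathbb{Z}[\zeta+\zeta^{-1}]$ above $\ell$ is unramified in $\mathcal{O}$, i.e. every prime of $\mathcal{O}$ above it has ramification index one over $\mathbb{Z}[\zeta+\zeta^{-1}]$ (for function fields this condition is void). Then $\mathcal{C}_\ell$ is non-empty and is an abelian group under $[\mathfrak a,a]\cdot[\mathfrak b,b]=[\mathfrak a\mathfrak b,ab]$. There is a norm homomorphism $\operatorname{Nm}_0:\operatorname{Pic}(R)\to\operatorname{Pic}(\mathcal{O})$ sending the class of an invertible fractional ideal $\mathfrak a$ to the class of the $\mathcal{O}$-module generated by $\{N_{K(\Psi)/K}(x):x\in\mathfrak a\}$, and there is an exact sequence $$1\to\operatorname{coker}(\operatorname{Nm}_1)\to\mathcal{C}_\ell\to\ker(\operatorname{Nm}_0)\to1,$$ with maps $u\mapsto[R,u]$ and $[\mathfrak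 a,a]\mapsto[\mathfrak a]$. The group $\operatorname{Gal}(K(\Psi)/K)$ acts on the set $\mathcal{C}_\ell$ by $s\cdot[\mathfrak a,x_1\wedge x_2]=[s(\mathfrak a),s(x_1)\wedge s(x_2)]$, and $\rho\mapsto\langle\rho\rangle$ induces a bijection $\mathcal{C}_\ell/\operatorname{Gal}(K(\Psi)/K)\cong\mathcal{K}_\ell$. Let $\Gamma$ be a subgroup of order $\ell$ and let $\mathcal{I}\in\mathcal{C}_\ell$ be the class of any element of $\Gamma$ with characteristic polynomial $\Psi$. Then $\Gamma$ has a dihedral overgroup if and only if $\mathcal{I}$ is $\operatorname{Gal}(K(\Psi)/K)$-invariant. If $\mathcal{I}$ is invariant, $N(\Gamma)$ is an inverting extension of $\mathbb{Z}/2$ by $\ker(\operatorname{Nm}_1)$; if not, $N(\Gamma)\cong\ker(\operatorname{Nm}_1)$. (2) Assume (R2): $\zeta\in K$ and $S$ contains all places of $K$ above $\ell$. Then there is a bijection $\mathcal{C}_\ell\to\operatorname{Pic}(\mathcal{O})$, sending $[\mathfrak a,a]$ to the class of the image of $\mathfrak a$ under $K(\Psi)\to K$, $T\mapsto\zeta$;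 via it, $\rho\mapsto\langle\rho\rangle$ induces a bijection of $\operatorname{Pic}(\mathcal{O})/(\mathcal{I}\sim\mathcal{I}^{-1})$ with $\mathcal{K}_\ell$. Let $\Gamma$ be a subgroup of order $\ell$ and let $\mathcal{I}\in\operatorname{Pic}(\mathcal{O})$ be the class corresponding to any element of $\Gamma$ with characteristic polynomial $\Psi$. Then $\Gamma$ has a dihedral overgroup if and only if $\mathcal{I}=\mathcal{I}^{-1}$. If $\mathcal{I}=\mathcal{I}^{-1}$, $N(\Gamma)$ is an inverting extension of $\mathbb{Z}/2$ by $\mathcal{O}^\times$; if not, $N(\Gamma)\cong\mathcal{O}^\times$. -/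

import Mathlib

open scoped nonZeroDivisors MatrixGroups

namespace SL2Conj

/-! ### Global fields, places, rings of `S`-integers -/

/-- A global field: a number field, or a finite separable extension of a rational function field
`𝔽_p(T)`. (As finite fields are perfect, every finite extension of `𝔽_p(T)` is separable over
`𝔽_p(T')` for a suitable choice of `T'`, and the embedding of `𝔽_p(T)` is existentially quantified,
so this is the usual class of fields.) -/
def IsGlobalField (K : Type*) [Field K] : Prop :=
  NumberField K ∨ ∃ p : ℕ, ∃ _ : Fact p.Prime, ∃ _ : Algebra (RatFunc (ZMod p)) K,
    FiniteDimensional (RatFunc (ZMod p)) K ∧ Algebra.IsSeparable (RatFunc (ZMod p)) K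

/-- The nonarchimedean places of a global field, given by their valuation rings: the valuation
subrings of `K` different from `K` itself. -/
abbrev Place (K : Type*) [Field K] := {v : ValuationSubring K // v ≠ ⊤}

/-- The ring `𝒪_{K,S}` of `S`-integers: elements of `K` integral at all nonarchimedean places
outside `S`. Archimedean places impose no condition: they always belong to `S`, and only the
nonarchimedean members of `S` are recorded. -/
abbrev sIntegers (K : Type*) [Field K] (S : Set (Place K)) : Subring K :=
  ⨅ v : {v : Place K // v ∉ S}, v.1.1.toSubring

/-! ### The quadratic algebras `R = A[T]/(T² - tT + 1)` and `K(Ψ) = K[T]/(T² - tT + 1)` -/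

section Quadratic

variable (A K : Type*) [CommRing A] [Field K] [Algebra A K] (t : A)

/-- The order `A[T]/(T² - tT + 1)`; the class of `T` is `QuadraticAlgebra.omega`. -/
abbrev QOrder := QuadraticAlgebra A (-1) t

/-- The algebra `K(Ψ) = K[T]/(T² - tT + 1)`. -/
abbrev QAlg := QuadraticAlgebra K (-1) (algebraMap A K t)

/-- The inclusion `A[T]/(Ψ) → K[T]/(Ψ)`, coefficientwise. -/
def qMap : QOrder A t →+* QAlg A K t where
  toFun z := ⟨algebraMap A K z.re, algebraMap A K z.im⟩
  map_one' := by ext <;> simp [QuadraticAlgebra.re_one, QuadraticAlgebra.im_one]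
  map_zero' := by ext <;> simp
  map_add' x y := by ext <;> simp
  map_mul' x y := by ext <;> simp

instance qAlgebra : Algebra (QOrder A t) (QAlg A K t) := (qMap A K t).toAlgebra

instance qFaithful [FaithfulSMul A K] : FaithfulSMul (QOrder A t) (QAlg A K t) :=
  (faithfulSMul_iff_algebraMap_injective _ _).2 fun x y h => by
    have hinj := FaithfulSMul.algebraMap_injective A K
    exact QuadraticAlgebra.ext (hinj (congrArg QuadraticAlgebra.re h))
      (hinj (congrArg QuadraticAlgebra.im h))

/-- The group `Gal(K(Ψ)/K)` of `K`-algebra automorphisms of `K(Ψ)`. -/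
abbrev QGal := QAlg A K t ≃ₐ[K] QAlg A K t

/-- The norm map `Nm₁` on unit groups for `A[T]/(Ψ)` over `A`. -/
noncomputable def normUnits : (QOrder A t)ˣ →* Aˣ :=
  Units.map (Algebra.norm A : QOrder A t →* A)

/-- `N` is the norm map `Nm₀` on Picard groups: the class of an invertible fractional ideal `𝔞` is
sent to the class of its ideal norm, the `A`-submodule of `K` generated by the norms of the
elements of `𝔞`. -/
def IsPicNorm [FaithfulSMul A K] (N : CommRing.Pic (QOrder A t) →* CommRing.Pic A) : Prop :=
  ∀ U : (Submodule (QOrder A t) (QAlg A K t))ˣ, ∃ V : (Submodule A K)ˣ,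
    (V : Submodule A K) = Submodule.span A
      {w | ∃ z ∈ (U : Submodule (QOrder A t) (QAlg A K t)), w = Algebra.norm K z} ∧
    N (Submodule.unitsToPic (QOrder A t) (QAlg A K t) U) = Submodule.unitsToPic A K V

variable {A K t}

/-- The wedge product `x ∧ y` in `⋀²_K K(Ψ)`, identified with `K` by `1 ∧ T ↦ 1`. -/
def wedge (x y : QAlg A K t) : K := x.re * y.im - x.im * y.re

variable (A K t)

/-- An oriented relative ideal `(𝔞, a)`: a fractional ideal `𝔞` together with a generator `a` of
the image of `⋀²_A 𝔞` in `⋀²_K K(Ψ) = K`. (For `A` Dedekind with fraction field `K` and `𝔞` of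
rank two, `𝔞` is a projective `A`-module and `⋀²_A 𝔞 → ⋀²_K K(Ψ)` is injective.) -/
structure OrientedIdeal where
  ideal : FractionalIdeal (QOrder A t)⁰ (QAlg A K t)
  orient : Kˣ
  span_orient : Submodule.span A {(orient : K)} =
    Submodule.span A {w : K | ∃ x ∈ ideal, ∃ y ∈ ideal, w = wedge x y}

variable {A K t}

/-- `(𝔞, a) ∼ (𝔟, b)` iff `τ𝔞 = 𝔟` and `(m_τ ∧ m_τ)(a) = N(τ) a = b` for some unit `τ` of
`K(Ψ)`. -/
def OrientedIdeal.Equivalent (I J : OrientedIdeal A K t) : Prop :=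
  ∃ τ : (QAlg A K t)ˣ, (∀ z : QAlg A K t, (τ : QAlg A K t) * z ∈ J.ideal ↔ z ∈ I.ideal) ∧
    (J.orient : K) = Algebra.norm K (τ : QAlg A K t) * I.orient

variable (A K t)

instance orientedSetoid : Setoid (OrientedIdeal A K t) where
  r := OrientedIdeal.Equivalent
  iseqv :=
    { refl := fun I => ⟨1, by simp, by simp⟩
      symm := by
        rintro I J ⟨τ, h1, h2⟩
        refine ⟨τ⁻¹, fun z => ?_, ?_⟩
        · rw [← h1, Units.mul_inv_cancel_left]
        · rw [h2, ← mul_assoc, ← map_mul, Units.inv_mul, map_one, one_mul]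
      trans := by
        rintro I J L ⟨τ, h1, h2⟩ ⟨σ, h3, h4⟩
        refine ⟨σ * τ, fun z => ?_, ?_⟩
        · rw [Units.val_mul, mul_assoc, h3, h1]
        · rw [h4, h2, Units.val_mul, map_mul, mul_assoc] }

/-- The set of oriented relative ideal classes. -/
def OrientedClasses := Quotient (orientedSetoid A K t)

variable {A K t}

/-- The class `[𝔞, a]`. -/
def OrientedIdeal.cls (I : OrientedIdeal A K t) : OrientedClasses A K t := Quotient.mk _ I

/-- `P` is the product of `I` and `J`: multiply the ideals and the volume forms. -/
def OrientedIdeal.IsProd (I J P : OrientedIdeal A K t) : Prop :=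
  P.ideal = I.ideal * J.ideal ∧ P.orient = I.orient * J.orient

/-- `J = s(I)` for `s ∈ Gal(K(Ψ)/K)`: the ideal is `s(𝔞)`, and if `a = x ∧ y` then the
orientation is `s(x) ∧ s(y)`. -/
def OrientedIdeal.IsConjugate (s : QGal A K t) (I J : OrientedIdeal A K t) :
    Prop :=
  (∀ z, s z ∈ J.ideal ↔ z ∈ I.ideal) ∧
    ∀ x y : QAlg A K t, wedge x y = (I.orient : K) → wedge (s x) (s y) = (J.orient : K)

/-- `ρ ∈ SL₂(A)` represents multiplication by `T` on the oriented relative ideal `(𝔞, a)`: there is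
an `A`-basis `x₀, x₁` of `𝔞` with `x₀ ∧ x₁ = a` in which multiplication by `T` has matrix `ρ`. -/
def Represents (ρ : SL(2, A)) (I : OrientedIdeal A K t) : Prop :=
  ∃ x : Fin 2 → QAlg A K t,
    (∀ z, z ∈ I.ideal ↔ ∃ c : Fin 2 → A, z = ∑ i, c i • x i) ∧
    wedge (x 0) (x 1) = (I.orient : K) ∧
    ∀ j, (QuadraticAlgebra.omega : QAlg A K t) * x j = ∑ i, ρ.1 i j • x i

end Quadratic

/-! ### Conjugacy classes of elements and subgroups of order `ℓ` -/

section Classes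

variable {A : Type*} [CommRing A] (ℓ : ℕ) (t : A)

open Polynomial in
/-- Elements of order `ℓ` in `SL₂(A)` with characteristic polynomial `T² - tT + 1`. -/
abbrev OrderElt :=
  {ρ : SL(2, A) // orderOf ρ = ℓ ∧ ρ.1.charpoly = X ^ 2 - C t * X + 1}

/-- Conjugacy in `SL₂(A)`. -/
instance eltSetoid : Setoid (OrderElt ℓ t) :=
  (IsConj.setoid SL(2, A)).comap Subtype.val

/-- The set `𝒞_ℓ` of `SL₂(A)`-conjugacy classes of such elements. -/
def EltClasses := Quotient (eltSetoid ℓ t)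

variable {ℓ t}

/-- The conjugacy class of an element. -/
def OrderElt.cls (ρ : OrderElt ℓ t) : EltClasses ℓ t := Quotient.mk _ ρ

variable (A ℓ)

/-- Subgroups of order `ℓ` in `SL₂(A)`. -/
abbrev OrderSubgroup := {Γ : Subgroup SL(2, A) // Nat.card Γ = ℓ}

/-- Conjugacy of subgroups in `SL₂(A)`. -/
instance subgroupSetoid : Setoid (OrderSubgroup A ℓ) where
  r Γ Δ := ∃ g : SL(2, A), ∀ h, g * h * g⁻¹ ∈ Δ.1 ↔ h ∈ Γ.1
  iseqv :=
    { refl := fun Γ => ⟨1, by simp⟩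
      symm := by
        rintro Γ Δ ⟨g, hg⟩
        refine ⟨g⁻¹, fun h => ?_⟩
        rw [← hg]
        simp [mul_assoc]
      trans := by
        rintro Γ Δ Θ ⟨g, hg⟩ ⟨k, hk⟩
        refine ⟨k * g, fun h => ?_⟩
        rw [← hg, ← hk]
        simp [mul_assoc] }

/-- The set `𝒦_ℓ` of conjugacy classes of subgroups of order `ℓ` in `SL₂(A)`. -/
def SubgroupClasses := Quotient (subgroupSetoid A ℓ)

variable {A ℓ}

/-- The conjugacy class of a subgroup. -/
def OrderSubgroup.cls (Γ : OrderSubgroup A ℓ) : SubgroupClasses A ℓ := Quotient.mk _ Γ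

/-- The subgroup of order `ℓ` generated by an element of order `ℓ`. -/
def OrderElt.gen (ρ : OrderElt ℓ t) : OrderSubgroup A ℓ :=
  ⟨Subgroup.zpowers ρ.1, by rw [Nat.card_zpowers, ρ.2.1]⟩

/-- `Γ` has a dihedral overgroup: it is contained in a subgroup of `SL₂(A)` whose image in
`PSL₂(A) = SL₂(A)/center` is a finite dihedral group. -/
def HasDihedralOvergroup (Γ : Subgroup SL(2, A)) : Prop :=
  ∃ D : Subgroup SL(2, A), Γ ≤ D ∧ ∃ n : ℕ, n ≠ 0 ∧
    Nonempty (D.map (QuotientGroup.mk' (Subgroup.center SL(2, A))) ≃* DihedralGroup n)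

/-- The normalizer `N` of `Γ` is an extension `1 → U → N → ℤ/2 → 1`, the quotient acting on `U` by
inversion, where all elements of `N` outside `U` have square `-1`. -/
def NormalizerIsExtension (U : Type*) [CommGroup U] (Γ : Subgroup SL(2, A)) : Prop :=
  ∃ (i : U →* Subgroup.normalizer (Γ : Set SL(2, A))) (π : Subgroup.normalizer (Γ : Set SL(2, A)) →* Multiplicative (ZMod 2)),
    Function.Injective i ∧ Function.Surjective π ∧ i.range = π.ker ∧
    ∀ n : Subgroup.normalizer (Γ : Set SL(2, A)), π n ≠ 1 →
      (n.1 : SL(2, A)) ^ 2 = -1 ∧ ∀ u : U, n * i u * n⁻¹ = i u⁻¹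

end Classes

/-- The relation identifying an element of a group with its inverse. -/
def inversionSetoid (P : Type*) [Group P] : Setoid P where
  r a b := a = b ∨ a = b⁻¹
  iseqv :=
    { refl := fun _ => Or.inl rfl
      symm := by
        rintro a b (h | h)
        · exact Or.inl h.symm
        · exact Or.inr (by rw [h, inv_inv])
      trans := by
        rintro a b c (rfl | rfl) (rfl | rfl)
        · exact Or.inl rfl
        · exact Or.inr rfl
        · exact Or.inr rfl
        · exact Or.inl (inv_inv _) }

/-- Condition that the prime `(ζ - ζ⁻¹)` of `ℤ[ζ + ζ⁻¹]` above `ℓ` is unramified in `A`, where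
`t = ζ + ζ⁻¹`. That prime of `ℤ[t]` is generated by `(ζ - ζ⁻¹)² = t² - 4`, so the primes of `A`
above it are the primes containing `t² - 4`; each must have ramification index one over `ℤ[t]`
(residue fields are finite, so residue extensions are separable). For function fields `t² - 4`
is a unit and the condition is void. -/
def UnramifiedAtEll {A : Type*} [CommRing A] (t : A) : Prop :=
  ∀ P : Ideal A, P.IsPrime → t ^ 2 - 4 ∈ P → P.ramificationIdx (Algebra.adjoin ℤ {t}) = 1

/-- `S` contains all places above `ℓ`. -/
def ContainsPlacesAbove {K : Type*} [Field K] (S : Set (Place K)) (ℓ : ℕ) : Prop :=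
  ∀ v : Place K, v.1.valuation (ℓ : K) < 1 → v ∈ S

end SL2Conj

open SL2Conj

/-!
# Conjugacy classes of elements and subgroups of odd prime order in `SL₂` of `S`-integers

Write `A` for the ring of `S`-integers, `R = A[T]/(Ψ)` and `K(Ψ) = K[T]/(Ψ)`. Everything rests on a
few properties of `A` and of `Ψ = T² - tT + 1`.

* `A` is a Dedekind domain with fraction field `K`
  (`isDedekindDomain_and_isFractionRing_sIntegers`). As `S`-integers are defined by valuation rings,
  `A` is integrally closed, and any ring between a principal ideal domain with finite residue rings
  and a finite extension of its fraction field has finite residue rings itself (Krull–Akizuki, by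
  counting). For a number field the principal ideal domain is `ℤ`. For a function field it is
  `𝔽_p[x]`, where `x` is a nonconstant function with poles only at one place of `S`; such an `x` is
  found by the pigeonhole principle, in place of the Riemann–Roch theorem
  (`exists_transcendental_mem_of_ne`).
* In `SL₂(A)` the elements of trace `t` have order `ℓ`, and every subgroup of order `ℓ` contains
  exactly two of them, which are inverse to each other (`IsOrderTrace`).
* `t - 2` divides `ℓ`, and `t + 2` is a unit, because `Ψ` divides the cyclotomic polynomial. Hence
  the discriminant `t² - 4` of `Ψ` is a unit if `ℓ` is one, and it is squarefree if the prime above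
  `ℓ` is unramified (`notMem_sq_of_unramifiedAtEll`). In both cases `R` contains every element of
  `K(Ψ)` whose trace and norm lie in `A` (`QIntegral`).

A matrix `ρ` of trace `t` makes `K²` a module over `K(Ψ)`, free of rank one since `ρ` is not scalar,
and `A²` becomes an oriented ideal in it. Conversely an oriented ideal has an `A`-basis whose wedge
product is the orientation, by Steinitz's argument (`OrientedIdeal.exists_wedge_eq`); here the
existence of a generator of the exterior square is what makes the ideal free. Since multiplication
by `T` has trace `t` and determinant `1`, this gives the bijection with oriented classes
(`exists_equiv_represents`), under which `ρ⁻¹` corresponds to the conjugate ideal with the opposite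
orientation.

Normalizers and dihedral overgroups are read off from `ρ` alone. The centralizer of `ρ` consists of
the matrices `x + yρ` for `x + yT` in `R` of norm one (`range_centralizerHom`). An element
normalizing `⟨ρ⟩` preserves the trace, so it fixes or inverts `ρ`; one that inverts `ρ` has trace
zero, hence square `-1`, and inverts the centralizer. A dihedral overgroup exists exactly if `ρ` is
conjugate to `ρ⁻¹`, and subgroups of order `ℓ` up to conjugacy are elements of trace `t` up to
conjugacy and inversion (`IsOrderTrace.exists_quotient_equiv`).

If `ζ ∉ K`, then `K(Ψ)` is a field and the relation `𝔞·𝔞̄ = N(𝔞)R` holds for every nonzero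
fractional ideal (`mul_starSubmodule`). It shows that fractional ideals are invertible, that the
norm is multiplicative, and that it is the image of the exterior square; so oriented ideals are
pairs of an invertible ideal and a generator of its norm, and the exact sequence follows
(`exists_commGroup_exact`). The nontrivial automorphism of `K(Ψ)` acts as inversion of matrices
(`exists_mulAction_gal`).

If `ζ ∈ K` and `ℓ` is a unit of `A`, then `R = A × A` by evaluation at `ζ` and `ζ⁻¹`. An oriented
ideal is a pair of fractional ideals of `A` whose product is generated by the orientation, so it is
determined up to equivalence by the class of the first one, conjugation exchanges the two
components, and the elements of norm one are the pairs `(u, u⁻¹)` (`exists_equiv_pic`).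
-/

namespace SL2Conj

/-! ### Overrings of principal ideal domains with finite residue rings -/

section KrullAkizuki

variable (R F K A : Type*) [CommRing R] [IsDomain R]
  [Field F] [Algebra R F] [IsFractionRing R F] [Field K] [Algebra R K] [Algebra F K]
  [IsScalarTower R F K]

include F in
theorem free_submodule_of_finite [IsPrincipalIdealRing R] (M : Submodule R K)
    [Module.Finite R M] : Module.Free R M := by
  have hRK : Function.Injective (algebraMap R K) := by
    rw [IsScalarTower.algebraMap_eq R F K]
    exact (algebraMap F K).injective.comp (IsFractionRing.injective R F)
  have : FaithfulSMul R K := (faithfulSMul_iff_algebraMap_injective _ _).2 hRK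
  infer_instance

variable [FiniteDimensional F K]
  [CommRing A] [Algebra R A] [Algebra A K] [IsScalarTower R A K] [FaithfulSMul A K]

include R F in
theorem isFractionRing_of_isIntegrallyClosedIn (hA : IsIntegrallyClosedIn A K) :
    IsFractionRing A K := by
  have hinj : Function.Injective (algebraMap A K) := FaithfulSMul.algebraMap_injective A K
  have : IsDomain A := hinj.isDomain
  have hRK : Function.Injective (algebraMap R K) := by
    rw [IsScalarTower.algebraMap_eq R F K]
    exact (algebraMap F K).injective.comp (IsFractionRing.injective R F)
  refine IsFractionRing.of_field A K fun z => ?_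
  have halg : IsAlgebraic R z :=
    (IsFractionRing.isAlgebraic_iff R F K).2 (Algebra.IsAlgebraic.isAlgebraic (R := F) z)
  obtain ⟨r, hr, hint⟩ := halg.exists_integral_multiple
  have h2 : IsIntegral A (r • z) := hint.tower_top
  obtain ⟨y, hy⟩ := hA.isIntegral_iff.1 h2
  refine ⟨y, algebraMap R A r, ?_⟩
  rw [hy, ← IsScalarTower.algebraMap_apply, Algebra.smul_def, mul_div_cancel_left₀]
  rwa [Ne, map_eq_zero_iff _ hRK]

variable [IsPrincipalIdealRing R]

theorem finrank_submodule_le_finrank (M : Submodule R K) [Module.Finite R M] :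
    Module.finrank R M ≤ Module.finrank F K := by
  have : Module.Free R M := free_submodule_of_finite R F K M
  have h1 : LinearIndependent R (fun i => (Module.finBasis R M i : K)) :=
    (Module.finBasis R M).linearIndependent.map' M.subtype (Submodule.ker_subtype M)
  rw [LinearIndependent.iff_fractionRing (R := R) (K := F)] at h1
  simpa using h1.fintype_card_le_finrank

/-- The counting step of the Krull–Akizuki theorem: for any ring `A` between a principal ideal
domain `R` and a finite extension `K` of its fraction field, `A / aA` has at most
`|R / aR| ^ [K : F]` elements. Any finite set of classes is represented in a finitely generated,
hence free, `R`-submodule of `A` of rank at most `[K : F]`. -/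
theorem finite_quotient_and_card_le (a : R) [Finite (R ⧸ Ideal.span {a})] :
    Finite (A ⧸ Ideal.span {algebraMap R A a}) ∧
      Nat.card (A ⧸ Ideal.span {algebraMap R A a}) ≤
        Nat.card (R ⧸ Ideal.span {a}) ^ Module.finrank F K := by
  classical
  set q := Nat.card (R ⧸ Ideal.span {a})
  have hq : 0 < q := Nat.card_pos
  have hinj : Function.Injective (algebraMap A K) := FaithfulSMul.algebraMap_injective A K
  have key : ∀ s : Finset (A ⧸ Ideal.span {algebraMap R A a}),
      s.card ≤ q ^ Module.finrank F K := by
    intro s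
    let g : A →ₗ[R] K := (IsScalarTower.toAlgHom R A K).toLinearMap
    let M₀ : Submodule R A := Submodule.span R ((s.image Quotient.out : Finset A) : Set A)
    let M : Submodule R K := M₀.map g
    have : Module.Finite R M₀ := Module.Finite.span_finset R _
    have : Module.Free R M := free_submodule_of_finite R F K M
    let b := Module.finBasis R M
    have hb : ∀ i, ∃ x : A, g x = b i := fun i => by
      obtain ⟨x, -, hx⟩ := (b i).2
      exact ⟨x, hx⟩
    choose b' hb' using hb
    let φ : (Fin (Module.finrank R M) → R ⧸ Ideal.span {a}) →
        A ⧸ Ideal.span {algebraMap R A a} := fun c =>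
      Ideal.Quotient.mk _ (∑ i, (c i).out • b' i)
    have hφ : ∀ z ∈ s, z ∈ Set.range φ := by
      intro z hz
      have hzM : g z.out ∈ M :=
        Submodule.mem_map_of_mem (Submodule.subset_span
          (Finset.mem_coe.2 (Finset.mem_image_of_mem _ hz)))
      let c : Fin (Module.finrank R M) → R := fun i => b.repr ⟨g z.out, hzM⟩ i
      refine ⟨fun i => Ideal.Quotient.mk _ (c i), ?_⟩
      have hz' : z.out = ∑ i, c i • b' i := by
        apply hinj
        have := congrArg Subtype.val (b.sum_repr ⟨g z.out, hzM⟩)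
        change g z.out = g _
        rw [map_sum]
        simp_rw [map_smul, hb']
        rw [Submodule.coe_sum] at this
        exact this.symm
      have hzz : z = Ideal.Quotient.mk _ z.out := (Quotient.out_eq z).symm
      rw [hzz, hz']
      change Ideal.Quotient.mk _ _ = _
      rw [Ideal.Quotient.eq, ← Finset.sum_sub_distrib]
      refine Ideal.sum_mem _ fun i _ => ?_
      have h1 : (Ideal.Quotient.mk (Ideal.span {a}) (c i)).out - c i ∈ Ideal.span {a} := by
        rw [← Ideal.Quotient.eq]
        exact Quotient.out_eq _
      obtain ⟨d, hd⟩ := Ideal.mem_span_singleton'.1 h1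
      rw [← sub_smul, ← hd, Ideal.mem_span_singleton']
      exact ⟨d • b' i, by simp only [Algebra.smul_def, map_mul]; ring⟩
    have hfin : (Set.range φ).Finite := Set.finite_range φ
    calc s.card = (s : Set _).ncard := (Set.ncard_coe_finset s).symm
      _ ≤ (Set.range φ).ncard := Set.ncard_le_ncard (fun z hz => hφ z hz) hfin
      _ ≤ Nat.card (Fin (Module.finrank R M) → R ⧸ Ideal.span {a}) := by
        rw [← Nat.card_coe_set_eq]
        exact Nat.card_le_card_of_surjective _ Set.rangeFactorization_surjective
      _ = q ^ Module.finrank R M := by rw [Nat.card_fun]; simp [q]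
      _ ≤ q ^ Module.finrank F K :=
        Nat.pow_le_pow_right hq (finrank_submodule_le_finrank R F K M)
  have hfin : Finite (A ⧸ Ideal.span {algebraMap R A a}) := by
    by_contra h
    rw [not_finite_iff_infinite] at h
    obtain ⟨s, hs⟩ := Infinite.exists_subset_card_eq
      (A ⧸ Ideal.span {algebraMap R A a}) (q ^ Module.finrank F K + 1)
    have := key s
    omega
  refine ⟨hfin, ?_⟩
  have := Fintype.ofFinite (A ⧸ Ideal.span {algebraMap R A a})
  rw [Nat.card_eq_fintype_card]
  exact key Finset.univ

variable (hR : ∀ a : R, a ≠ 0 → Finite (R ⧸ Ideal.span {a}))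

include F K hR

theorem finite_quotient_of_ne_bot {I : Ideal A} (hI : I ≠ ⊥) : Finite (A ⧸ I) := by
  have hinj : Function.Injective (algebraMap A K) := FaithfulSMul.algebraMap_injective A K
  obtain ⟨x, hxI, hx⟩ := Submodule.exists_mem_ne_zero_of_ne_bot hI
  have : IsDomain A := hinj.isDomain
  have halg : IsAlgebraic R x := by
    have : IsAlgebraic F (algebraMap A K x) := Algebra.IsAlgebraic.isAlgebraic _
    rw [← IsFractionRing.isAlgebraic_iff R F K] at this
    exact (isAlgebraic_algebraMap_iff hinj).1 this
  obtain ⟨r, hr, hdvd⟩ := halg.exists_nonzero_dvd (mem_nonZeroDivisors_of_ne_zero hx)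
  have := hR r hr
  have := (finite_quotient_and_card_le R F K A r).1
  have hle : Ideal.span {algebraMap R A r} ≤ I :=
    (Ideal.span_singleton_le_iff_mem _).2 (I.mem_of_dvd hdvd hxI)
  exact Finite.of_surjective _ (Ideal.Quotient.factor_surjective hle)

theorem isNoetherianRing_of_finite_quotients : IsNoetherianRing A := by
  rw [isNoetherianRing_iff_ideal_fg]
  intro I
  by_cases hI : I = ⊥
  · rw [hI]; exact Submodule.fg_bot
  obtain ⟨x, hxI, hx⟩ := Submodule.exists_mem_ne_zero_of_ne_bot hI
  have hfin : Finite (A ⧸ Ideal.span {x}) :=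
    finite_quotient_of_ne_bot R F K A hR (by simpa using hx)
  apply Submodule.fg_of_fg_map_of_fg_inf_ker (Ideal.span {x} : Submodule A A).mkQ
  · exact Submodule.FG.of_finite
  · rw [Submodule.ker_mkQ, inf_eq_right.2 ((Ideal.span_singleton_le_iff_mem _).2 hxI)]
    exact Submodule.fg_span_singleton x

theorem dimensionLEOne_of_finite_quotients : Ring.DimensionLEOne A := by
  refine ⟨fun {P} hP hprime => ?_⟩
  have := finite_quotient_of_ne_bot R F K A hR hP
  exact Ideal.Quotient.maximal_of_isField _ (Finite.isField_of_domain (A ⧸ P))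

theorem isDedekindDomain_of_isIntegrallyClosedIn (hA : IsIntegrallyClosedIn A K) :
    IsDedekindDomain A := by
  have hinj : Function.Injective (algebraMap A K) := FaithfulSMul.algebraMap_injective A K
  have : IsDomain A := hinj.isDomain
  have := isNoetherianRing_of_finite_quotients R F K A hR
  have := dimensionLEOne_of_finite_quotients R F K A hR
  have := isFractionRing_of_isIntegrallyClosedIn R F K A hA
  have : IsIntegrallyClosed A := (isIntegrallyClosed_iff_isIntegrallyClosedIn K).2 hA
  exact { }

end KrullAkizuki

/-! ### Function fields of one variable over a finite field -/

section FunctionField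

open scoped IntermediateField.algebraAdjoinAdjoin
open IntermediateField Polynomial

variable {k K : Type*} [Field k] [Field K] [Algebra k K]

theorem finite_polynomial_quotient [Finite k] {f : k[X]} (hf : f ≠ 0) :
    Finite (k[X] ⧸ Ideal.span {f}) := by
  have : Module.Finite k (AdjoinRoot f) := (AdjoinRoot.powerBasis hf).finite
  exact Module.finite_of_finite k (M := AdjoinRoot f)

theorem adjoin_pid {u : K} (hu : Transcendental k u) :
    IsPrincipalIdealRing (Algebra.adjoin k {u}) :=
  IsPrincipalIdealRing.of_surjective
    (Polynomial.algEquivOfTranscendental k u hu : k[X] →+* Algebra.adjoin k {u})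
    (Polynomial.algEquivOfTranscendental k u hu).surjective

theorem finite_quotient_adjoin [Finite k] {u : K} (hu : Transcendental k u)
    (a : Algebra.adjoin k {u}) (ha : a ≠ 0) : Finite (Algebra.adjoin k {u} ⧸ Ideal.span {a}) := by
  let e := Polynomial.algEquivOfTranscendental k u hu
  have : Finite (k[X] ⧸ Ideal.span {e.symm a}) := finite_polynomial_quotient (by simpa using ha)
  refine Finite.of_equiv _ (Ideal.quotientEquiv (Ideal.span {e.symm a}) (Ideal.span {a})
    e.toRingEquiv ?_).toEquiv
  rw [Ideal.map_span]
  simp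

theorem card_quotient_adjoin [Finite k] {u : K} (hu : Transcendental k u) :
    Nat.card (Algebra.adjoin k {u} ⧸
      Ideal.span {(⟨u, Algebra.self_mem_adjoin_singleton k u⟩ : Algebra.adjoin k {u})}) =
      Nat.card k := by
  let e := Polynomial.algEquivOfTranscendental k u hu
  have h1 := Ideal.quotientEquiv (Ideal.span {(X : k[X])}) (Ideal.span
    {(⟨u, Algebra.self_mem_adjoin_singleton k u⟩ : Algebra.adjoin k {u})}) e.toRingEquiv (by
      rw [Ideal.map_span]
      congr 2
      simp only [Set.image_singleton]
      congr 1
      ext; simp [e])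
  have h2 : (k[X] ⧸ Ideal.span {(X : k[X])}) ≃+* k := by
    rw [show (X : k[X]) = X - C 0 by simp]
    exact (Polynomial.quotientSpanXSubCAlgEquiv (0 : k)).toRingEquiv
  exact Nat.card_congr (h1.symm.trans h2).toEquiv

/-- An element of `K` integral over `k[u⁻¹]` becomes integral over `k[u]` after multiplication
by a power of `u`. -/
theorem exists_pow_mul_mem_adjoin {u a : K} (hu : u ≠ 0) (ha : a ∈ Algebra.adjoin k {u⁻¹}) :
    ∃ c : ℕ, ∀ d, c ≤ d → u ^ d * a ∈ Algebra.adjoin k {u} := by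
  have hself : u ∈ Algebra.adjoin k {u} := Algebra.self_mem_adjoin_singleton k u
  induction ha using Algebra.adjoin_induction with
  | mem x hx =>
    rw [Set.mem_singleton_iff] at hx
    refine ⟨1, fun d hd => ?_⟩
    obtain ⟨e, rfl⟩ := Nat.exists_eq_add_of_le hd
    rw [hx, show u ^ (1 + e) * u⁻¹ = u ^ e by rw [pow_add]; field_simp]
    exact pow_mem hself _
  | algebraMap r => exact ⟨0, fun d _ => mul_mem (pow_mem hself _) (Subalgebra.algebraMap_mem _ r)⟩
  | add x y _ _ hx hy =>
    obtain ⟨c, hc⟩ := hx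
    obtain ⟨d, hd⟩ := hy
    refine ⟨max c d, fun e he => ?_⟩
    rw [mul_add]
    exact add_mem (hc e (le_of_max_le_left he)) (hd e (le_of_max_le_right he))
  | mul x y _ _ hx hy =>
    obtain ⟨c, hc⟩ := hx
    obtain ⟨d, hd⟩ := hy
    refine ⟨c + d, fun e he => ?_⟩
    obtain ⟨e', rfl⟩ := Nat.exists_eq_add_of_le he
    rw [show u ^ (c + d + e') * (x * y) = u ^ c * x * (u ^ (d + e') * y) by ring]
    exact mul_mem (hc c le_rfl) (hd _ (by omega))

theorem exists_pow_mul_isIntegral {u z : K} (hu : u ≠ 0)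
    (hz : IsIntegral (Algebra.adjoin k {u⁻¹}) z) :
    ∃ c : ℕ, ∀ d, c ≤ d → IsIntegral (Algebra.adjoin k {u}) (u ^ d * z) := by
  classical
  obtain ⟨p, hp, hpz⟩ := hz
  choose c hc using fun i => exists_pow_mul_mem_adjoin hu (p.coeff i).2
  refine ⟨(Finset.range (p.natDegree + 1)).sup c, fun d hd => ?_⟩
  let q : K[X] := (p.map (algebraMap _ K)).scaleRoots (u ^ d)
  have hq : q.Monic := (monic_scaleRoots_iff _).2 (hp.map _)
  have hdeg : (p.map (algebraMap (Algebra.adjoin k {u⁻¹}) K)).natDegree = p.natDegree :=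
    hp.natDegree_map _
  have hlift : q ∈ lifts (algebraMap (Algebra.adjoin k {u}) K) := by
    rw [lifts_iff_coeff_lifts]
    intro i
    rw [coeff_scaleRoots, hdeg, coeff_map]
    rcases lt_trichotomy i p.natDegree with hi | hi | hi
    · have h1 : c i ≤ d :=
        (Finset.le_sup (f := c) (Finset.mem_range.2 (by omega))).trans hd
      have h2 : d ≤ d * (p.natDegree - i) := Nat.le_mul_of_pos_right d (by omega)
      refine ⟨⟨_, hc i (d * (p.natDegree - i)) (h1.trans h2)⟩, ?_⟩
      rw [← pow_mul]
      exact mul_comm (u ^ (d * (p.natDegree - i))) (p.coeff i : K)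
    · refine ⟨1, ?_⟩
      rw [hi, hp.coeff_natDegree]; simp
    · refine ⟨0, ?_⟩
      rw [coeff_eq_zero_of_natDegree_lt hi]; simp
  obtain ⟨r, hr, -, hrm⟩ := lifts_and_natDegree_eq_and_monic hlift hq
  refine ⟨r, hrm, ?_⟩
  rw [← eval_map, hr, ← eval₂_id]
  exact scaleRoots_eval₂_eq_zero _ (by rw [eval₂_id, eval_map]; exact hpz)


/-- In a function field of one variable, every transcendental element generates a subfield of
finite index. -/
theorem finiteDimensional_adjoin_of_transcendental [Algebra (RatFunc k) K]
    [IsScalarTower k (RatFunc k) K] [FiniteDimensional (RatFunc k) K] {u : K}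
    (hu : Transcendental k u) : FiniteDimensional k⟮u⟯ K := by
  let T : K := algebraMap (RatFunc k) K RatFunc.X
  have hpoly : ∀ f : k[X], algebraMap (RatFunc k) K (algebraMap k[X] (RatFunc k) f) =
      aeval T f := by
    have : (IsScalarTower.toAlgHom k (RatFunc k) K).comp
        (IsScalarTower.toAlgHom k k[X] (RatFunc k)) = aeval T :=
      Polynomial.algHom_ext (by simp [T])
    exact fun f => DFunLike.congr_fun this f
  have halg : Algebra.IsAlgebraic (Algebra.adjoin k {T}) K := by
    refine ⟨fun z => ?_⟩
    have h1 : IsAlgebraic (RatFunc k) z := Algebra.IsAlgebraic.isAlgebraic z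
    let _ : Algebra k[X] K :=
      ((algebraMap (RatFunc k) K).comp (algebraMap k[X] (RatFunc k))).toAlgebra
    have : IsScalarTower k[X] (RatFunc k) K := IsScalarTower.of_algebraMap_eq fun _ => rfl
    rw [← IsFractionRing.isAlgebraic_iff k[X] (RatFunc k) K] at h1
    obtain ⟨p, hp, hpz⟩ := h1
    let φ : k[X] →+* Algebra.adjoin k {T} :=
      ((aeval (⟨T, Algebra.self_mem_adjoin_singleton k T⟩ : Algebra.adjoin k {T})) :
        k[X] →ₐ[k] Algebra.adjoin k {T})
    have hφ : (algebraMap (Algebra.adjoin k {T}) K).comp φ = algebraMap k[X] K := by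
      refine RingHom.ext fun f => Eq.trans ?_ (hpoly f).symm
      exact (aeval_algHom_apply (Algebra.adjoin k {T}).val _ f).symm
    have hinj : Function.Injective φ := by
      apply Function.Injective.of_comp (f := algebraMap (Algebra.adjoin k {T}) K)
      rw [← RingHom.coe_comp, hφ]
      exact (algebraMap (RatFunc k) K).injective.comp (IsFractionRing.injective _ _)
    refine ⟨p.map φ, (Polynomial.map_ne_zero_iff hinj).2 hp, ?_⟩
    rw [aeval_def, eval₂_map, hφ]
    exact hpz
  -- `K` has transcendence degree one, so it is algebraic over `k(u)`
  have htr : AlgebraicIndependent k (fun _ : Unit => u) :=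
    (algebraicIndependent_unique_type_iff).2 hu
  have hle : Algebra.trdeg k K ≤ 1 := by
    simpa using Algebra.IsAlgebraic.trdeg_le_cardinalMk k ({T} : Set K)
  have hbasis : IsTranscendenceBasis k (fun _ : Unit => u) :=
    htr.isTranscendenceBasis_of_lift_trdeg_le_of_finite (by simpa using hle)
  have halg' : Algebra.IsAlgebraic (Algebra.adjoin k {u}) K := by
    have := hbasis.isAlgebraic
    rwa [Set.range_const] at this
  have halg'' : Algebra.IsAlgebraic k⟮u⟯ K :=
    (IsFractionRing.comap_isAlgebraic_iff (A := Algebra.adjoin k {u})).1 halg'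
  -- it is generated over `k(u)` by `T` and a basis of `K` over `k(T)`
  let b := Module.finBasis (RatFunc k) K
  let s : Set K := insert T (Set.range b)
  have hs : Finite s := (Set.finite_range b).insert T
  have hfd : FiniteDimensional k⟮u⟯ (adjoin k⟮u⟯ s) :=
    finiteDimensional_adjoin fun x _ => Algebra.IsIntegral.isIntegral x
  have htop : adjoin k⟮u⟯ s = ⊤ := by
    rw [eq_top_iff]
    intro z _
    have hT : T ∈ adjoin k⟮u⟯ s := subset_adjoin _ _ (Set.mem_insert _ _)
    have hk : ∀ f : k[X], aeval T f ∈ adjoin k⟮u⟯ s := fun f =>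
      Algebra.adjoin_le (S := ((adjoin k⟮u⟯ s).restrictScalars k).toSubalgebra)
        (Set.singleton_subset_iff.2 hT) (aeval_mem_adjoin_singleton k T)
    have hF : ∀ r : RatFunc k, algebraMap (RatFunc k) K r ∈ adjoin k⟮u⟯ s := by
      intro r
      rw [← RatFunc.num_div_denom r, map_div₀, hpoly, hpoly]
      exact div_mem (hk _) (hk _)
    rw [← b.sum_repr z]
    refine sum_mem fun i _ => ?_
    rw [Algebra.smul_def]
    exact mul_mem (hF _) (subset_adjoin _ _ (Set.mem_insert_of_mem _ ⟨i, rfl⟩))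
  rw [htop] at hfd
  exact (IntermediateField.topEquiv (F := k⟮u⟯) (E := K)).toLinearEquiv.finiteDimensional

end FunctionField

/-! ### Functions with a single pole -/

section Places

variable {K : Type*} [Field K]

theorem mem_valuationSubring_of_isIntegral {R : Type*} [CommRing R] [Algebra R K]
    (v : ValuationSubring K) (hR : ∀ r : R, algebraMap R K r ∈ v) {x : K}
    (hx : IsIntegral R x) : x ∈ v := by
  obtain ⟨p, hp, hpx⟩ := hx
  let φ : R →+* v := (algebraMap R K).codRestrict v hR
  have : IsIntegral v x := by
    refine ⟨p.map φ, hp.map φ, ?_⟩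
    rw [Polynomial.eval₂_map]
    exact hpx
  obtain ⟨y, rfl⟩ := (IsIntegrallyClosed.isIntegral_iff (K := K)).1 this
  exact y.2

theorem algebraMap_mem_valuationSubring {k : Type*} [Field k] [Finite k] [Algebra k K]
    (v : ValuationSubring K) (c : k) : algebraMap k K c ∈ v := by
  by_cases hc : c = 0
  · rw [hc, map_zero]; exact v.zero_mem
  · rw [← v.valuation_le_one_iff]
    obtain ⟨n, hn, h⟩ := isOfFinOrder_of_finite (Units.mk0 c hc) |>.exists_pow_eq_one
    have h1 : c ^ n = 1 := by simpa using congrArg Units.val h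
    have h2 : v.valuation (algebraMap k K c) ^ n = 1 := by rw [← map_pow, ← map_pow, h1]; simp
    exact not_lt.1 fun h3 => (one_lt_pow₀ h3 hn.ne').ne' h2

theorem algebraMap_adjoin_mem_valuationSubring {k : Type*} [Field k] [Finite k] [Algebra k K]
    (v : ValuationSubring K) {u : K} (hu : u ∈ v) (r : Algebra.adjoin k {u}) :
    algebraMap (Algebra.adjoin k {u}) K r ∈ v := by
  obtain ⟨r, hr⟩ := r
  change r ∈ v
  induction hr using Algebra.adjoin_induction with
  | mem x hx => rwa [Set.mem_singleton_iff.1 hx]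
  | algebraMap c => exact algebraMap_mem_valuationSubring v c
  | add x y _ _ hx hy => exact v.add_mem _ _ hx hy
  | mul x y _ _ hx hy => exact v.mul_mem _ _ hx hy

/-- In a Dedekind domain with fraction field `K`, every element of `K` is a local integer at a
given nonzero prime, or the inverse of a local nonunit. -/
theorem exists_mul_eq_or_exists_mul_eq {W : Type*} [CommRing W] [IsDedekindDomain W] [Algebra W K]
    [IsFractionRing W K] (P : Ideal W) [P.IsPrime] (hP : P ≠ ⊥) (x : K) :
    (∃ a b : W, b ∉ P ∧ x * algebraMap W K b = algebraMap W K a) ∨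
      ∃ a b : W, b ∉ P ∧ a ∈ P ∧ x * algebraMap W K a = algebraMap W K b := by
  have hinj : Function.Injective (algebraMap W K) := IsFractionRing.injective W K
  have := IsLocalization.AtPrime.isDiscreteValuationRing_of_dedekind_domain W hP
    (Localization.AtPrime P)
  obtain ⟨a, b, hb, rfl⟩ := IsFractionRing.div_surjective (A := W) x
  have hb0 : b ≠ 0 := nonZeroDivisors.ne_zero hb
  have hb' : algebraMap W K b ≠ 0 := by rwa [Ne, map_eq_zero_iff _ hinj]
  -- one of `a`, `b` divides the other in the discrete valuation ring `W_P`
  have hdvd : ∀ c d : W, algebraMap W (Localization.AtPrime P) c ∣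
      algebraMap W (Localization.AtPrime P) d → ∃ e s : W, s ∉ P ∧ c * e = d * s := by
    rintro c d ⟨z, hz⟩
    obtain ⟨e, s, rfl⟩ := IsLocalization.exists_mk'_eq P.primeCompl z
    refine ⟨e, s, s.2, ?_⟩
    apply IsLocalization.injective (Localization.AtPrime P) P.primeCompl_le_nonZeroDivisors
    rw [map_mul, map_mul, hz, mul_assoc, IsLocalization.mk'_spec]
  rcases ValuationRing.dvd_total (algebraMap W (Localization.AtPrime P) b)
    (algebraMap W (Localization.AtPrime P) a) with h | h
  · obtain ⟨e, s, hs, h⟩ := hdvd b a h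
    refine Or.inl ⟨e, s, hs, ?_⟩
    have := congrArg (algebraMap W K) h
    simp only [map_mul] at this
    field_simp
    rw [← this]
  · obtain ⟨e, s, hs, h⟩ := hdvd a b h
    have := congrArg (algebraMap W K) h
    simp only [map_mul] at this
    by_cases he : e ∈ P
    · exact Or.inr ⟨e, s, hs, he, by field_simp; rw [this]⟩
    · exact Or.inl ⟨s, e, he, by field_simp; rw [this]⟩

/-- The center of a valuation subring on a subring `W`. -/
def center {W : Type*} [CommRing W] [Algebra W K] (v : ValuationSubring K)
    (hW : ∀ w : W, algebraMap W K w ∈ v) : Ideal W :=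
  (IsLocalRing.maximalIdeal v).comap ((algebraMap W K).codRestrict v hW)

theorem mem_center {W : Type*} [CommRing W] [Algebra W K] (v : ValuationSubring K)
    (hW : ∀ w : W, algebraMap W K w ∈ v) (w : W) :
    w ∈ center v hW ↔ v.valuation (algebraMap W K w) < 1 := by
  rw [center, Ideal.mem_comap, ValuationSubring.valuation_lt_one_iff]
  rfl

instance center_isPrime {W : Type*} [CommRing W] [Algebra W K] (v : ValuationSubring K)
    (hW : ∀ w : W, algebraMap W K w ∈ v) : (center v hW).IsPrime :=
  Ideal.comap_isPrime _ _

/-- A valuation subring with nonzero center on a Dedekind domain is determined by its center. -/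
theorem eq_of_center_eq {W : Type*} [CommRing W] [IsDedekindDomain W] [Algebra W K]
    [IsFractionRing W K] {v v' : ValuationSubring K} (hW : ∀ w : W, algebraMap W K w ∈ v)
    (hW' : ∀ w : W, algebraMap W K w ∈ v') (h : center v hW = center v' hW')
    (h0 : center v hW ≠ ⊥) : v = v' := by
  have key : ∀ (w w' : ValuationSubring K) (h1 : ∀ z : W, algebraMap W K z ∈ w)
      (h2 : ∀ z : W, algebraMap W K z ∈ w'), center w h1 = center w' h2 → center w h1 ≠ ⊥ →
      w ≤ w' := by
    intro w w' h1 h2 h h0 x hx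
    have hunit : ∀ (y : ValuationSubring K) (h3 : ∀ z : W, algebraMap W K z ∈ y) (b : W),
        b ∉ center y h3 → y.valuation (algebraMap W K b) = 1 := fun y h3 b hb =>
      le_antisymm ((y.valuation_le_one_iff _).2 (h3 b)) (not_lt.1 (mt (mem_center y h3 b).2 hb))
    rcases exists_mul_eq_or_exists_mul_eq (center w h1) h0 x with
      ⟨a, b, hb, hab⟩ | ⟨a, b, hb, ha, hab⟩
    · have hb1 := hunit w' h2 b (h ▸ hb)
      have h3 := (w'.valuation_le_one_iff _).2 (h2 a)
      rw [← hab, map_mul, hb1, mul_one] at h3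
      exact (w'.valuation_le_one_iff _).1 h3
    · have h3 := hunit w h1 b hb
      rw [← hab, map_mul] at h3
      have h4 := (mem_center w h1 a).1 ha
      have h5 := (w.valuation_le_one_iff x).2 hx
      exact absurd h3 ((mul_le_of_le_one_left' h5).trans_lt h4).ne
  exact le_antisymm (key v v' hW hW' h h0) (key v' v hW' hW h.symm (h ▸ h0))

/-- The `u`-adic digit expansion bounds the size of `M / u ^ N`. -/
theorem finite_quotient_pow_and_card_le {M : Type*} [CommRing M] (u : M)
    [Finite (M ⧸ Ideal.span {u})] (N : ℕ) :
    Finite (M ⧸ Ideal.span {u ^ N}) ∧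
      Nat.card (M ⧸ Ideal.span {u ^ N}) ≤ Nat.card (M ⧸ Ideal.span {u}) ^ N := by
  induction N with
  | zero =>
    have h : Subsingleton (M ⧸ Ideal.span {u ^ 0}) := by
      rw [Ideal.Quotient.subsingleton_iff]; simp
    exact ⟨inferInstance, by simp⟩
  | succ N ih =>
    obtain ⟨h1, h2⟩ := ih
    let φ : (M ⧸ Ideal.span {u}) × (M ⧸ Ideal.span {u ^ N}) → M ⧸ Ideal.span {u ^ (N + 1)} :=
      fun p => Ideal.Quotient.mk _ (p.1.out + u * p.2.out)
    have hφ : Function.Surjective φ := by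
      intro z
      obtain ⟨x, rfl⟩ := Ideal.Quotient.mk_surjective z
      have hout : ∀ (I : Ideal M) (y : M), ((Ideal.Quotient.mk I y).out : M) - y ∈ I := by
        intro I y
        rw [← Ideal.Quotient.eq]
        exact Quotient.out_eq _
      obtain ⟨x', hx'⟩ := Ideal.mem_span_singleton'.1 (hout (Ideal.span {u}) x)
      obtain ⟨x'', hx''⟩ := Ideal.mem_span_singleton'.1 (hout (Ideal.span {u ^ N}) (-x'))
      refine ⟨(Ideal.Quotient.mk _ x, Ideal.Quotient.mk _ (-x')), ?_⟩
      rw [Ideal.Quotient.eq, Ideal.mem_span_singleton']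
      refine ⟨x'', ?_⟩
      linear_combination u * hx'' + hx'
    refine ⟨Finite.of_surjective φ hφ, ?_⟩
    calc _ ≤ _ := Nat.card_le_card_of_surjective φ hφ
      _ = Nat.card (M ⧸ Ideal.span {u}) * Nat.card (M ⧸ Ideal.span {u ^ N}) := Nat.card_prod _ _
      _ ≤ Nat.card (M ⧸ Ideal.span {u}) * Nat.card (M ⧸ Ideal.span {u}) ^ N := by gcongr
      _ = _ := by ring

/-- Inverting a nonunit modulo `u` makes the quotient modulo `u` strictly smaller. -/
theorem finite_and_card_localization_quotient_lt {W M : Type*} [CommRing W] [CommRing M]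
    [Algebra W M] (u s : W) [IsLocalization.Away s M] [Finite (W ⧸ Ideal.span {u})]
    (hs : Ideal.span {s} ⊔ Ideal.span {u} ≠ ⊤) :
    Finite (M ⧸ Ideal.span {algebraMap W M u}) ∧
      Nat.card (M ⧸ Ideal.span {algebraMap W M u}) < Nat.card (W ⧸ Ideal.span {u}) := by
  let I := Ideal.span {u}
  let J := Ideal.span {algebraMap W M u}
  have hIJ : I ≤ J.comap (algebraMap W M) := by
    rw [Ideal.span_singleton_le_iff_mem]
    exact Ideal.mem_span_singleton_self _
  let φ : W ⧸ I →+* M ⧸ J := Ideal.quotientMap J (algebraMap W M) hIJ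
  have hsM : IsUnit (algebraMap W M s) := IsLocalization.Away.algebraMap_isUnit s
  -- two powers of `s` agree modulo `u`, and `s` is invertible in `M`, so `s⁻¹` is a power of `s`
  -- modulo `u`
  have hφs : ∃ r : W, (Ideal.Quotient.mk J (algebraMap W M (r * s))) = 1 := by
    obtain ⟨i, j, hij, h⟩ := Finite.exists_ne_map_eq_of_infinite
      (fun n : ℕ => Ideal.Quotient.mk I s ^ n)
    wlog hlt : i < j generalizing i j
    · exact this j i hij.symm h.symm (lt_of_le_of_ne (not_lt.1 hlt) hij.symm)
    obtain ⟨d, rfl⟩ := Nat.exists_eq_add_of_lt hlt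
    refine ⟨s ^ d, ?_⟩
    have h' := congrArg φ h
    simp only [map_pow] at h'
    have h1 : φ (Ideal.Quotient.mk I s) = Ideal.Quotient.mk J (algebraMap W M s) := rfl
    rw [h1, show i + d + 1 = i + (d + 1) by ring, pow_add] at h'
    have hu : IsUnit (Ideal.Quotient.mk J (algebraMap W M s) ^ i) := (hsM.map _).pow i
    have h2 := hu.mul_left_cancel ((mul_one _).trans h')
    rw [← pow_succ, map_pow, map_pow, ← h2]
  have hsurj : Function.Surjective φ := by
    intro z
    obtain ⟨m, rfl⟩ := Ideal.Quotient.mk_surjective z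
    obtain ⟨n, a, ha⟩ := IsLocalization.Away.surj s m
    obtain ⟨r, hr⟩ := hφs
    refine ⟨Ideal.Quotient.mk I (a * r ^ n), ?_⟩
    change Ideal.Quotient.mk J (algebraMap W M (a * r ^ n)) = _
    rw [map_mul, ← ha, map_mul, map_mul, map_pow, map_pow, map_pow, mul_assoc, ← mul_pow,
      ← map_mul, ← map_mul, mul_comm s, hr, one_pow, mul_one]
  have hfin : Finite (M ⧸ J) := Finite.of_surjective φ hsurj
  refine ⟨hfin, lt_of_le_of_ne (Nat.card_le_card_of_surjective φ hsurj) fun hcard => hs ?_⟩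
  have hinj : Function.Injective φ :=
    ((Nat.bijective_iff_surjective_and_card φ).2 ⟨hsurj, hcard.symm⟩).1
  obtain ⟨r, hr⟩ := hφs
  have h1 : Ideal.Quotient.mk I (r * s) = 1 := hinj (by rw [map_one]; exact hr)
  rw [← map_one (Ideal.Quotient.mk I), Ideal.Quotient.eq] at h1
  rw [Ideal.eq_top_iff_one]
  have h2 : r * s ∈ Ideal.span {s} ⊔ I :=
    Ideal.mem_sup_left (Ideal.mul_mem_left _ _ (Ideal.mem_span_singleton_self s))
  have := sub_mem h2 (Ideal.mem_sup_right (S := Ideal.span {s}) h1)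
  rwa [sub_sub_cancel] at this

theorem exists_pow_add_lt_pow {C Q : ℕ} (h : C < Q) (c : ℕ) : ∃ m, C ^ (m + c) < Q ^ m := by
  rcases Nat.eq_zero_or_pos C with rfl | hC
  · exact ⟨1, by rw [zero_pow (by omega), pow_one]; exact h⟩
  have h1 : (1 : ℚ) < Q / C := by
    rw [one_lt_div (by exact_mod_cast hC)]; exact_mod_cast h
  obtain ⟨m, hm⟩ := pow_unbounded_of_one_lt ((C : ℚ) ^ c) h1
  refine ⟨m, ?_⟩
  rw [div_pow, lt_div_iff₀ (by positivity)] at hm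
  rw [pow_add, mul_comm]
  exact_mod_cast hm

end Places

section Pole

open scoped IntermediateField.algebraAdjoinAdjoin
open IntermediateField Polynomial

variable {k K : Type*} [Field k] [Finite k] [Field K] [Algebra k K]

omit [Finite k] [Algebra k K] [Field k] in
theorem valuation_lt_one_of_inv_notMem (v : ValuationSubring K) {u : K} (hu0 : u ≠ 0)
    (hu : u⁻¹ ∉ v) : v.valuation u < 1 := by
  rw [← v.valuation_le_one_iff, not_le, map_inv₀] at hu
  exact (one_lt_inv₀ (zero_lt_iff.2 (v.valuation.ne_zero_iff.2 hu0))).1 hu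

omit [Finite k] [Algebra k K] [Field k] in
/-- Prime avoidance: some element of `W` vanishes at a given zero of `u` and at no other one. -/
theorem exists_valuation_eq_one_of_ne {W : Type*} [CommRing W] [IsDedekindDomain W] [Algebra W K]
    [IsFractionRing W K] (u : W) (hu : u ≠ 0) [Finite (W ⧸ Ideal.span {u})]
    (hW : ∀ v : ValuationSubring K, algebraMap W K u ∈ v → ∀ w : W, algebraMap W K w ∈ v)
    (v₀ : ValuationSubring K) (hv₀ : v₀.valuation (algebraMap W K u) < 1) :
    ∃ s : W, (∀ v : ValuationSubring K, v ≠ v₀ → v.valuation (algebraMap W K u) < 1 →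
      v.valuation (algebraMap W K s) = 1) ∧ Ideal.span {s} ⊔ Ideal.span {u} ≠ ⊤ := by
  have hle : ∀ v : ValuationSubring K, v.valuation (algebraMap W K u) < 1 → algebraMap W K u ∈ v :=
    fun v hv => (v.valuation_le_one_iff _).1 hv.le
  let P₀ : Ideal W := center v₀ (hW v₀ (hle v₀ hv₀))
  have hP₀ : u ∈ P₀ := (mem_center _ _ _).2 hv₀
  have hP₀bot : P₀ ≠ ⊥ := fun h => hu (by simpa [h] using hP₀)
  have hP₀max : P₀.IsMaximal := Ideal.IsPrime.isMaximal inferInstance hP₀bot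
  let PP : Set (Ideal W) := {P | P.IsPrime ∧ u ∈ P ∧ P ≠ P₀}
  have hfin : PP.Finite := by
    have hfinI : Finite (Ideal (W ⧸ Ideal.span {u})) :=
      Finite.of_injective (fun I => (I : Set (W ⧸ Ideal.span {u}))) SetLike.coe_injective
    refine (Set.finite_range (Ideal.comap (Ideal.Quotient.mk (Ideal.span {u})))).subset
      fun P hP => ⟨P.map (Ideal.Quotient.mk _), ?_⟩
    rw [Ideal.comap_map_of_surjective _ Ideal.Quotient.mk_surjective, ← RingHom.ker_eq_comap_bot,
      Ideal.mk_ker, sup_eq_left, Ideal.span_singleton_le_iff_mem]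
    exact hP.2.1
  have hnot : ¬ ((P₀ : Set W) ⊆ ⋃ P ∈ PP, (P : Set W)) := by
    intro h
    obtain ⟨P, hP, hle⟩ := (Ideal.subset_union_prime_finite hfin (f := id) ⊥ ⊥
      (fun P hP _ _ => hP.1)).1 h
    exact hP.2.2 (hP₀max.eq_of_le hP.1.ne_top hle).symm
  obtain ⟨s, hs, hs'⟩ := Set.not_subset.1 hnot
  refine ⟨s, fun v hv hvu => ?_, fun h => hP₀max.ne_top (top_unique (h ▸ sup_le ?_ ?_))⟩
  · have hvW := hW v (hle v hvu)
    by_contra hne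
    have hlt : v.valuation (algebraMap W K s) < 1 :=
      lt_of_le_of_ne ((v.valuation_le_one_iff _).2 (hvW s)) hne
    have hmem : center v hvW ∈ PP := ⟨inferInstance, (mem_center _ _ _).2 hvu, fun h =>
      hv (eq_of_center_eq hvW _ h (h ▸ hP₀bot))⟩
    exact hs' (Set.mem_biUnion hmem ((mem_center v hvW s).2 hlt))
  · rwa [Ideal.span_singleton_le_iff_mem]
  · rwa [Ideal.span_singleton_le_iff_mem]

/-- A polynomial in `y⁻¹` of degree less than `m`, multiplied by `y ^ m`, is a multiple of `y` where
`y` is integral. -/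
theorem exists_pow_mul_aeval_eq (v : ValuationSubring K) {y : K} (hy0 : y ≠ 0) (hy : y ∈ v)
    {m : ℕ} {p : k[X]} (hp : p.degree < m) : ∃ r ∈ v, y ^ m * aeval y⁻¹ p = y * r := by
  rcases Nat.eq_zero_or_pos m with rfl | hm
  · refine ⟨0, v.zero_mem, ?_⟩
    have : p = 0 := by simpa [Nat.WithBot.lt_zero_iff] using hp
    simp [this]
  have hp' : p.natDegree < m := by
    by_cases h0 : p = 0
    · simpa [h0] using hm
    · exact (natDegree_lt_iff_degree_lt h0).2 hp
  refine ⟨∑ i ∈ Finset.range m, algebraMap k K (p.coeff i) * y ^ (m - i - 1), ?_, ?_⟩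
  · exact sum_mem fun i _ => mul_mem (algebraMap_mem_valuationSubring v _) (pow_mem hy _)
  · rw [aeval_eq_sum_range' hp', Finset.mul_sum, Finset.mul_sum]
    refine Finset.sum_congr rfl fun i hi => ?_
    obtain ⟨j, rfl⟩ := Nat.exists_eq_add_of_lt (Finset.mem_range.1 hi)
    rw [show i + j + 1 - i - 1 = j by omega, Algebra.smul_def, inv_pow]
    field_simp
    ring

omit [Finite k] in
/-- A basis of `K` over `k(u)` consisting of elements integral over `k[u⁻¹]`, and a power of `u`
that makes all of them integral over `k[u]`. -/
theorem exists_basis_integral {u : K} (hu : u ≠ 0) [FiniteDimensional k⟮u⟯ K]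
    [FiniteDimensional k⟮u⁻¹⟯ K] :
    ∃ (e : Fin (Module.finrank k⟮u⟯ K) → K) (c : ℕ),
      LinearIndependent (Algebra.adjoin k {u}) e ∧
      (∀ i, IsIntegral (Algebra.adjoin k {u⁻¹}) (e i)) ∧
      ∀ i, IsIntegral (Algebra.adjoin k {u}) (u ^ c * e i) := by
  classical
  let b := Module.finBasis k⟮u⟯ K
  have hmem : ∀ r ∈ Algebra.adjoin k {u⁻¹}, r ∈ k⟮u⟯ := by
    intro r hr
    have h : u⁻¹ ∈ k⟮u⟯ := inv_mem (mem_adjoin_simple_self k u)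
    exact Algebra.adjoin_le (S := k⟮u⟯.toSubalgebra) (Set.singleton_subset_iff.2 h) hr
  have h1 : ∀ i, ∃ r : k⟮u⟯, r ≠ 0 ∧ IsIntegral (Algebra.adjoin k {u⁻¹}) (r • b i) := by
    intro i
    have halg : IsAlgebraic (Algebra.adjoin k {u⁻¹}) (b i) :=
      (IsFractionRing.isAlgebraic_iff _ k⟮u⁻¹⟯ K).2 (Algebra.IsAlgebraic.isAlgebraic _)
    obtain ⟨r, hr, hint⟩ := halg.exists_integral_multiple
    refine ⟨⟨r, hmem r r.2⟩, fun h => hr (Subtype.ext (congrArg (fun z : k⟮u⟯ => (z : K)) h)), ?_⟩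
    exact hint
  choose r hr hint using h1
  have h2 : LinearIndependent k⟮u⟯ (fun i => r i • b i) :=
    b.linearIndependent.units_smul (fun i => Units.mk0 (r i) (hr i))
  choose c hc using fun i => exists_pow_mul_isIntegral hu (hint i)
  refine ⟨fun i => r i • b i, Finset.univ.sup c, ?_, hint,
    fun i => hc i _ (Finset.le_sup (Finset.mem_univ i))⟩
  exact (LinearIndependent.iff_fractionRing (Algebra.adjoin k {u}) k⟮u⟯).2 h2

/-- If the quotient of `W` by `u` has at most `|k| ^ n` elements and `s` is not a unit modulo `u`,
then among the combinations of `n` elements of `W` with coefficients of degree less than `m` in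
`u` there is, for large `m`, one that is divisible by `u ^ (m + c)` after inverting `s`. -/
theorem exists_combination_mem_pow {R W : Type*} [CommRing R] [CommRing W] [Algebra k R]
    [Algebra R W] (u : R) (s : W) [Finite (W ⧸ Ideal.span {algebraMap R W u})]
    (hs : Ideal.span {s} ⊔ Ideal.span {algebraMap R W u} ≠ ⊤) {n : ℕ}
    (hcard : Nat.card (W ⧸ Ideal.span {algebraMap R W u}) ≤ Nat.card k ^ n) (e : Fin n → W)
    (c : ℕ) :
    ∃ (m : ℕ) (d : Fin n → degreeLT k m), d ≠ 0 ∧ ∃ (l : ℕ) (w : W),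
      s ^ l * ∑ i, algebraMap R W (aeval u (d i : k[X])) * e i =
        algebraMap R W u ^ (m + c) * w := by
  let M := Localization.Away s
  let uW := algebraMap R W u
  obtain ⟨hMfin, hMcard⟩ := finite_and_card_localization_quotient_lt (M := M) uW s hs
  obtain ⟨m, hm⟩ := exists_pow_add_lt_pow (hMcard.trans_le hcard) c
  obtain ⟨hNfin, hNcard⟩ := finite_quotient_pow_and_card_le (algebraMap W M uW) (m + c)
  let G := Fin n → degreeLT k m
  let ψ : G → W := fun g => ∑ i, algebraMap R W (aeval u (g i : k[X])) * e i
  let φ : G → M ⧸ Ideal.span {algebraMap W M uW ^ (m + c)} := fun g =>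
    Ideal.Quotient.mk _ (algebraMap W M (ψ g))
  have : Finite (degreeLT k m) := Finite.of_equiv _ (degreeLTEquiv k m).toEquiv.symm
  have hGcard : Nat.card G = (Nat.card k ^ n) ^ m := by
    rw [Nat.card_fun, Nat.card_congr (degreeLTEquiv k m).toEquiv, Nat.card_fun, Nat.card_fin,
      Nat.card_fin, ← pow_mul, ← pow_mul, mul_comm]
  have hnotinj : ¬ Function.Injective φ := by
    intro h
    have h1 := Nat.card_le_card_of_injective φ h
    rw [hGcard] at h1
    exact absurd (h1.trans hNcard) (not_le.2 hm)
  obtain ⟨g, g', hgg', hne⟩ : ∃ g g', φ g = φ g' ∧ g ≠ g' := by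
    simpa [Function.Injective] using hnotinj
  have hψd : ψ (g - g') = ψ g - ψ g' := by
    simp only [ψ, ← Finset.sum_sub_distrib, ← sub_mul, ← map_sub]
    rfl
  have hmem : algebraMap W M (ψ (g - g')) ∈ Ideal.span {algebraMap W M uW ^ (m + c)} := by
    rw [hψd, map_sub, ← Ideal.Quotient.eq]; exact hgg'
  rw [← map_pow, ← Set.image_singleton, ← Ideal.map_span,
    IsLocalization.algebraMap_mem_map_algebraMap_iff (Submonoid.powers s)] at hmem
  obtain ⟨_, ⟨l, rfl⟩, h⟩ := hmem
  obtain ⟨w, hw⟩ := Ideal.mem_span_singleton'.1 h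
  exact ⟨m, g - g', sub_ne_zero.2 hne, l, w, by rw [mul_comm _ w, hw]⟩

set_option maxHeartbeats 2000000 in
/-- A place of a function field of one variable over a finite field carries a nonconstant
function without any other pole. Let `u` vanish at the place and let `W` be the integral closure of
`k[u]`. After inverting an element of `W` which vanishes at the given place only, the quotient
modulo `u` has fewer than `|k| ^ n` elements, `n` being the degree of `K` over `k(u)`. So, among the
combinations of a basis with coefficients of degree less than `m` in `u`, two have the same
polar part away from the place as soon as `m` is large. -/
theorem exists_transcendental_mem_of_ne
    (hK : ∀ u : K, Transcendental k u → FiniteDimensional k⟮u⟯ K) (v₀ : ValuationSubring K)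
    (hv₀ : v₀ ≠ ⊤) : ∃ x : K, Transcendental k x ∧ ∀ v : ValuationSubring K, v ≠ v₀ → x ∈ v := by
  classical
  have halgmem : ∀ (v : ValuationSubring K) (z : K), IsAlgebraic k z → z ∈ v := fun v z hz =>
    mem_valuationSubring_of_isIntegral v (algebraMap_mem_valuationSubring v) hz.isIntegral
  obtain ⟨y, hy⟩ : ∃ y, y ∉ v₀ := by
    by_contra! h
    exact hv₀ (top_unique fun z _ => h z)
  have hy0 : y ≠ 0 := fun h => hy (h ▸ v₀.zero_mem)
  have hytr : Transcendental k y := fun h => hy (halgmem v₀ y h)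
  obtain ⟨u, rfl⟩ : ∃ u, y = u⁻¹ := ⟨y⁻¹, (inv_inv y).symm⟩
  have hu0 : u ≠ 0 := fun h => hy0 (by rw [h, inv_zero])
  have hutr : Transcendental k u := fun h => hytr h.inv
  have := hK u hutr
  have := hK u⁻¹ hytr
  have := adjoin_pid hutr
  have hv₀u : v₀.valuation u < 1 := valuation_lt_one_of_inv_notMem v₀ hu0 hy
  let R := Algebra.adjoin k {u}
  let u' : R := ⟨u, Algebra.self_mem_adjoin_singleton k u⟩
  have hu' : u' ≠ 0 := fun h => hu0 (congrArg Subtype.val h)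
  let W := integralClosure R K
  have hW : IsIntegrallyClosedIn W K := inferInstance
  have hRfin := fun a ha => finite_quotient_adjoin (k := k) (u := u) hutr a ha
  have : IsDedekindDomain W := isDedekindDomain_of_isIntegrallyClosedIn R k⟮u⟯ K W hRfin hW
  have : IsFractionRing W K := isFractionRing_of_isIntegrallyClosedIn R k⟮u⟯ K W hW
  have := hRfin u' hu'
  obtain ⟨hWfin, hWcard⟩ := finite_quotient_and_card_le R k⟮u⟯ K W u'
  rw [card_quotient_adjoin hutr] at hWcard
  set n := Module.finrank k⟮u⟯ K
  let uW : W := algebraMap R W u'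
  have huW : (uW : K) = u := rfl
  have huW0 : uW ≠ 0 := fun h => hu0 (congrArg Subtype.val h)
  have hWv : ∀ v : ValuationSubring K, u ∈ v → ∀ w : W, algebraMap W K w ∈ v := fun v hv w =>
    mem_valuationSubring_of_isIntegral v (algebraMap_adjoin_mem_valuationSubring v hv) w.2
  have hle : ∀ v : ValuationSubring K, v.valuation u < 1 → u ∈ v := fun v hv =>
    (v.valuation_le_one_iff u).1 hv.le
  obtain ⟨s, hsv, hs⟩ := exists_valuation_eq_one_of_ne uW huW0 hWv v₀ hv₀u
  obtain ⟨e, c, heind, heint, heW⟩ := exists_basis_integral (k := k) hu0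
  let e' : Fin n → W := fun i => ⟨u ^ c * e i, heW i⟩
  obtain ⟨m, d, hd, l, w, hlw⟩ := exists_combination_mem_pow u' s hs hWcard e' c
  let N := m + c
  let z : W := ∑ i, algebraMap R W (aeval u' (d i : k[X])) * e' i
  have haev : ∀ p : k[X], (aeval u' p : K) = aeval u p := fun p =>
    (aeval_algHom_apply R.val u' p).symm
  have hψK : (z : K) = ∑ i, aeval u (d i : k[X]) * (u ^ c * e i) := by
    simp only [z, AddSubmonoidClass.coe_finsetSum]
    refine Finset.sum_congr rfl fun i _ => ?_
    rw [← haev]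
    rfl
  have hψ0 : (z : K) ≠ 0 := by
    intro h
    have h1 : ∑ i, aeval u' (d i : k[X]) • e i = 0 := by
      rw [hψK] at h
      have h2 : u ^ c * ∑ i, aeval u' (d i : k[X]) • e i = 0 := by
        rw [← h, Finset.mul_sum]
        refine Finset.sum_congr rfl fun i _ => ?_
        rw [← haev, Algebra.smul_def]
        exact mul_left_comm _ _ _
      exact (mul_eq_zero.1 h2).resolve_left (pow_ne_zero _ hu0)
    have h3 := Fintype.linearIndependent_iff.1 heind _ h1
    refine hd (funext fun i => Subtype.ext ?_)
    by_contra hne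
    refine hutr ⟨d i, hne, ?_⟩
    rw [← haev, h3 i]
    rfl
  -- `z` is divisible by `u ^ N` at all zeros of `u` except the given one
  let x : K := z / u ^ N
  have hx0 : x ≠ 0 := div_ne_zero hψ0 (pow_ne_zero _ hu0)
  -- where `u` does not vanish, `x` is integral: polynomials in `u` of degree less than `m`, divided
  -- by `u ^ m`, are multiples of `u⁻¹`
  have hxy : ∀ v : ValuationSubring K, u⁻¹ ∈ v → ∃ r ∈ v, x = u⁻¹ * r := by
    intro v hv
    have h1 : ∀ i, ∃ r ∈ v, u⁻¹ ^ m * aeval u⁻¹⁻¹ (d i : k[X]) = u⁻¹ * r := fun i =>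
      exists_pow_mul_aeval_eq v hy0 hv (mem_degreeLT.1 (d i).2)
    choose r hr hr' using h1
    refine ⟨∑ i, r i * e i, sum_mem fun i _ => mul_mem (hr i)
      (mem_valuationSubring_of_isIntegral v (algebraMap_adjoin_mem_valuationSubring v hv)
        (heint i)), ?_⟩
    simp only [x, hψK, Finset.sum_div, Finset.mul_sum]
    refine Finset.sum_congr rfl fun i _ => ?_
    have h1 := hr' i
    rw [inv_inv, inv_pow] at h1
    rw [← mul_assoc u⁻¹, ← h1]
    simp only [N, pow_add]
    field_simp
  refine ⟨x, ?_, ?_⟩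
  · intro hxalg
    -- `x` vanishes at the zeros of `u⁻¹`, which exist, so it is not a constant
    obtain ⟨v, hv, hvy⟩ : ∃ v : ValuationSubring K, u⁻¹ ∈ v ∧ v.valuation u⁻¹ < 1 := by
      have := adjoin_pid hytr
      let B := Algebra.adjoin k {u⁻¹}
      let y' : B := ⟨u⁻¹, Algebra.self_mem_adjoin_singleton k u⁻¹⟩
      have htop : Ideal.span {y'} ≠ ⊤ := by
        intro h
        have h1 := card_quotient_adjoin hytr
        have h2 : Subsingleton (B ⧸ Ideal.span {y'}) := Ideal.Quotient.subsingleton_iff.2 h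
        have h3 : Nat.card (B ⧸ Ideal.span {y'}) = 1 := Nat.card_unique
        have h4 : 1 < Nat.card k := Finite.one_lt_card
        exact h4.ne (h3.symm.trans h1)
      obtain ⟨v, hv, hvI⟩ := Ideal.image_subset_nonunits_valuationSubring (A := B.toSubring) _ htop
      refine ⟨v, hv y'.2, ?_⟩
      rw [← ValuationSubring.mem_nonunits_iff]
      exact hvI ⟨y', Ideal.mem_span_singleton_self _, rfl⟩
    obtain ⟨r, hr, hxr⟩ := hxy v hv
    have h1 : v.valuation x < 1 := by
      rw [hxr, map_mul]
      exact (mul_le_of_le_one_right' ((v.valuation_le_one_iff r).2 hr)).trans_lt hvy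
    have h2 := (v.valuation_le_one_iff _).2 (halgmem v _ hxalg.inv)
    rw [map_inv₀, inv_le_one₀ (zero_lt_iff.2 (v.valuation.ne_zero_iff.2 hx0))] at h2
    exact absurd h1 (not_lt.2 h2)
  · intro v hv
    by_cases hvy : u⁻¹ ∈ v
    · obtain ⟨r, hr, hxr⟩ := hxy v hvy
      rw [hxr]
      exact mul_mem hvy hr
    · have hvu : v.valuation u < 1 := valuation_lt_one_of_inv_notMem v hu0 hvy
      have h1 : (s : K) ^ l * x = w := by
        have := congrArg (algebraMap W K) hlw
        simp only [map_mul, map_pow] at this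
        change (s : K) ^ l * z = u ^ N * w at this
        rw [← mul_div_assoc, this]
        field_simp
      have h2 := (v.valuation_le_one_iff _).2 (hWv v (hle v hvu) w)
      change v.valuation (w : K) ≤ 1 at h2
      have h3 : v.valuation (s : K) = 1 := hsv v hv hvu
      rw [← h1, map_mul, map_pow, h3, one_pow, one_mul] at h2
      exact (v.valuation_le_one_iff _).1 h2

end Pole

/-! ### Rings of `S`-integers are Dedekind domains -/

section SIntegers

open scoped IntermediateField.algebraAdjoinAdjoin
open IntermediateField Polynomial

variable {K : Type*} [Field K] (S : Set (Place K))

theorem mem_sIntegers {x : K} : x ∈ sIntegers K S ↔ ∀ v : Place K, v ∉ S → x ∈ v.1 := by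
  simp only [sIntegers, Subring.mem_iInf, Subtype.forall]
  rfl

theorem isIntegrallyClosedIn_sIntegers : IsIntegrallyClosedIn (sIntegers K S) K := by
  rw [Subring.isIntegrallyClosedIn_iff]
  intro x hx
  rw [mem_sIntegers]
  intro v hv
  exact mem_valuationSubring_of_isIntegral v.1 (fun r => (mem_sIntegers S).1 r.2 v hv) hx

/-- Rings of `S`-integers are Dedekind domains with fraction field `K`: they are integrally closed
and contain `ℤ` or, in the function field case, a polynomial ring `𝔽_p[x]`, where `x` has no pole
outside one place of `S`. -/
theorem isDedekindDomain_and_isFractionRing_sIntegers (hK : IsGlobalField K)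
    (hS : NumberField K ∨ S.Nonempty) :
    IsDedekindDomain (sIntegers K S) ∧ IsFractionRing (sIntegers K S) K := by
  have hcl := isIntegrallyClosedIn_sIntegers S
  by_cases hnf : NumberField K
  · have : FiniteDimensional ℚ K := hnf.to_finiteDimensional
    have hfin : ∀ a : ℤ, a ≠ 0 → Finite (ℤ ⧸ Ideal.span {a}) := fun a ha => by
      have : NeZero a.natAbs := ⟨by simpa using ha⟩
      exact Finite.of_equiv _ (Int.quotientSpanEquivZMod a).symm.toEquiv
    exact ⟨isDedekindDomain_of_isIntegrallyClosedIn ℤ ℚ K _ hfin hcl,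
      isFractionRing_of_isIntegrallyClosedIn ℤ ℚ K _ hcl⟩
  · obtain ⟨p, _, _, hfd, -⟩ := hK.resolve_left hnf
    let _ : Algebra (ZMod p) K :=
      ((algebraMap (RatFunc (ZMod p)) K).comp (algebraMap (ZMod p) (RatFunc (ZMod p)))).toAlgebra
    have : IsScalarTower (ZMod p) (RatFunc (ZMod p)) K :=
      IsScalarTower.of_algebraMap_eq fun _ => rfl
    obtain ⟨v₀, hv₀⟩ := hS.resolve_left hnf
    have hfd' : ∀ u : K, Transcendental (ZMod p) u → FiniteDimensional (ZMod p)⟮u⟯ K :=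
      fun u hu => finiteDimensional_adjoin_of_transcendental hu
    obtain ⟨x, hx, hxv⟩ := exists_transcendental_mem_of_ne hfd' v₀.1 v₀.2
    have := hfd' x hx
    have := adjoin_pid hx
    let R := Algebra.adjoin (ZMod p) {x}
    have hmem : ∀ r : R, algebraMap R K r ∈ sIntegers K S := fun r =>
      (mem_sIntegers S).2 fun v hv => algebraMap_adjoin_mem_valuationSubring v.1
        (hxv v.1 fun h => hv (Subtype.ext h ▸ hv₀)) r
    let _ : Algebra R (sIntegers K S) := ((algebraMap R K).codRestrict _ hmem).toAlgebra
    have : IsScalarTower R (sIntegers K S) K := IsScalarTower.of_algebraMap_eq fun _ => rfl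
    have hfin := fun a ha => finite_quotient_adjoin (k := ZMod p) (u := x) hx a ha
    exact ⟨isDedekindDomain_of_isIntegrallyClosedIn R (ZMod p)⟮x⟯ K _ hfin hcl,
      isFractionRing_of_isIntegrallyClosedIn R (ZMod p)⟮x⟯ K _ hcl⟩

end SIntegers

/-! ### The wedge product and oriented relative ideals -/

section Wedge

open scoped QuadraticAlgebra
open QuadraticAlgebra (omega)

variable {A K : Type*} [CommRing A] [Field K] [Algebra A K] {t : A}

theorem algebraNorm_eq (z : QAlg A K t) : Algebra.norm K z = z.norm := by
  rw [Algebra.norm_apply, ← QuadraticAlgebra.det_toLinearMap_eq_norm]; rfl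

theorem qNorm_eq (z : QAlg A K t) :
    Algebra.norm K z = z.re ^ 2 + algebraMap A K t * z.re * z.im + z.im ^ 2 := by
  rw [algebraNorm_eq, QuadraticAlgebra.norm_def]; ring

theorem algebraMap_qNorm (z : QAlg A K t) :
    algebraMap K (QAlg A K t) (Algebra.norm K z) = z * star z := by
  rw [algebraNorm_eq, QuadraticAlgebra.algebraMap_norm_eq_mul_star]

theorem re_smul_eq (c : A) (z : QAlg A K t) : (c • z).re = algebraMap A K c * z.re := by
  rw [← algebraMap_smul K c z]; rfl

theorem im_smul_eq (c : A) (z : QAlg A K t) : (c • z).im = algebraMap A K c * z.im := by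
  rw [← algebraMap_smul K c z]; rfl

theorem qOrder_smul_eq (r : QOrder A t) (z : QAlg A K t) : r • z = qMap A K t r * z := rfl

@[simp]
theorem re_qMap (r : QOrder A t) : (qMap A K t r).re = algebraMap A K r.re := rfl

@[simp]
theorem im_qMap (r : QOrder A t) : (qMap A K t r).im = algebraMap A K r.im := rfl

theorem smul_eq_algebraMap_smul (c : A) (z : QAlg A K t) :
    c • z = algebraMap A (QOrder A t) c • z := by
  rw [qOrder_smul_eq]
  ext <;> simp [Algebra.smul_def (A := K)]

theorem omega_mul_eq_smul (z : QAlg A K t) : omega * z = (omega : QOrder A t) • z := by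
  rw [qOrder_smul_eq]
  ext <;> simp

theorem wedge_mul (w x y : QAlg A K t) : wedge (w * x) (w * y) = Algebra.norm K w * wedge x y := by
  rw [qNorm_eq]; simp [wedge]; ring

/-- Multiplication by `T` has trace `t`, expressed through the wedge product. -/
theorem wedge_omega_mul (x y : QAlg A K t) :
    wedge (omega * x) y + wedge x (omega * y) = algebraMap A K t * wedge x y := by
  simp [wedge]; ring

theorem wedge_smul_left (c : A) (x y : QAlg A K t) :
    wedge (c • x) y = algebraMap A K c * wedge x y := by
  simp [wedge, Algebra.smul_def (A := K)]; ring

theorem wedge_smul_right (c : A) (x y : QAlg A K t) :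
    wedge x (c • y) = algebraMap A K c * wedge x y := by
  simp [wedge, Algebra.smul_def (A := K)]; ring

theorem wedge_add_left (x y z : QAlg A K t) : wedge (x + y) z = wedge x z + wedge y z := by
  simp [wedge]; ring

theorem wedge_add_right (x y z : QAlg A K t) : wedge x (y + z) = wedge x y + wedge x z := by
  simp [wedge]; ring

theorem wedge_self (x : QAlg A K t) : wedge x x = 0 := by
  simp [wedge]; ring

theorem wedge_swap (x y : QAlg A K t) : wedge y x = - wedge x y := by
  simp [wedge]; ring

/-- **Cramer's rule** for the wedge product. -/
theorem wedge_smul_eq (x y z : QAlg A K t) :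
    wedge x y • z = wedge z y • x + wedge x z • y := by
  ext <;> simp [wedge] <;> ring

theorem wedge_sum_sum (c d : Fin 2 → A) (x : Fin 2 → QAlg A K t) :
    wedge (∑ i, c i • x i) (∑ i, d i • x i) =
      algebraMap A K (c 0 * d 1 - c 1 * d 0) * wedge (x 0) (x 1) := by
  simp [Fin.sum_univ_two, wedge, Algebra.smul_def (A := K)]; ring

/-- An `A`-basis is an independent family: coordinates are determined. -/
theorem coord_eq_of_sum_eq [FaithfulSMul A K] {x : Fin 2 → QAlg A K t} (hx : wedge (x 0) (x 1) ≠ 0)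
    {c d : Fin 2 → A} (h : ∑ i, c i • x i = ∑ i, d i • x i) : c = d := by
  have hinj := FaithfulSMul.algebraMap_injective A K
  have h0 := congrArg (fun z => wedge z (x 1)) h
  have h1 := congrArg (fun z => wedge (x 0) z) h
  simp only [Fin.sum_univ_two, wedge_add_left, wedge_add_right, wedge_smul_left, wedge_smul_right,
    wedge_self, mul_zero, add_zero, zero_add] at h0 h1
  funext i
  fin_cases i
  · exact hinj (mul_right_cancel₀ hx h0)
  · exact hinj (mul_right_cancel₀ hx h1)

namespace OrientedIdeal

variable (I : OrientedIdeal A K t)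

theorem smul_mem {c : A} {z : QAlg A K t} (hz : z ∈ I.ideal) : c • z ∈ I.ideal := by
  rw [smul_eq_algebraMap_smul]
  exact Submodule.smul_mem (I.ideal : Submodule (QOrder A t) (QAlg A K t)) _ hz

theorem omega_mul_mem {z : QAlg A K t} (hz : z ∈ I.ideal) : omega * z ∈ I.ideal := by
  rw [omega_mul_eq_smul]
  exact Submodule.smul_mem (I.ideal : Submodule (QOrder A t) (QAlg A K t)) _ hz

theorem add_mem {y z : QAlg A K t} (hy : y ∈ I.ideal) (hz : z ∈ I.ideal) : y + z ∈ I.ideal :=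
  Submodule.add_mem (I.ideal : Submodule (QOrder A t) (QAlg A K t)) hy hz

theorem exists_wedge_eq_mul {x y : QAlg A K t} (hx : x ∈ I.ideal) (hy : y ∈ I.ideal) :
    ∃ a : A, wedge x y = algebraMap A K a * I.orient := by
  have h : wedge x y ∈ Submodule.span A {(I.orient : K)} := by
    rw [I.span_orient]
    exact Submodule.subset_span ⟨x, hx, y, hy, rfl⟩
  obtain ⟨a, ha⟩ := Submodule.mem_span_singleton.1 h
  exact ⟨a, by rw [← ha, Algebra.smul_def]⟩

/-- Two elements of an oriented ideal whose wedge product is the orientation form a basis. -/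
theorem mem_iff_of_wedge_eq {x : Fin 2 → QAlg A K t} (hx : ∀ i, x i ∈ I.ideal)
    (hw : wedge (x 0) (x 1) = (I.orient : K)) (z : QAlg A K t) :
    z ∈ I.ideal ↔ ∃ c : Fin 2 → A, z = ∑ i, c i • x i := by
  constructor
  · intro hz
    obtain ⟨a, ha⟩ := I.exists_wedge_eq_mul hz (hx 1)
    obtain ⟨b, hb⟩ := I.exists_wedge_eq_mul (hx 0) hz
    refine ⟨![a, b], ?_⟩
    have h := wedge_smul_eq (x 0) (x 1) z
    rw [hw, ha, hb] at h
    have hne : (I.orient : K) ≠ 0 := I.orient.ne_zero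
    have h' : (I.orient : K) • z = (I.orient : K) • (a • x 0 + b • x 1) := by
      rw [h, smul_add, ← algebraMap_smul K a, ← algebraMap_smul K b, smul_smul, smul_smul,
        mul_comm, mul_comm (algebraMap A K b)]
    rw [Fin.sum_univ_two]
    exact smul_right_injective _ hne h'
  · rintro ⟨c, rfl⟩
    rw [Fin.sum_univ_two]
    exact I.add_mem (I.smul_mem (hx 0)) (I.smul_mem (hx 1))

/-- The oriented ideal attached to a pair of vectors spanning an `A`-module stable under `T`. -/
noncomputable def ofBasis [IsDomain A] [IsFractionRing A K] (x : Fin 2 → QAlg A K t)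
    (hx : wedge (x 0) (x 1) ≠ 0) (ρ : Fin 2 → Fin 2 → A)
    (hρ : ∀ j, omega * x j = ∑ i, ρ i j • x i) : OrientedIdeal A K t where
  ideal := ⟨{ carrier := {z | ∃ c : Fin 2 → A, z = ∑ i, c i • x i}
              zero_mem' := ⟨0, by simp⟩
              add_mem' := by
                rintro _ _ ⟨c, rfl⟩ ⟨d, rfl⟩
                exact ⟨c + d, by simp [add_smul]; abel⟩
              smul_mem' := by
                rintro r _ ⟨c, rfl⟩
                refine ⟨fun i => r.re * c i + r.im * ∑ j, ρ i j * c j, ?_⟩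
                have h : ∀ z : QAlg A K t, r • z = r.re • z + r.im • (omega * z) := by
                  intro z
                  rw [qOrder_smul_eq]
                  ext
                  · simp [Algebra.smul_def (A := K)]
                  · simp [Algebra.smul_def (A := K)]
                    ring
                rw [h]
                simp only [Fin.sum_univ_two, mul_add, mul_smul_comm, hρ]
                module }, by
    obtain ⟨d, hd⟩ := IsLocalization.exist_integer_multiples_of_finite A⁰
      (fun p : Fin 2 × Fin 2 => if p.1 = 0 then (x p.2).re else (x p.2).im)
    have h : ∀ j, ∃ r : QOrder A t, algebraMap (QOrder A t) (QAlg A K t) r = (d : A) • x j := by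
      intro j
      obtain ⟨a, ha⟩ := hd (0, j)
      obtain ⟨b, hb⟩ := hd (1, j)
      refine ⟨⟨a, b⟩, ?_⟩
      ext
      · rw [re_smul_eq]
        exact ha.trans (Algebra.smul_def _ _)
      · rw [im_smul_eq]
        exact hb.trans (Algebra.smul_def _ _)
    choose r hr using h
    refine ⟨algebraMap A (QOrder A t) d,
      QuadraticAlgebra.algebraMap_mem_nonZeroDivisors_iff.2 d.2, ?_⟩
    rintro _ ⟨c, rfl⟩
    refine ⟨∑ i, algebraMap A (QOrder A t) (c i) * r i, ?_⟩
    rw [← smul_eq_algebraMap_smul, map_sum, Finset.smul_sum]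
    refine Finset.sum_congr rfl fun i _ => ?_
    rw [map_mul, hr, ← Algebra.smul_def, ← smul_eq_algebraMap_smul, smul_comm]⟩
  orient := Units.mk0 _ hx
  span_orient := by
    refine le_antisymm ?_ ?_
    · rw [Submodule.span_singleton_le_iff_mem]
      exact Submodule.subset_span ⟨x 0, ⟨![1, 0], by simp⟩, x 1, ⟨![0, 1], by simp⟩, rfl⟩
    · rw [Submodule.span_le]
      rintro _ ⟨_, ⟨c, rfl⟩, _, ⟨d, rfl⟩, rfl⟩
      rw [wedge_sum_sum]
      exact Submodule.mem_span_singleton.2 ⟨_, Algebra.smul_def _ _⟩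

end OrientedIdeal

end Wedge

/-! ### Oriented relative ideals and conjugacy classes of matrices -/

section Representation

open scoped QuadraticAlgebra
open QuadraticAlgebra (omega)

variable {A K : Type*} [CommRing A] [Field K] [Algebra A K] {t : A}

/-- The image of an oriented ideal under the coordinate map `x + yT ↦ y`. -/
noncomputable def OrientedIdeal.imIdeal (I : OrientedIdeal A K t) : FractionalIdeal A⁰ K :=
  ⟨{ carrier := {w | ∃ z ∈ I.ideal, w = z.im}
     zero_mem' := ⟨0, Submodule.zero_mem (I.ideal : Submodule (QOrder A t) (QAlg A K t)), rfl⟩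
     add_mem' := by
       rintro _ _ ⟨y, hy, rfl⟩ ⟨z, hz, rfl⟩
       exact ⟨y + z, I.add_mem hy hz, rfl⟩
     smul_mem' := by
       rintro c _ ⟨z, hz, rfl⟩
       exact ⟨c • z, I.smul_mem hz, rfl⟩ }, by
    obtain ⟨r, hr, h⟩ := I.ideal.isFractional
    refine ⟨r.norm, QuadraticAlgebra.norm_mem_nonZeroDivisors_iff.2 hr, ?_⟩
    rintro _ ⟨z, hz, rfl⟩
    obtain ⟨w, hw⟩ := h z hz
    refine ⟨(star r * w).im, ?_⟩
    have h1 : r.norm • z = (star r * w) • (1 : QAlg A K t) := by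
      rw [mul_smul, ← Algebra.algebraMap_eq_smul_one w, hw, smul_smul, smul_eq_algebraMap_smul,
        QuadraticAlgebra.algebraMap_norm_eq_mul_star, mul_comm]
    have h2 := congrArg QuadraticAlgebra.im h1
    rw [qOrder_smul_eq, mul_one, im_qMap] at h2
    exact h2.symm⟩

theorem OrientedIdeal.imIdeal_ne_zero (I : OrientedIdeal A K t) : I.imIdeal ≠ 0 := by
  intro h
  have him : ∀ z ∈ I.ideal, z.im = 0 := by
    intro z hz
    have h1 : z.im ∈ I.imIdeal := ⟨z, hz, rfl⟩
    rwa [h, FractionalIdeal.mem_zero_iff] at h1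
  have h2 : (I.orient : K) ∈
      Submodule.span A {w : K | ∃ x ∈ I.ideal, ∃ y ∈ I.ideal, w = wedge x y} := by
    rw [← I.span_orient]
    exact Submodule.mem_span_singleton_self _
  have h3 : Submodule.span A {w : K | ∃ x ∈ I.ideal, ∃ y ∈ I.ideal, w = wedge x y} ≤ ⊥ := by
    rw [Submodule.span_le]
    rintro _ ⟨x, hx, y, hy, rfl⟩
    simp [wedge, him x hx, him y hy]
  exact I.orient.ne_zero ((Submodule.mem_bot A).1 (h3 h2))

/-- Elements of the kernel of the coordinate map: if `c` is in the inverse of the image, then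
`c·(x ∧ y)` is an `A`-linear combination of `x` and `y`. -/
theorem OrientedIdeal.mk_mem_of_mem_span (I : OrientedIdeal A K t) {c : K}
    (hc : ∀ w ∈ I.imIdeal, ∃ a : A, algebraMap A K a = c * w) (a : A) :
    (⟨algebraMap A K a * I.orient * c, 0⟩ : QAlg A K t) ∈ I.ideal := by
  have key : ∀ w ∈ Submodule.span A {w : K | ∃ x ∈ I.ideal, ∃ y ∈ I.ideal, w = wedge x y},
      (⟨w * c, 0⟩ : QAlg A K t) ∈ I.ideal := by
    intro w hw
    induction hw using Submodule.span_induction with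
    | mem w hw =>
      obtain ⟨x, hx, y, hy, rfl⟩ := hw
      obtain ⟨a, ha⟩ := hc _ ⟨x, hx, rfl⟩
      obtain ⟨b, hb⟩ := hc _ ⟨y, hy, rfl⟩
      have h : (⟨wedge x y * c, 0⟩ : QAlg A K t) = b • x + (-a) • y := by
        ext
        · simp [Algebra.smul_def (A := K), ha, hb, wedge]; ring
        · simp [Algebra.smul_def (A := K), ha, hb]; ring
      rw [h]
      exact I.add_mem (I.smul_mem hx) (I.smul_mem hy)
    | zero =>
      rw [zero_mul]
      exact Submodule.zero_mem (I.ideal : Submodule (QOrder A t) (QAlg A K t))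
    | add x y _ _ hx hy =>
      have h : (⟨(x + y) * c, 0⟩ : QAlg A K t) = ⟨x * c, 0⟩ + ⟨y * c, 0⟩ := by
        ext <;> simp [add_mul]
      rw [h]
      exact I.add_mem hx hy
    | smul a x _ hx =>
      have h : (⟨(a • x) * c, 0⟩ : QAlg A K t) = a • ⟨x * c, 0⟩ := by
        ext <;> simp
      rw [h]
      exact I.smul_mem hx
  refine key _ ?_
  rw [← I.span_orient]
  exact Submodule.mem_span_singleton.2 ⟨a, Algebra.smul_def _ _⟩

variable [IsDedekindDomain A] [IsFractionRing A K]

/-- An oriented relative ideal is free as an `A`-module: the orientation is the wedge product of two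
elements. This is Steinitz's argument: the image of the ideal in `K` is generated by two elements
`α`, `β` with `α c + β d = 1` for some `c`, `d` in the inverse, and preimages of `α` and `β` can be
corrected by elements of the kernel. -/
theorem OrientedIdeal.exists_wedge_eq (I : OrientedIdeal A K t) :
    ∃ x : Fin 2 → QAlg A K t, (∀ i, x i ∈ I.ideal) ∧ wedge (x 0) (x 1) = (I.orient : K) := by
  have hJ := I.imIdeal_ne_zero
  obtain ⟨α, hα, hα0⟩ : ∃ α ∈ I.imIdeal, α ≠ 0 := by
    by_contra! h
    exact hJ (FractionalIdeal.eq_zero_iff.2 h)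
  obtain ⟨β, hβ⟩ := IsDedekindDomain.exists_add_spanSingleton_mul_eq (K := K)
    (a := FractionalIdeal.spanSingleton A⁰ α) (b := 1) (c := I.imIdeal)
    (FractionalIdeal.spanSingleton_le_iff_mem.2 hα)
    (FractionalIdeal.spanSingleton_ne_zero_iff.2 hα0) one_ne_zero
  rw [mul_one] at hβ
  have hβI : β ∈ I.imIdeal := by
    rw [← FractionalIdeal.spanSingleton_le_iff_mem, ← hβ]
    exact le_add_self
  obtain ⟨c, hc, d, hd, hcd⟩ : ∃ c ∈ I.imIdeal⁻¹, ∃ d ∈ I.imIdeal⁻¹, α * c + β * d = 1 := by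
    have h1 : (1 : K) ∈ I.imIdeal * I.imIdeal⁻¹ := by
      rw [mul_inv_cancel₀ hJ]; exact FractionalIdeal.one_mem_one _
    nth_rewrite 1 [← hβ] at h1
    rw [add_mul, FractionalIdeal.mem_add] at h1
    obtain ⟨u, hu, v, hv, huv⟩ := h1
    obtain ⟨c, hc, rfl⟩ := FractionalIdeal.mem_singleton_mul.1 hu
    obtain ⟨d, hd, rfl⟩ := FractionalIdeal.mem_singleton_mul.1 hv
    exact ⟨c, hc, d, hd, huv⟩
  have hinv : ∀ c ∈ I.imIdeal⁻¹, ∀ w ∈ I.imIdeal, ∃ a : A, algebraMap A K a = c * w := by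
    intro c hc w hw
    rw [FractionalIdeal.mem_inv_iff hJ] at hc
    obtain ⟨a, ha⟩ := (FractionalIdeal.mem_one_iff _).1 (hc w hw)
    exact ⟨a, ha⟩
  obtain ⟨x, hx, hxα⟩ := hα
  obtain ⟨y, hy, hyβ⟩ := hβI
  -- `x ∧ y` is `a` times the orientation; the corrections by kernel elements contribute `1 - a`
  obtain ⟨a, ha⟩ := I.exists_wedge_eq_mul hx hy
  have hm1 := I.mk_mem_of_mem_span (hinv c hc) (a - 1)
  have hm2 := I.mk_mem_of_mem_span (hinv d hd) (1 - a)
  refine ⟨![x + ⟨algebraMap A K (1 - a) * I.orient * d, 0⟩,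
    y + ⟨algebraMap A K (a - 1) * I.orient * c, 0⟩], ?_, ?_⟩
  · intro i
    fin_cases i
    · exact I.add_mem hx hm2
    · exact I.add_mem hy hm1
  · simp only [wedge, Matrix.cons_val_zero, Matrix.cons_val_one, QuadraticAlgebra.re_add,
      QuadraticAlgebra.im_add, add_zero, map_sub, map_one] at ha ⊢
    rw [← hxα, ← hyβ] at *
    linear_combination ha + (1 - algebraMap A K a) * I.orient * hcd

end Representation

section Represents

open scoped QuadraticAlgebra
open QuadraticAlgebra (omega)

variable {A K : Type*} [CommRing A] [Field K] [Algebra A K] {t : A}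

theorem charpoly_eq_iff_trace_eq [Nontrivial A] (ρ : SL(2, A)) :
    ρ.1.charpoly = Polynomial.X ^ 2 - Polynomial.C t * Polynomial.X + 1 ↔ ρ.1.trace = t := by
  rw [Matrix.charpoly_fin_two, ρ.2]
  constructor
  · intro h
    have := congrArg (fun p => Polynomial.coeff p 1) h
    simpa [Polynomial.coeff_one] using this
  · rintro rfl
    simp

theorem sum_smul_sum_smul {M : Type*} [AddCommGroup M] [Module A M]
    (P : Matrix (Fin 2) (Fin 2) A) (c : Fin 2 → A) (x : Fin 2 → M) :
    ∑ k, c k • ∑ i, P i k • x i = ∑ i, (P.mulVec c) i • x i := by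
  simp only [Fin.sum_univ_two, Matrix.mulVec, dotProduct]
  module

theorem sum_smul_sum_smul' {M : Type*} [AddCommGroup M] [Module A M]
    (P Q : Matrix (Fin 2) (Fin 2) A) (x : Fin 2 → M) (j : Fin 2) :
    ∑ k, Q k j • ∑ i, P i k • x i = ∑ i, (P * Q) i j • x i := by
  rw [sum_smul_sum_smul]
  rfl

theorem coe_mul_coe_inv (g : SL(2, A)) : g.1 * (g⁻¹).1 = 1 := by
  rw [← Matrix.SpecialLinearGroup.coe_mul, mul_inv_cancel, Matrix.SpecialLinearGroup.coe_one]

theorem coe_inv_mul_coe (g : SL(2, A)) : (g⁻¹).1 * g.1 = 1 := by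
  rw [← Matrix.SpecialLinearGroup.coe_mul, inv_mul_cancel, Matrix.SpecialLinearGroup.coe_one]

/-- Change of basis: conjugate matrices represent the same oriented ideals. -/
theorem Represents.conj {ρ : SL(2, A)} {I : OrientedIdeal A K t} (h : Represents ρ I)
    (g : SL(2, A)) : Represents (g * ρ * g⁻¹) I := by
  obtain ⟨x, hx, hw, hρ⟩ := h
  have h1 := coe_mul_coe_inv g
  have h2 := coe_inv_mul_coe g
  have h4 : (g⁻¹).1 * (g * ρ * g⁻¹).1 = ρ.1 * (g⁻¹).1 := by
    change (g⁻¹).1 * (g.1 * ρ.1 * (g⁻¹).1) = _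
    rw [← mul_assoc, ← mul_assoc, h2, one_mul]
  have hdet := (g⁻¹).2
  generalize (g⁻¹).1 = Q at *
  generalize (g * ρ * g⁻¹) = σ at *
  rw [Matrix.det_fin_two] at hdet
  refine ⟨fun j => ∑ i, Q i j • x i, fun z => ?_, ?_, fun j => ?_⟩
  · rw [hx]
    constructor
    · rintro ⟨c, rfl⟩
      refine ⟨g.1.mulVec c, ?_⟩
      rw [sum_smul_sum_smul Q, Matrix.mulVec_mulVec, h2, Matrix.one_mulVec]
    · rintro ⟨c, rfl⟩
      exact ⟨Q.mulVec c, sum_smul_sum_smul Q c x⟩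
  · rw [wedge_sum_sum, hw, mul_comm (Q 1 0), hdet, map_one, one_mul]
  · have h3 : omega * ∑ i, Q i j • x i = ∑ k, Q k j • ∑ i, ρ.1 i k • x i := by
      rw [Finset.mul_sum]
      refine Finset.sum_congr rfl fun k _ => ?_
      rw [mul_smul_comm, hρ]
    refine h3.trans ((sum_smul_sum_smul' ρ.1 Q x j).trans ?_)
    rw [← h4]
    exact (sum_smul_sum_smul' Q σ.1 x j).symm

/-- Multiplication by `τ` carries bases to bases. -/
theorem Represents.of_equivalent {ρ : SL(2, A)} {I J : OrientedIdeal A K t}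
    (h : Represents ρ I) (hIJ : I.Equivalent J) : Represents ρ J := by
  obtain ⟨x, hx, hw, hρ⟩ := h
  obtain ⟨τ, hτ, hor⟩ := hIJ
  refine ⟨fun i => τ * x i, fun z => ?_, ?_, fun j => ?_⟩
  · have h1 : z ∈ J.ideal ↔ (↑τ⁻¹ : QAlg A K t) * z ∈ I.ideal := by
      rw [← hτ, Units.mul_inv_cancel_left]
    rw [h1, hx]
    simp_rw [← mul_smul_comm, ← Finset.mul_sum, Units.inv_mul_eq_iff_eq_mul]
  · rw [wedge_mul, hw, hor]
  · rw [mul_left_comm, hρ, Finset.mul_sum]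
    simp_rw [mul_smul_comm]

/-- A matrix determines its oriented ideal up to equivalence: the linear map carrying one basis to
the other commutes with `T`, so it is a multiplication. -/
theorem Represents.equivalent {ρ : SL(2, A)} {I J : OrientedIdeal A K t} (htr : ρ.1.trace = t)
    (hI : Represents ρ I) (hJ : Represents ρ J) : I.Equivalent J := by
  obtain ⟨x, hx, hw, hρ⟩ := hI
  obtain ⟨y, hy, hwy, hσ⟩ := hJ
  have hI0 : (I.orient : K) ≠ 0 := I.orient.ne_zero
  have hJ0 : (J.orient : K) ≠ 0 := J.orient.ne_zero
  have htr' : algebraMap A K (ρ.1 0 0) + algebraMap A K (ρ.1 1 1) = algebraMap A K t := by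
    rw [← map_add, ← htr, Matrix.trace_fin_two]
  let f : QAlg A K t → QAlg A K t := fun z => wedge z (x 1) • y 0 + wedge (x 0) z • y 1
  have hadd : ∀ z z', f (z + z') = f z + f z' := fun z z' => by
    simp only [f, wedge_add_left, wedge_add_right]; module
  have hsmul : ∀ (c : K) z, f (c • z) = c • f z := fun c z => by
    have h1 : wedge (c • z) (x 1) = c * wedge z (x 1) := by simp [wedge]; ring
    have h2 : wedge (x 0) (c • z) = c * wedge (x 0) z := by simp [wedge]; ring
    simp only [f, h1, h2]; module
  have hom : ∀ z, f (omega * z) = omega * f z := by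
    intro z
    have h0 := hρ 0
    have h1 := hρ 1
    have e1 := wedge_omega_mul z (x 1)
    have e2 := wedge_omega_mul (x 0) z
    rw [h1, Fin.sum_univ_two, wedge_add_right, wedge_smul_right, wedge_smul_right,
      wedge_swap (x 0) z] at e1
    rw [h0, Fin.sum_univ_two, wedge_add_left, wedge_smul_left, wedge_smul_left,
      wedge_swap z (x 1)] at e2
    have e1' : wedge (omega * z) (x 1) = algebraMap A K (ρ.1 0 0) * wedge z (x 1) +
        algebraMap A K (ρ.1 0 1) * wedge (x 0) z := by
      linear_combination e1 - wedge z (x 1) * htr'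
    have e2' : wedge (x 0) (omega * z) = algebraMap A K (ρ.1 1 1) * wedge (x 0) z +
        algebraMap A K (ρ.1 1 0) * wedge z (x 1) := by
      linear_combination e2 - wedge (x 0) z * htr'
    simp only [f, mul_add, mul_smul_comm, hσ, Fin.sum_univ_two, e1', e2',
      ← algebraMap_smul K (_ : A) (_ : QAlg A K t)]
    module
  have hf : ∀ z, f z = z * f 1 := by
    intro z
    have h1 : z = z.re • (1 : QAlg A K t) + z.im • (omega * 1) := by
      ext <;> simp
    conv_lhs => rw [h1]
    rw [hadd, hsmul, hsmul, hom]
    conv_rhs => rw [h1]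
    rw [add_mul, smul_mul_assoc, smul_mul_assoc, one_mul, mul_one]
  have hf0 : f (x 0) = (I.orient : K) • y 0 := by simp [f, wedge_self, hw]
  have hf1 : f (x 1) = (I.orient : K) • y 1 := by simp [f, wedge_self, hw]
  let τ : QAlg A K t := (I.orient : K)⁻¹ • f 1
  have hτ0 : τ * x 0 = y 0 := by
    rw [smul_mul_assoc, mul_comm, ← hf, hf0, inv_smul_smul₀ hI0]
  have hτ1 : τ * x 1 = y 1 := by
    rw [smul_mul_assoc, mul_comm, ← hf, hf1, inv_smul_smul₀ hI0]
  have hτi : ∀ i, τ * x i = y i := fun i => by fin_cases i <;> assumption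
  have hN : (J.orient : K) = Algebra.norm K τ * I.orient := by
    rw [← hwy, ← hτ0, ← hτ1, wedge_mul, hw]
  have hu : IsUnit τ := by
    rw [QuadraticAlgebra.isUnit_iff_norm_isUnit, ← algebraNorm_eq, isUnit_iff_ne_zero]
    intro h
    rw [h, zero_mul] at hN
    exact hJ0 hN
  refine ⟨hu.unit, fun z => ?_, hN⟩
  rw [hx, hy]
  refine exists_congr fun c => ?_
  rw [IsUnit.unit_spec]
  simp_rw [← hτi, ← mul_smul_comm, ← Finset.mul_sum]
  exact hu.mul_right_inj

/-- Two matrices representing the same oriented ideal are conjugate under the change of basis. -/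
theorem Represents.isConj [FaithfulSMul A K] {ρ σ : SL(2, A)} {I : OrientedIdeal A K t}
    (hρ : Represents ρ I) (hσ : Represents σ I) : IsConj ρ σ := by
  obtain ⟨x, hx, hw, hρ⟩ := hρ
  obtain ⟨y, hy, hwy, hσ⟩ := hσ
  have hI0 : (I.orient : K) ≠ 0 := I.orient.ne_zero
  have h1 : ∀ j, ∃ c : Fin 2 → A, x j = ∑ i, c i • y i := fun j =>
    (hy _).1 ((hx _).2 ⟨Pi.single j 1, by simp [Pi.single_apply]⟩)
  choose c hc using h1
  have hdet : c 0 0 * c 1 1 - c 0 1 * c 1 0 = 1 := by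
    have := hw
    rw [hc, hc, wedge_sum_sum, hwy] at this
    exact FaithfulSMul.algebraMap_injective A K
      (mul_right_cancel₀ hI0 (by rw [this, map_one, one_mul]))
  let g : SL(2, A) := ⟨Matrix.of fun i j => c j i, by
    rw [Matrix.det_fin_two]
    simp only [Matrix.of_apply]
    linear_combination hdet⟩
  have hcg : ∀ j, x j = ∑ i, g.1 i j • y i := hc
  refine isConj_iff.2 ⟨g, ?_⟩
  rw [mul_inv_eq_iff_eq_mul]
  apply Subtype.ext
  change g.1 * ρ.1 = σ.1 * g.1
  ext i j
  have h2 : ∑ i, (g.1 * ρ.1) i j • y i = ∑ i, (σ.1 * g.1) i j • y i := by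
    rw [← sum_smul_sum_smul', ← sum_smul_sum_smul']
    simp_rw [← hcg, ← hσ, ← mul_smul_comm, ← Finset.mul_sum, ← hcg]
    rw [hρ]
  exact congrFun (coord_eq_of_sum_eq (by rw [hwy]; exact hI0) h2) i

/-- Inversion of the matrix corresponds to conjugation of the ideal. -/
theorem Represents.inv_of_star {ρ : SL(2, A)} {I J : OrientedIdeal A K t} (h : Represents ρ I)
    (hJ : ∀ z, z ∈ J.ideal ↔ star z ∈ I.ideal) (hor : (J.orient : K) = - I.orient) :
    Represents ρ⁻¹ J := by
  obtain ⟨x, hx, hw, hρ⟩ := h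
  have hst : ∀ (c : A) (z : QAlg A K t), star (c • z) = c • star z := fun c z => by
    ext <;> simp [smul_add]
  have hsw : wedge (star (x 0)) (star (x 1)) = - wedge (x 0) (x 1) := by
    simp [wedge]; ring
  refine ⟨fun i => star (x i), fun z => ?_, by rw [hsw, hw, hor], fun j => ?_⟩
  · rw [hJ, hx]
    refine exists_congr fun c => ?_
    rw [← star_inj, star_star, star_sum]
    simp_rw [hst]
  · have h1 : star (omega : QAlg A K t) * omega = 1 := by ext <;> simp
    have h2 : ∀ j, star (x j) = omega * ∑ i, ρ.1 i j • star (x i) := by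
      intro j
      have := congrArg star (hρ j)
      rw [star_mul, star_sum] at this
      simp_rw [hst] at this
      rw [← this, mul_comm (star (x j)), ← mul_assoc, mul_comm omega, h1, one_mul]
    have h3 := coe_mul_coe_inv ρ
    have h4 : ∑ k, (ρ⁻¹).1 k j • ∑ i, ρ.1 i k • star (x i) = star (x j) := by
      refine (sum_smul_sum_smul' ρ.1 (ρ⁻¹).1 (fun i => star (x i)) j).trans ?_
      rw [h3]
      simp [Matrix.one_apply]
    beta_reduce
    rw [← h4, Finset.mul_sum]
    refine Finset.sum_congr rfl fun k _ => ?_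
    rw [mul_smul_comm, ← h2]

end Represents

section Bijection

open scoped QuadraticAlgebra
open QuadraticAlgebra (omega)

variable {A K : Type*} [CommRing A] [IsDedekindDomain A] [Field K] [Algebra A K]
  [IsFractionRing A K] {t : A}

/-- A nonscalar matrix of trace `t` makes `K²` a free module of rank one over `K(Ψ)`. -/
theorem exists_represents (ht : t ^ 2 - 4 ≠ 0) (ρ : SL(2, A)) (htr : ρ.1.trace = t) :
    ∃ I : OrientedIdeal A K t, Represents ρ I := by
  have hinj := IsFractionRing.injective A K
  have hdet := ρ.2
  rw [Matrix.det_fin_two] at hdet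
  rw [Matrix.trace_fin_two] at htr
  obtain ⟨a, ha⟩ : ∃ a, ρ.1 0 0 = a := ⟨_, rfl⟩
  obtain ⟨b, hb⟩ : ∃ b, ρ.1 0 1 = b := ⟨_, rfl⟩
  obtain ⟨c, hc⟩ : ∃ c, ρ.1 1 0 = c := ⟨_, rfl⟩
  obtain ⟨d, hd⟩ : ∃ d, ρ.1 1 1 = d := ⟨_, rfl⟩
  rw [ha, hb, hc, hd] at hdet
  rw [ha, hd] at htr
  -- This form in `α`, `β` is the wedge product of the vectors `x 0`, `x 1` below, whose coordinates
  -- solve `T x₀ = a x₀ + c x₁`, `T x₁ = b x₀ + d x₁`. It vanishes identically for scalar `ρ` only.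
  obtain ⟨α, β, h⟩ : ∃ α β : A, c * α ^ 2 + (a - d) * α * β - b * β ^ 2 ≠ 0 := by
    by_contra! h
    have h1 := h 1 0
    have h2 := h 0 1
    have h3 := h 1 1
    apply ht
    have hc0 : c = 0 := by linear_combination h1
    have hb0 : b = 0 := by linear_combination -h2
    have had : a = d := by linear_combination h3 - hc0 + hb0
    rw [← htr]
    rw [hb0, hc0, ← had] at hdet
    rw [← had]
    linear_combination 4 * hdet
  let x : Fin 2 → QAlg A K t :=
    ![⟨algebraMap A K (α * c - β * d), algebraMap A K β⟩,
      ⟨algebraMap A K (β * b - α * a), algebraMap A K α⟩]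
  have hx : wedge (x 0) (x 1) ≠ 0 := by
    have : wedge (x 0) (x 1) =
        algebraMap A K (c * α ^ 2 + (a - d) * α * β - b * β ^ 2) := by
      simp [x, wedge]; ring
    rwa [this, Ne, map_eq_zero_iff _ hinj]
  have hK := congrArg (algebraMap A K) hdet
  have hKt := congrArg (algebraMap A K) htr
  simp only [map_sub, map_mul, map_one, map_add] at hK hKt
  have hω : ∀ j, omega * x j = ∑ i, ρ.1 i j • x i := by
    intro j
    fin_cases j
    · ext
      · simp [x, Fin.sum_univ_two, Algebra.smul_def (A := K), ha, hc]
        linear_combination algebraMap A K β * hK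
      · simp [x, Fin.sum_univ_two, Algebra.smul_def (A := K), ha, hc]
        linear_combination -algebraMap A K β * hKt
    · ext
      · simp [x, Fin.sum_univ_two, Algebra.smul_def (A := K), hb, hd]
        linear_combination algebraMap A K α * hK
      · simp [x, Fin.sum_univ_two, Algebra.smul_def (A := K), hb, hd]
        linear_combination -algebraMap A K α * hKt
  exact ⟨OrientedIdeal.ofBasis x hx ρ.1 hω, x, fun z => Iff.rfl, rfl, hω⟩

/-- Every oriented relative ideal is represented by a matrix of trace `t`. -/
theorem OrientedIdeal.exists_represents (I : OrientedIdeal A K t) :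
    ∃ ρ : SL(2, A), ρ.1.trace = t ∧ Represents ρ I := by
  have hinj := IsFractionRing.injective A K
  obtain ⟨x, hx, hw⟩ := I.exists_wedge_eq
  have hI0 : (I.orient : K) ≠ 0 := I.orient.ne_zero
  have hbasis := I.mem_iff_of_wedge_eq hx hw
  choose c hc using fun j => (hbasis _).1 (I.omega_mul_mem (hx j))
  have hdet : c 0 0 * c 1 1 - c 0 1 * c 1 0 = 1 := by
    have h1 : wedge (omega * x 0) (omega * x 1) = wedge (x 0) (x 1) := by
      rw [wedge_mul, qNorm_eq]; simp
    rw [hc, hc, wedge_sum_sum, hw] at h1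
    exact hinj (mul_right_cancel₀ hI0 (by rw [h1, map_one, one_mul]))
  have htr : c 0 0 + c 1 1 = t := by
    have h1 := wedge_omega_mul (x 0) (x 1)
    rw [hc, hc] at h1
    simp only [Fin.sum_univ_two, wedge_add_left, wedge_add_right, wedge_smul_left,
      wedge_smul_right, wedge_self, hw, mul_zero, add_zero, zero_add] at h1
    rw [← add_mul, ← map_add] at h1
    exact hinj (mul_right_cancel₀ hI0 h1)
  exact ⟨⟨Matrix.of fun i j => c j i, by
    rw [Matrix.det_fin_two]
    simp only [Matrix.of_apply]
    linear_combination hdet⟩, by rw [Matrix.trace_fin_two]; exact htr, x, hbasis, hw, hc⟩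

variable (A K t) in
/-- The correspondence between conjugacy classes of matrices and classes of oriented ideals. -/
theorem exists_equiv_represents {ℓ : ℕ} (ht : t ^ 2 - 4 ≠ 0)
    (hord : ∀ ρ : SL(2, A), ρ.1.trace = t → orderOf ρ = ℓ) :
    ∃ Φ : EltClasses ℓ t ≃ OrientedClasses A K t,
      ∀ (ρ : OrderElt ℓ t) (I : OrientedIdeal A K t), Φ ρ.cls = I.cls ↔ Represents ρ.1 I := by
  have htr : ∀ ρ : OrderElt ℓ t, ρ.1.1.trace = t := fun ρ =>
    (charpoly_eq_iff_trace_eq ρ.1).1 ρ.2.2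
  choose F hF using fun ρ : OrderElt ℓ t => SL2Conj.exists_represents (K := K) ht ρ.1 (htr ρ)
  have hwd : ∀ ρ σ : OrderElt ℓ t, ρ ≈ σ → (F ρ).cls = (F σ).cls := by
    intro ρ σ h
    obtain ⟨g, hg⟩ := isConj_iff.1 (show IsConj ρ.1 σ.1 from h)
    have h1 := (hF ρ).conj g
    rw [hg] at h1
    exact Quotient.sound (h1.equivalent (htr σ) (hF σ))
  let φ : EltClasses ℓ t → OrientedClasses A K t := Quotient.lift (fun ρ => (F ρ).cls) hwd
  have hφ : ∀ (ρ : OrderElt ℓ t) (I : OrientedIdeal A K t),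
      φ ρ.cls = I.cls ↔ Represents ρ.1 I := by
    intro ρ I
    constructor
    · intro h
      exact (hF ρ).of_equivalent (Quotient.exact h)
    · intro h
      exact Quotient.sound ((hF ρ).equivalent (htr ρ) h)
  refine ⟨Equiv.ofBijective φ ⟨?_, ?_⟩, hφ⟩
  · intro c d h
    induction c using Quotient.inductionOn with | _ ρ
    induction d using Quotient.inductionOn with | _ σ
    exact Quotient.sound (((hφ ρ (F σ)).1 h).isConj (hF σ))
  · intro C
    induction C using Quotient.inductionOn with | _ I
    obtain ⟨ρ, hρ, hI⟩ := I.exists_represents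
    exact ⟨OrderElt.cls ⟨ρ, hord ρ hρ, (charpoly_eq_iff_trace_eq ρ).2 hρ⟩, (hφ _ I).2 hI⟩

end Bijection

/-! ### Arithmetic of the polynomial `T² - tT + 1` -/

section Trace

open Polynomial

variable {A Ω : Type*} [CommRing A] [Field Ω] {φ : A →+* Ω} {ℓ : ℕ} {ζ : Ω} {t : A}

theorem ne_inv_of_isPrimitiveRoot (hℓ : ℓ.Prime) (hodd : Odd ℓ) (hζ : IsPrimitiveRoot ζ ℓ) :
    ζ ≠ ζ⁻¹ := by
  intro h
  have h0 : ζ ≠ 0 := hζ.ne_zero hℓ.ne_zero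
  have h2 : ζ ^ 2 = 1 := by
    rw [pow_two]; nth_rewrite 2 [h]; exact mul_inv_cancel₀ h0
  have h3 := Nat.le_of_dvd two_pos (hζ.dvd_of_pow_eq_one 2 h2)
  have := hℓ.two_le
  obtain ⟨k, hk⟩ := hodd
  omega

theorem sq_sub_four_ne_zero (hℓ : ℓ.Prime) (hodd : Odd ℓ) (hζ : IsPrimitiveRoot ζ ℓ)
    (ht : φ t = ζ + ζ⁻¹) : t ^ 2 - 4 ≠ 0 := by
  intro h
  have h0 : ζ ≠ 0 := hζ.ne_zero hℓ.ne_zero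
  have h1 := congrArg φ h
  simp only [map_sub, map_pow, map_ofNat, map_zero, ht] at h1
  have h2 : (ζ - ζ⁻¹) ^ 2 = 0 := by
    have := mul_inv_cancel₀ h0
    linear_combination h1 - 4 * this
  exact ne_inv_of_isPrimitiveRoot hℓ hodd hζ (sub_eq_zero.1 (pow_eq_zero_iff two_ne_zero |>.1 h2))

/-- `T² - tT + 1` divides the cyclotomic polynomial `1 + T + ⋯ + T^(ℓ-1)`. -/
theorem dvd_geom_sum (hφ : Function.Injective φ) (hℓ : ℓ.Prime) (hodd : Odd ℓ)
    (hζ : IsPrimitiveRoot ζ ℓ) (ht : φ t = ζ + ζ⁻¹) :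
    X ^ 2 - C t * X + 1 ∣ ∑ i ∈ Finset.range ℓ, (X : A[X]) ^ i := by
  have hA : Nontrivial A := φ.domain_nontrivial
  have h0 : ζ ≠ 0 := hζ.ne_zero hℓ.ne_zero
  have hmonic : (X ^ 2 - C t * X + 1 : A[X]).Monic := by
    monicity!
  rw [← Polynomial.map_dvd_map φ hφ hmonic]
  have h1 : (X ^ 2 - C t * X + 1 : A[X]).map φ = (X - C ζ) * (X - C ζ⁻¹) := by
    have h2 : (C ζ : Polynomial Ω) * C ζ⁻¹ = 1 := by rw [← C_mul, mul_inv_cancel₀ h0, C_1]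
    simp only [Polynomial.map_add, Polynomial.map_sub, Polynomial.map_pow, Polynomial.map_mul,
      map_X, map_C, Polynomial.map_one, ht, C_add]
    linear_combination -h2
  rw [h1]
  refine IsCoprime.mul_dvd (isCoprime_X_sub_C_of_isUnit_sub
    (sub_ne_zero.2 (ne_inv_of_isPrimitiveRoot hℓ hodd hζ)).isUnit) ?_ ?_
  · rw [dvd_iff_isRoot]
    simpa [Polynomial.map_sum, eval_finsetSum] using hζ.geom_sum_eq_zero hℓ.one_lt
  · rw [dvd_iff_isRoot]
    simpa [Polynomial.map_sum, eval_finsetSum, -inv_pow] using hζ.inv.geom_sum_eq_zero hℓ.one_lt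

/-- Evaluation of the cyclotomic polynomial at `1`. -/
theorem two_sub_dvd (hφ : Function.Injective φ) (hℓ : ℓ.Prime) (hodd : Odd ℓ)
    (hζ : IsPrimitiveRoot ζ ℓ) (ht : φ t = ζ + ζ⁻¹) : t - 2 ∣ (ℓ : A) := by
  obtain ⟨q, hq⟩ := dvd_geom_sum hφ hℓ hodd hζ ht
  have := congrArg (eval 1) hq
  simp [eval_finsetSum] at this
  exact ⟨-q.eval 1, by rw [this]; ring⟩

/-- Evaluation of the cyclotomic polynomial at `-1`, where it takes the value `1`. -/
theorem isUnit_add_two (hφ : Function.Injective φ) (hℓ : ℓ.Prime) (hodd : Odd ℓ)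
    (hζ : IsPrimitiveRoot ζ ℓ) (ht : φ t = ζ + ζ⁻¹) : IsUnit (t + 2) := by
  obtain ⟨q, hq⟩ := dvd_geom_sum hφ hℓ hodd hζ ht
  have := congrArg (eval (-1)) hq
  simp only [eval_finsetSum, eval_pow, eval_X, neg_one_geom_sum,
    if_neg (Nat.not_even_iff_odd.2 hodd), eval_mul, eval_add, eval_sub, eval_C, eval_one] at this
  exact IsUnit.of_mul_eq_one (q.eval (-1)) (by linear_combination -this)

theorem isUnit_sq_sub_four (hφ : Function.Injective φ) (hℓ : ℓ.Prime) (hodd : Odd ℓ)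
    (hζ : IsPrimitiveRoot ζ ℓ) (ht : φ t = ζ + ζ⁻¹) (hu : IsUnit (ℓ : A)) :
    IsUnit (t ^ 2 - 4) := by
  have h1 : t ^ 2 - 4 = (t - 2) * (t + 2) := by ring
  rw [h1]
  exact (isUnit_of_dvd_unit (two_sub_dvd hφ hℓ hodd hζ ht) hu).mul
    (isUnit_add_two hφ hℓ hodd hζ ht)

theorem orderOf_eq_of_trace_eq (hφ : Function.Injective φ) (hℓ : ℓ.Prime) (hodd : Odd ℓ)
    (hζ : IsPrimitiveRoot ζ ℓ) (ht : φ t = ζ + ζ⁻¹) (ρ : SL(2, A)) (hρ : ρ.1.trace = t) :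
    orderOf ρ = ℓ := by
  have hA : Nontrivial A := φ.domain_nontrivial
  have : Fact ℓ.Prime := ⟨hℓ⟩
  refine orderOf_eq_prime ?_ ?_
  · have h1 : X ^ 2 - C t * X + 1 ∣ (X : A[X]) ^ ℓ - 1 := by
      rw [← geom_sum_mul]
      exact (dvd_geom_sum hφ hℓ hodd hζ ht).mul_right _
    rw [← (charpoly_eq_iff_trace_eq ρ).2 hρ] at h1
    obtain ⟨q, hq⟩ := h1
    have h2 := congrArg (aeval ρ.1) hq
    rw [map_mul, Matrix.aeval_self_charpoly, zero_mul, map_sub, map_pow, aeval_X, map_one,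
      sub_eq_zero] at h2
    apply Subtype.ext
    exact (Matrix.SpecialLinearGroup.coe_pow ρ ℓ).trans h2
  · rintro rfl
    apply sq_sub_four_ne_zero hℓ hodd hζ ht
    rw [← hρ]
    simp
    norm_num

/-- Under the unramifiedness condition, the discriminant `t² - 4` is not divisible by the square
of a nonzero prime. A prime `P` dividing it contains `t - 2`, and the prime of `ℤ[t]` below `P` is
contained in `(t - 2)A`, so ramification index one forces `t - 2` to generate `P` locally. -/
theorem notMem_sq_of_unramifiedAtEll [IsDomain A] [IsNoetherianRing A]
    (hφ : Function.Injective φ) (hℓ : ℓ.Prime) (hodd : Odd ℓ)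
    (hζ : IsPrimitiveRoot ζ ℓ) (ht : φ t = ζ + ζ⁻¹) (hun : UnramifiedAtEll t)
    (P : Ideal A) [hP : P.IsPrime] (hP0 : P ≠ ⊥) : t ^ 2 - 4 ∉ P ^ 2 := by
  intro hd
  have hdP : t ^ 2 - 4 ∈ P := Ideal.pow_le_self two_ne_zero hd
  have hu := isUnit_add_two hφ hℓ hodd hζ ht
  have hfac : t ^ 2 - 4 = (t + 2) * (t - 2) := by ring
  have h2P : t - 2 ∈ P := by
    rw [hfac] at hdP
    exact (Ideal.unit_mul_mem_iff_mem P hu).1 hdP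
  have h2P2 : t - 2 ∈ P ^ 2 := by
    rw [hfac] at hd
    exact (Ideal.unit_mul_mem_iff_mem _ hu).1 hd
  have hℓP : (ℓ : A) ∈ P := Ideal.mem_of_dvd _ (two_sub_dvd hφ hℓ hodd hζ ht) h2P
  -- `P` meets the integers in `ℓℤ`, and `t - 2` divides `ℓ`
  have hint : ∀ n : ℤ, (n : A) ∈ P → t - 2 ∣ (n : A) := by
    intro n hn
    by_cases h : (ℓ : ℤ) ∣ n
    · obtain ⟨m, rfl⟩ := h
      push_cast
      exact (two_sub_dvd hφ hℓ hodd hζ ht).mul_right _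
    · exfalso
      obtain ⟨u, v, huv⟩ := (Prime.coprime_iff_not_dvd (Nat.prime_iff_prime_int.1 hℓ)).2 h
      apply hP.ne_top
      rw [Ideal.eq_top_iff_one]
      have h1 := congrArg (Int.cast : ℤ → A) huv
      push_cast at h1
      rw [← h1]
      exact P.add_mem (P.mul_mem_left _ hℓP) (P.mul_mem_left _ hn)
  -- every element of `ℤ[t]` is an integer modulo `t - 2`
  have hunder : ∀ f : Algebra.adjoin ℤ {t}, f ∈ P.under (Algebra.adjoin ℤ {t}) →
      t - 2 ∣ (f : A) := by
    rintro ⟨f, hf⟩ hfP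
    change f ∈ P at hfP
    change t - 2 ∣ f
    rw [Algebra.adjoin_singleton_eq_range_aeval] at hf
    obtain ⟨q, rfl⟩ := hf
    have h1 : t - 2 ∣ aeval t q - (q.eval 2 : ℤ) := by
      have := Polynomial.sub_dvd_eval_sub t 2 (q.map (Int.castRingHom A))
      rw [← eval₂_eq_eval_map, ← eval₂_eq_eval_map,
        show (2 : A) = Int.castRingHom A 2 by simp, eval₂_at_apply] at this
      simpa [aeval_def] using this
    have h2 : ((q.eval 2 : ℤ) : A) ∈ P := by
      have := P.sub_mem hfP (Ideal.mem_of_dvd _ h1 h2P)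
      simpa using this
    have := dvd_add h1 (hint _ h2)
    simpa using this
  have hram := hun P hP hdP
  rw [Ideal.ramificationIdx_def] at hram
  let m := IsLocalRing.maximalIdeal (Localization.AtPrime P)
  have hlen := (ENat.toNat_eq_iff one_ne_zero).1 hram
  rw [Nat.cast_one, Module.length_eq_one_iff, isSimpleModule_iff_isCoatom] at hlen
  have hmax := IsLocalRing.eq_maximalIdeal (Ideal.isMaximal_def.2 hlen)
  have hmm : m = P.map (algebraMap A (Localization.AtPrime P)) :=
    (Localization.AtPrime.map_eq_maximalIdeal).symm
  -- ramification index one means that the prime below `P` generates `m`; it is contained in `m ^ 2`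
  have hle : m ≤ m ^ 2 := by
    change IsLocalRing.maximalIdeal _ ≤ _
    rw [← hmax, Ideal.map_le_iff_le_comap]
    intro f hf
    rw [Ideal.mem_comap, IsScalarTower.algebraMap_apply _ A, hmm, ← Ideal.map_pow]
    exact Ideal.mem_map_of_mem _ (Ideal.mem_of_dvd _ (hunder f hf) h2P2)
  have hbot : m = ⊥ := by
    refine Submodule.eq_bot_of_le_smul_of_le_jacobson_bot m m (IsNoetherian.noetherian m) ?_ ?_
    · rwa [smul_eq_mul, ← pow_two]
    · rw [IsLocalRing.jacobson_eq_maximalIdeal _ bot_ne_top]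
  rw [hmm, Ideal.map_eq_bot_iff_of_injective
    (IsLocalization.injective _ P.primeCompl_le_nonZeroDivisors)] at hbot
  exact hP0 hbot

/-- If `t² - 4` is squarefree, an element `x + yT` of `K(Ψ)` with trace and norm in `A` has
coordinates in `A`. -/
theorem mem_range_of_trace_norm {K : Type*} [Field K] [Algebra A K] [IsDedekindDomain A]
    [IsFractionRing A K] (hd : ∀ P : Ideal A, P.IsPrime → P ≠ ⊥ → t ^ 2 - 4 ∉ P ^ 2)
    {x y : K} (h1 : 2 * x + algebraMap A K t * y ∈ (algebraMap A K).range)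
    (h2 : x ^ 2 + algebraMap A K t * x * y + y ^ 2 ∈ (algebraMap A K).range) :
    x ∈ (algebraMap A K).range ∧ y ∈ (algebraMap A K).range := by
  obtain ⟨a, ha⟩ := h1
  obtain ⟨b, hb⟩ := h2
  have hy : y ∈ (algebraMap A K).range := by
    refine IsDedekindDomain.HeightOneSpectrum.mem_integers_of_valuation_le_one K y fun v => ?_
    by_contra! hv
    have hy0 : v.valuation K y ≠ 0 := (zero_lt_one.trans hv).ne'
    have hd1 : ¬ v.valuation K (algebraMap A K (t ^ 2 - 4)) ≤ WithZero.exp (-(2 : ℕ) : ℤ) := by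
      rw [v.valuation_of_algebraMap, v.intValuation_le_pow_iff_mem]
      exact hd _ v.isPrime v.ne_bot
    -- `(t² - 4) y²` is the discriminant of the characteristic polynomial of `x + yT`
    have hd2 : v.valuation K (algebraMap A K (t ^ 2 - 4)) * v.valuation K y ^ 2 ≤ 1 := by
      rw [← map_pow, ← map_mul]
      have : algebraMap A K (t ^ 2 - 4) * y ^ 2 = algebraMap A K (a ^ 2 - 4 * b) := by
        simp only [map_sub, map_pow, map_mul, ha, hb, map_ofNat]; ring
      rw [this]
      exact v.valuation_le_one _
    have hd0 : v.valuation K (algebraMap A K (t ^ 2 - 4)) ≠ 0 := by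
      intro h
      rw [h] at hd1
      exact hd1 zero_le
    generalize v.valuation K (algebraMap A K (t ^ 2 - 4)) = D at *
    generalize v.valuation K y = Y at *
    have e1 : D = WithZero.exp (WithZero.log D) := (WithZero.exp_log hd0).symm
    have e2 : Y = WithZero.exp (WithZero.log Y) := (WithZero.exp_log hy0).symm
    rw [e1] at hd1 hd2
    rw [e2] at hd2 hv
    rw [← WithZero.exp_zero, WithZero.exp_lt_exp] at hv
    rw [WithZero.exp_le_exp] at hd1
    rw [← WithZero.exp_nsmul, ← WithZero.exp_add, ← WithZero.exp_zero, WithZero.exp_le_exp] at hd2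
    simp only [nsmul_eq_mul] at hd2
    push_cast at *
    omega
  refine ⟨?_, hy⟩
  obtain ⟨c, hc⟩ := hy
  refine IsIntegrallyClosed.isIntegral_iff.1
    ⟨X ^ 2 + C (t * c) * X + C (c ^ 2 - b), by monicity!, ?_⟩
  simp only [eval₂_add, eval₂_sub, eval₂_mul, eval₂_pow, eval₂_X, eval₂_C, C_sub, map_mul, map_pow,
    hb, hc]
  ring

end Trace

/-! ### Traces in `SL₂` and elements of order `ℓ` -/

section Matrices

variable {A : Type*} [CommRing A]

theorem trace_inv (g : SL(2, A)) : (g⁻¹).1.trace = g.1.trace := by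
  change (g.1.adjugate).trace = _
  rw [Matrix.adjugate_fin_two, Matrix.trace_fin_two_of, Matrix.trace_fin_two, add_comm]

theorem trace_conj (g h : SL(2, A)) : (g * h * g⁻¹).1.trace = h.1.trace := by
  rw [Matrix.SpecialLinearGroup.coe_mul, Matrix.trace_mul_comm, ← Matrix.SpecialLinearGroup.coe_mul,
    ← mul_assoc, inv_mul_cancel, one_mul]

/-- The Cayley–Hamilton identity in the form `g⁻¹ = tr(g) - g`. -/
theorem coe_inv_eq (g : SL(2, A)) : (g⁻¹).1 = g.1.trace • (1 : Matrix (Fin 2) (Fin 2) A) - g.1 := by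
  change g.1.adjugate = _
  rw [Matrix.adjugate_fin_two, Matrix.trace_fin_two]
  ext i j
  fin_cases i <;> fin_cases j <;> simp

theorem trace_mul_self_mul (g h : SL(2, A)) :
    (g * (g * h)).1.trace = g.1.trace * (g * h).1.trace - h.1.trace := by
  have h1 : g.1 * g.1 = g.1.trace • g.1 - 1 := by
    have h2 := coe_inv_mul_coe g
    rw [coe_inv_eq, sub_mul, smul_mul_assoc, one_mul] at h2
    rw [← h2, sub_sub_cancel]
  change (g.1 * (g.1 * h.1)).trace = g.1.trace * (g.1 * h.1).trace - h.1.trace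
  rw [← mul_assoc, h1, sub_mul, one_mul, Matrix.trace_sub, smul_mul_assoc, Matrix.trace_smul,
    smul_eq_mul]

theorem trace_pow_eq {Ω : Type*} [Field Ω] (φ : A →+* Ω) {g : SL(2, A)} {z : Ω} (hz : z ≠ 0)
    (hg : φ g.1.trace = z + z⁻¹) (n : ℕ) : φ (g ^ n).1.trace = z ^ n + z⁻¹ ^ n := by
  induction n using Nat.twoStepInduction with
  | zero =>
    simp [one_add_one_eq_two]
    exact map_ofNat φ 2
  | one => simpa using hg
  | more n h1 h2 =>
    have h3 := trace_mul_self_mul g (g ^ n)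
    rw [← pow_succ', ← pow_succ'] at h3
    rw [h3, map_sub, map_mul, hg, h1, h2]
    have := mul_inv_cancel₀ hz
    linear_combination (z ^ n + z⁻¹ ^ n) * this

/-- An element of `SL₂` satisfying `g^ℓ = 1` has trace `z + z⁻¹` for an `ℓ`-th root of unity `z`. -/
theorem exists_trace_eq_of_pow_eq_one {Ω : Type*} [Field Ω] (φ : A →+* Ω) {ℓ : ℕ} {ζ : Ω}
    (hℓ : 0 < ℓ) (hζ : IsPrimitiveRoot ζ ℓ) {g : SL(2, A)} (hg : g ^ ℓ = 1) :
    ∃ z : Ω, z ^ ℓ = 1 ∧ φ g.1.trace = z + z⁻¹ := by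
  let M : Matrix (Fin 2) (Fin 2) Ω := g.1.map φ
  have hM : M ^ ℓ = 1 := by
    have h1 := congrArg (fun h : SL(2, A) => h.1.map φ) hg
    have h2 : (g ^ ℓ).1.map φ = M ^ ℓ := by
      rw [Matrix.SpecialLinearGroup.coe_pow]
      exact map_pow φ.mapMatrix g.1 ℓ
    rw [← h2, h1]
    ext i j
    fin_cases i <;> fin_cases j <;> simp
  let f : Polynomial Ω →* Ω := Matrix.detMonoidHom.comp
    ((Polynomial.aeval M : Polynomial Ω →ₐ[Ω] _) : Polynomial Ω →* Matrix (Fin 2) (Fin 2) Ω)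
  have hf : ∀ q, f q = (Polynomial.aeval M q).det := fun _ => rfl
  have h1 := congrArg f (Polynomial.X_pow_sub_one_eq_prod hℓ hζ)
  rw [hf, map_sub, map_pow, Polynomial.aeval_X, map_one, hM, sub_self,
    Matrix.det_zero, map_prod, eq_comm, Finset.prod_eq_zero_iff] at h1
  obtain ⟨z, hz, hdet⟩ := h1
  rw [hf] at hdet
  have hzℓ := (Polynomial.mem_nthRootsFinset hℓ 1).1 hz
  refine ⟨z, hzℓ, ?_⟩
  have hz0 : z ≠ 0 := by
    rintro rfl
    rw [zero_pow hℓ.ne'] at hzℓ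
    exact zero_ne_one hzℓ
  have hd := congrArg φ g.2
  rw [Matrix.det_fin_two] at hd hdet
  simp [M, Matrix.algebraMap_eq_diagonal] at hd hdet
  rw [Matrix.trace_fin_two, map_add]
  field_simp
  linear_combination hd - hdet


/-- The relation between order `ℓ` and trace `t` in `SL₂(A)`: elements of trace `t` have order `ℓ`,
and in every subgroup of order `ℓ` the elements of trace `t` are some `ρ` and its inverse. -/
structure IsOrderTrace (ℓ : ℕ) (t : A) : Prop where
  prime : ℓ.Prime
  odd : Odd ℓ
  disc_ne_zero : t ^ 2 - 4 ≠ 0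
  orderOf_eq : ∀ ρ : SL(2, A), ρ.1.trace = t → orderOf ρ = ℓ
  eq_or_eq_inv : ∀ ρ σ : SL(2, A), ρ.1.trace = t → σ.1.trace = t → σ ∈ Subgroup.zpowers ρ →
    σ = ρ ∨ σ = ρ⁻¹
  exists_mem : ∀ Γ : Subgroup SL(2, A), Nat.card Γ = ℓ → ∃ ρ ∈ Γ, ρ.1.trace = t

/-- The trace `ζ + ζ⁻¹` characterizes, up to inversion, one element of each group of order `ℓ`: the
traces of its nontrivial elements are `ζᵏ + ζ⁻ᵏ`. -/
theorem isOrderTrace_of_isPrimitiveRoot {Ω : Type*} [Field Ω] {φ : A →+* Ω} {ℓ : ℕ} {ζ : Ω}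
    {t : A} (hφ : Function.Injective φ) (hℓ : ℓ.Prime) (hodd : Odd ℓ) (hℓ0 : (ℓ : Ω) ≠ 0)
    (hζ : IsPrimitiveRoot ζ ℓ) (ht : φ t = ζ + ζ⁻¹) : IsOrderTrace ℓ t := by
  have hζ0 : ζ ≠ 0 := hζ.ne_zero hℓ.ne_zero
  have hord := orderOf_eq_of_trace_eq hφ hℓ hodd hζ ht
  have : Fact ℓ.Prime := ⟨hℓ⟩
  refine ⟨hℓ, hodd, sq_sub_four_ne_zero hℓ hodd hζ ht, hord, ?_, ?_⟩
  · intro ρ σ hρ hσ hmem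
    have hfin : IsOfFinOrder ρ := by
      rw [← orderOf_pos_iff, hord ρ hρ]; exact hℓ.pos
    obtain ⟨k, rfl⟩ := hfin.mem_powers_iff_mem_zpowers.2 hmem
    change (ρ ^ k).1.trace = t at hσ
    have h1 := trace_pow_eq φ hζ0 (by rw [hρ, ht]) k
    rw [hσ, ht] at h1
    have h2 : (ζ ^ k - ζ) * (ζ ^ k * ζ - 1) = 0 := by
      have e1 := mul_inv_cancel₀ hζ0
      have e2 : ζ ^ k * ζ⁻¹ ^ k = 1 := by rw [← mul_pow, e1, one_pow]
      linear_combination -ζ ^ k * ζ * h1 + ζ ^ k * e1 - ζ * e2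
    rcases mul_eq_zero.1 h2 with h3 | h3
    · left
      have h4 : ζ ^ k = ζ ^ 1 := by rw [pow_one]; exact sub_eq_zero.1 h3
      rw [hζ.isOfFinOrder hℓ.ne_zero |>.pow_eq_pow_iff_modEq, ← hζ.eq_orderOf, ← hord ρ hρ,
        ← pow_eq_pow_iff_modEq, pow_one] at h4
      exact h4
    · right
      have h4 : ζ ^ (k + 1) = 1 := by rw [pow_succ]; exact sub_eq_zero.1 h3
      have h5 := hζ.dvd_of_pow_eq_one _ h4
      rw [← hord ρ hρ, orderOf_dvd_iff_pow_eq_one, pow_succ] at h5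
      exact eq_inv_of_mul_eq_one_left h5
  · intro Γ hΓ
    have hfin : Finite Γ := Nat.finite_of_card_ne_zero (by rw [hΓ]; exact hℓ.ne_zero)
    have hnt : Nontrivial Γ := by
      rw [← Finite.one_lt_card_iff_nontrivial, hΓ]
      exact hℓ.one_lt
    obtain ⟨⟨g, hgΓ⟩, hg1⟩ := exists_ne (1 : Γ)
    have hg1' : g ≠ 1 := fun h => hg1 (Subtype.ext h)
    have hgℓ : g ^ ℓ = 1 := by
      have := pow_card_eq_one' (x := (⟨g, hgΓ⟩ : Γ))
      rw [hΓ] at this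
      exact congrArg Subtype.val this
    obtain ⟨z, hz, hzt⟩ := exists_trace_eq_of_pow_eq_one φ hℓ.pos hζ hgℓ
    have hz0 : z ≠ 0 := by
      rintro rfl
      rw [zero_pow hℓ.ne_zero] at hz
      exact zero_ne_one hz
    have hz1 : z ≠ 1 := by
      rintro rfl
      -- a unipotent element of finite order `ℓ` is trivial because `ℓ` is invertible
      have htr : g.1.trace = 2 := hφ (by rw [hzt, map_ofNat]; norm_num)
      have hsq : (g.1 - 1) * (g.1 - 1) = 0 := by
        have h2 := coe_inv_mul_coe g
        rw [coe_inv_eq, htr] at h2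
        have h3 : ∀ M : Matrix (Fin 2) (Fin 2) A,
            (M - 1) * (M - 1) = 1 - ((2 : A) • 1 - M) * M := by
          intro M
          rw [two_smul]
          noncomm_ring
        rw [h3, h2, sub_self]
      have hpow : ∀ n : ℕ, g.1 ^ n = 1 + (n : A) • (g.1 - 1) := by
        intro n
        induction n with
        | zero => simp
        | succ n ih =>
          rw [pow_succ, ih]
          have : (1 + (n : A) • (g.1 - 1)) * g.1 =
              (1 + (n : A) • (g.1 - 1)) * (1 + (g.1 - 1)) := by rw [add_sub_cancel]
          rw [this, mul_add, mul_one, add_mul, one_mul, smul_mul_assoc, hsq, smul_zero]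
          push_cast
          module
      have h3 := hpow ℓ
      rw [← Matrix.SpecialLinearGroup.coe_pow, hgℓ, Matrix.SpecialLinearGroup.coe_one,
        left_eq_add] at h3
      apply hg1'
      apply Subtype.ext
      ext i j
      have h4 := congrArg φ (congrFun (congrFun h3 i) j)
      simp only [Matrix.smul_apply, smul_eq_mul, map_mul, map_natCast, Matrix.zero_apply, map_zero,
        mul_eq_zero, hℓ0, false_or] at h4
      have h5 := hφ (h4.trans (map_zero φ).symm)
      exact sub_eq_zero.1 h5
    have hzp : IsPrimitiveRoot z ℓ := by
      rw [IsPrimitiveRoot.iff_orderOf]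
      exact orderOf_eq_prime hz hz1
    obtain ⟨k, -, hk⟩ := hzp.eq_pow_of_pow_eq_one hζ.pow_eq_one
    refine ⟨g ^ k, Γ.pow_mem hgΓ k, hφ ?_⟩
    rw [trace_pow_eq φ hz0 hzt, ht, ← hk, inv_pow]

end Matrices

/-! ### Centralizers and normalizers -/

section Centralizer

/-- A matrix commuting with a nonscalar matrix `N` of size two is a polynomial in `N`. -/
theorem exists_eq_smul_add_of_commute {K : Type*} [Field K] {M N : Matrix (Fin 2) (Fin 2) K}
    (hN : ¬ (N 0 1 = 0 ∧ N 1 0 = 0 ∧ N 0 0 = N 1 1)) (h : M * N = N * M) :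
    ∃ x y : K, M = x • (1 : Matrix (Fin 2) (Fin 2) K) + y • N := by
  have h00 := congrFun (congrFun h 0) 0
  have h01 := congrFun (congrFun h 0) 1
  have h10 := congrFun (congrFun h 1) 0
  simp only [Matrix.mul_apply, Fin.sum_univ_two] at h00 h01 h10
  have key : ∀ e : K, e ≠ 0 → ∀ f : K, e * M 0 1 = f * N 0 1 → e * M 1 0 = f * N 1 0 →
      e * (M 0 0 - M 1 1) = f * (N 0 0 - N 1 1) →
      ∃ x y : K, M = x • (1 : Matrix (Fin 2) (Fin 2) K) + y • N := by
    intro e he f e1 e2 e3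
    refine ⟨M 0 0 - f / e * N 0 0, f / e, ?_⟩
    ext i j
    fin_cases i <;> fin_cases j
    · simp
    · simp
      field_simp
      linear_combination e1
    · simp
      field_simp
      linear_combination e2
    · simp
      field_simp
      linear_combination -e3
  by_cases h1 : N 0 1 = 0
  · by_cases h2 : N 1 0 = 0
    · have h3 : N 0 0 - N 1 1 ≠ 0 := fun h3 => hN ⟨h1, h2, sub_eq_zero.1 h3⟩
      exact key _ h3 (M 0 0 - M 1 1) (by linear_combination -h01) (by linear_combination h10)
        (by ring)
    · exact key _ h2 (M 1 0) (by linear_combination h00) (by ring) (by linear_combination -h10)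
  · exact key _ h1 (M 0 1) (by ring) (by linear_combination -h00) (by linear_combination h01)

variable {A : Type*} [CommRing A] {t : A}

theorem coe_mul_coe_self (ρ : SL(2, A)) : ρ.1 * ρ.1 = ρ.1.trace • ρ.1 - 1 := by
  have h2 := coe_inv_mul_coe ρ
  rw [coe_inv_eq, sub_mul, smul_mul_assoc, one_mul] at h2
  rw [← h2, sub_sub_cancel]

theorem algebraNorm_qOrder (z : QOrder A t) :
    Algebra.norm A z = z.re ^ 2 + t * z.re * z.im + z.im ^ 2 := by
  have : Algebra.norm A z = z.norm := by
    rw [Algebra.norm_apply, ← QuadraticAlgebra.det_toLinearMap_eq_norm]; rfl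
  rw [this, QuadraticAlgebra.norm_def]; ring

theorem mem_ker_normUnits {u : (QOrder A t)ˣ} :
    u ∈ (normUnits A t).ker ↔ Algebra.norm A (u : QOrder A t) = 1 := by
  rw [MonoidHom.mem_ker, ← Units.val_inj]; rfl

theorem det_smul_one_add_smul (ρ : SL(2, A)) (x y : A) :
    (x • (1 : Matrix (Fin 2) (Fin 2) A) + y • ρ.1).det = x ^ 2 + ρ.1.trace * x * y + y ^ 2 := by
  have hd := ρ.2
  rw [Matrix.det_fin_two] at hd
  rw [Matrix.det_fin_two, Matrix.trace_fin_two]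
  simp
  linear_combination y ^ 2 * hd

/-- The matrices `x + yρ` for the norm one elements `x + yT` of `A[T]/(T² - tT + 1)`. -/
noncomputable def centralizerHom (ρ : SL(2, A)) (hρ : ρ.1.trace = t) :
    (normUnits A t).ker →* SL(2, A) where
  toFun u := ⟨(u.1 : QOrder A t).re • (1 : Matrix (Fin 2) (Fin 2) A) + (u.1 : QOrder A t).im • ρ.1,
    by rw [det_smul_one_add_smul, hρ, ← algebraNorm_qOrder]; exact mem_ker_normUnits.1 u.2⟩
  map_one' := by
    apply Subtype.ext
    simp [QuadraticAlgebra.re_one, QuadraticAlgebra.im_one]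
  map_mul' u v := by
    apply Subtype.ext
    have h := coe_mul_coe_self ρ
    rw [hρ] at h
    change ((u * v).1 : QOrder A t).re • (1 : Matrix (Fin 2) (Fin 2) A) +
        ((u * v).1 : QOrder A t).im • ρ.1 =
      ((u.1 : QOrder A t).re • (1 : Matrix (Fin 2) (Fin 2) A) + (u.1 : QOrder A t).im • ρ.1) *
        ((v.1 : QOrder A t).re • (1 : Matrix (Fin 2) (Fin 2) A) + (v.1 : QOrder A t).im • ρ.1)
    generalize ρ.1 = M at h
    simp only [Subgroup.coe_mul, Units.val_mul, QuadraticAlgebra.re_mul, QuadraticAlgebra.im_mul]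
    simp only [add_mul, mul_add, smul_mul_assoc, mul_smul_comm, one_mul, mul_one, h]
    module

theorem centralizerHom_coe (ρ : SL(2, A)) (hρ : ρ.1.trace = t) (u : (normUnits A t).ker) :
    (centralizerHom ρ hρ u).1 = (u.1 : QOrder A t).re • (1 : Matrix (Fin 2) (Fin 2) A) +
      (u.1 : QOrder A t).im • ρ.1 := rfl

theorem not_scalar (ht : t ^ 2 - 4 ≠ 0) (ρ : SL(2, A)) (hρ : ρ.1.trace = t) :
    ¬ (ρ.1 0 1 = 0 ∧ ρ.1 1 0 = 0 ∧ ρ.1 0 0 = ρ.1 1 1) := by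
  rintro ⟨h1, h2, h3⟩
  have hd := ρ.2
  rw [Matrix.det_fin_two] at hd
  apply ht
  rw [← hρ, Matrix.trace_fin_two]
  linear_combination 4 * hd + (ρ.1 0 0 - ρ.1 1 1) * h3 + 4 * ρ.1 1 0 * h1

theorem centralizerHom_injective [IsDomain A] (ht : t ^ 2 - 4 ≠ 0) (ρ : SL(2, A))
    (hρ : ρ.1.trace = t) : Function.Injective (centralizerHom ρ hρ) := by
  intro u v h
  have hM := congrArg Subtype.val h
  change (centralizerHom ρ hρ u).1 = (centralizerHom ρ hρ v).1 at hM
  rw [centralizerHom_coe, centralizerHom_coe] at hM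
  have h00 := congrFun (congrFun hM 0) 0
  have h01 := congrFun (congrFun hM 0) 1
  have h10 := congrFun (congrFun hM 1) 0
  have h11 := congrFun (congrFun hM 1) 1
  simp at h00 h01 h10 h11
  have him : (u.1 : QOrder A t).im = (v.1 : QOrder A t).im := by
    have hns := not_scalar ht ρ hρ
    by_contra hne
    apply hns
    refine ⟨h01.resolve_left hne, h10.resolve_left hne, ?_⟩
    exact mul_left_cancel₀ (sub_ne_zero.2 hne) (by linear_combination h00 - h11)
  have hre : (u.1 : QOrder A t).re = (v.1 : QOrder A t).re := by
    linear_combination h00 - ρ.1 0 0 * him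
  exact Subtype.ext (Units.ext (QuadraticAlgebra.ext hre him))

/-- The centralizer of a matrix of trace `t`, as soon as elements of `K(Ψ)` with trace and norm in
`A` lie in `A[T]/(Ψ)`. -/
theorem range_centralizerHom [IsDomain A] {K : Type*} [Field K] [Algebra A K] [FaithfulSMul A K]
    (ht : t ^ 2 - 4 ≠ 0)
    (hH : ∀ x y : K, 2 * x + algebraMap A K t * y ∈ (algebraMap A K).range →
      x ^ 2 + algebraMap A K t * x * y + y ^ 2 ∈ (algebraMap A K).range →
      x ∈ (algebraMap A K).range ∧ y ∈ (algebraMap A K).range)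
    (ρ : SL(2, A)) (hρ : ρ.1.trace = t) :
    (centralizerHom ρ hρ).range = Subgroup.centralizer {ρ} := by
  have hinj := FaithfulSMul.algebraMap_injective A K
  ext g
  rw [Subgroup.mem_centralizer_singleton_iff]
  constructor
  · rintro ⟨u, rfl⟩
    apply Subtype.ext
    change (centralizerHom ρ hρ u).1 * ρ.1 = ρ.1 * (centralizerHom ρ hρ u).1
    rw [centralizerHom_coe]
    simp [add_mul, mul_add]
  · intro hg
    have hg' : g.1 * ρ.1 = ρ.1 * g.1 := congrArg Subtype.val hg
    obtain ⟨x, y, hxy⟩ := exists_eq_smul_add_of_commute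
      (M := (algebraMap A K).mapMatrix g.1) (N := (algebraMap A K).mapMatrix ρ.1)
      (by
        have := not_scalar ht ρ hρ
        simpa [hinj.eq_iff, map_eq_zero_iff _ hinj] using this)
      (by rw [← map_mul, ← map_mul, hg'])
    have hcoord : ∀ i j, algebraMap A K (g.1 i j) =
        x * (1 : Matrix (Fin 2) (Fin 2) K) i j + y * algebraMap A K (ρ.1 i j) :=
      fun i j => congrFun (congrFun hxy i) j
    have hdet := congrArg (algebraMap A K) g.2
    have hdetρ := congrArg (algebraMap A K) ρ.2
    have htr : algebraMap A K (ρ.1 0 0) + algebraMap A K (ρ.1 1 1) = algebraMap A K t := by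
      rw [← map_add, ← Matrix.trace_fin_two, hρ]
    have e00 := hcoord 0 0
    have e01 := hcoord 0 1
    have e10 := hcoord 1 0
    have e11 := hcoord 1 1
    simp at e00 e01 e10 e11
    simp only [Matrix.det_fin_two, map_sub, map_mul, map_one] at hdet hdetρ
    have hnorm : x ^ 2 + algebraMap A K t * x * y + y ^ 2 = 1 := by
      rw [e00, e01, e10, e11] at hdet
      rw [← htr]
      linear_combination hdet - y ^ 2 * hdetρ
    obtain ⟨⟨a, rfl⟩, ⟨b, rfl⟩⟩ := hH x y
      ⟨g.1 0 0 + g.1 1 1, by rw [map_add, e00, e11, ← htr]; ring⟩ ⟨1, by rw [map_one, hnorm]⟩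
    have hab : Algebra.norm A (⟨a, b⟩ : QOrder A t) = 1 := by
      rw [algebraNorm_qOrder]
      apply hinj
      simpa using hnorm
    have hu : IsUnit (⟨a, b⟩ : QOrder A t) := by
      rw [QuadraticAlgebra.isUnit_iff_norm_isUnit, QuadraticAlgebra.norm_def]
      rw [algebraNorm_qOrder] at hab
      exact IsUnit.of_mul_eq_one 1 (by linear_combination hab)
    refine ⟨⟨hu.unit, mem_ker_normUnits.2 hab⟩, ?_⟩
    apply Subtype.ext
    change (centralizerHom ρ hρ _).1 = g.1
    rw [centralizerHom_coe]
    ext i j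
    apply hinj
    rw [hcoord]
    simp [Matrix.one_apply, apply_ite (algebraMap A K)]

/-- If `g` inverts `ρ` under conjugation, then `g` has trace zero, by the polarized Cayley–Hamilton
identity. -/
theorem sq_eq_neg_one_of_conj_eq_inv [IsDomain A] (ht : t ^ 2 - 4 ≠ 0) {ρ g : SL(2, A)}
    (hρ : ρ.1.trace = t) (hg : g * ρ * g⁻¹ = ρ⁻¹) : g ^ 2 = -1 := by
  have h0 : g * ρ = ρ⁻¹ * g := mul_inv_eq_iff_eq_mul.1 hg
  have h1 : g.1 * ρ.1 = (ρ⁻¹).1 * g.1 := congrArg Subtype.val h0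
  rw [coe_inv_eq, hρ] at h1
  have h00 := congrFun (congrFun h1 0) 0
  have h01 := congrFun (congrFun h1 0) 1
  have h10 := congrFun (congrFun h1 1) 0
  have h11 := congrFun (congrFun h1 1) 1
  have htr : ρ.1 0 0 + ρ.1 1 1 = t := by rw [← Matrix.trace_fin_two, hρ]
  simp [Matrix.mul_apply, Fin.sum_univ_two] at h00 h01 h10 h11
  have htrg : g.1.trace = 0 := by
    rw [Matrix.trace_fin_two]
    by_contra hne
    refine not_scalar ht ρ hρ ⟨?_, ?_, ?_⟩
    · refine mul_left_cancel₀ hne ?_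
      linear_combination h01 - g.1 0 1 * htr
    · refine mul_left_cancel₀ hne ?_
      linear_combination h10 - g.1 1 0 * htr
    · refine mul_left_cancel₀ hne ?_
      linear_combination h00 - h11 - (g.1 0 0 - g.1 1 1) * htr
  apply Subtype.ext
  rw [pow_two]
  change g.1 * g.1 = _
  rw [coe_mul_coe_self, htrg, zero_smul, zero_sub]
  rfl

theorem conj_centralizerHom {ρ g : SL(2, A)} (hρ : ρ.1.trace = t) (hg : g * ρ * g⁻¹ = ρ⁻¹)
    (u : (normUnits A t).ker) :
    g * centralizerHom ρ hρ u * g⁻¹ = centralizerHom ρ hρ u⁻¹ := by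
  rw [map_inv]
  apply Subtype.ext
  have h1 : g.1 * ρ.1 * (g⁻¹).1 = (ρ⁻¹).1 := congrArg Subtype.val hg
  change g.1 * (centralizerHom ρ hρ u).1 * (g⁻¹).1 = ((centralizerHom ρ hρ u)⁻¹).1
  rw [coe_inv_eq (centralizerHom ρ hρ u), centralizerHom_coe, mul_add, add_mul, mul_smul_comm,
    mul_smul_comm, mul_one, smul_mul_assoc, smul_mul_assoc, h1, coe_mul_coe_inv, coe_inv_eq ρ,
    Matrix.trace_add, Matrix.trace_smul, Matrix.trace_smul, Matrix.trace_one, hρ]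
  simp only [smul_eq_mul, Fintype.card_fin]
  push_cast
  module

end Centralizer

/-! ### Normalizers, dihedral overgroups and classes of subgroups of order `ℓ` -/

section Normalizer

variable {A : Type*} [CommRing A] {ℓ : ℕ} {t : A}

namespace IsOrderTrace

variable (hT : IsOrderTrace ℓ t)
include hT

theorem eq_zpowers {Γ : Subgroup SL(2, A)} (hΓ : Nat.card Γ = ℓ) {ρ : SL(2, A)}
    (hρ : ρ.1.trace = t) (hmem : ρ ∈ Γ) : Γ = Subgroup.zpowers ρ := by
  have hfin : Finite Γ := Nat.finite_of_card_ne_zero (by rw [hΓ]; exact hT.prime.ne_zero)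
  refine (Subgroup.eq_of_le_of_card_ge ((Subgroup.zpowers_le).2 hmem) ?_).symm
  rw [Nat.card_zpowers, hT.orderOf_eq ρ hρ, hΓ]

theorem ne_inv {ρ : SL(2, A)} (hρ : ρ.1.trace = t) : ρ ≠ ρ⁻¹ := by
  intro h
  have h1 : ρ ^ 2 = 1 := by rw [pow_two]; nth_rewrite 2 [h]; exact mul_inv_cancel ρ
  have h2 := Nat.le_of_dvd two_pos (orderOf_dvd_of_pow_eq_one h1)
  rw [hT.orderOf_eq ρ hρ] at h2
  have := hT.prime.two_le
  obtain ⟨k, hk⟩ := hT.odd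
  omega

/-- Conjugation by a normalizing element fixes or inverts `ρ`, as these are the elements of
`⟨ρ⟩` with the trace of `ρ`. -/
theorem mem_normalizer_iff {ρ : SL(2, A)} (hρ : ρ.1.trace = t) (g : SL(2, A)) :
    g ∈ Subgroup.normalizer (Subgroup.zpowers ρ : Set SL(2, A)) ↔
      g * ρ * g⁻¹ = ρ ∨ g * ρ * g⁻¹ = ρ⁻¹ := by
  have hcard : Nat.card (Subgroup.zpowers ρ) = ℓ := by
    rw [Nat.card_zpowers, hT.orderOf_eq ρ hρ]
  rw [Subgroup.mem_normalizer_iff]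
  constructor
  · intro h
    exact hT.eq_or_eq_inv ρ _ hρ (by rw [trace_conj, hρ])
      ((h ρ).1 (Subgroup.mem_zpowers ρ))
  · intro h
    have h1 : Subgroup.zpowers (g * ρ * g⁻¹) = Subgroup.zpowers ρ := by
      rcases h with h | h
      · rw [h]
      · rw [h, Subgroup.zpowers_inv]
    intro x
    have h2 : (Subgroup.zpowers ρ).map (MulAut.conj g).toMonoidHom =
        Subgroup.zpowers (g * ρ * g⁻¹) := by
      rw [MonoidHom.map_zpowers]; rfl
    rw [← Subgroup.mem_map_iff_mem (f := (MulAut.conj g).toMonoidHom) (MulAut.conj g).injective,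
      h2, h1]
    rfl

/-- The normalizer of `⟨ρ⟩` when `ρ` is conjugate to its inverse. -/
theorem normalizerIsExtension [IsDomain A] {U : Type*} [CommGroup U] {ρ : SL(2, A)}
    (hρ : ρ.1.trace = t) (j : U →* SL(2, A)) (hj : Function.Injective j)
    (hrange : j.range = Subgroup.centralizer {ρ})
    (hinv : ∀ (g : SL(2, A)) (u : U), g * ρ * g⁻¹ = ρ⁻¹ → g * j u * g⁻¹ = j u⁻¹)
    (hconj : IsConj ρ ρ⁻¹) {Γ : Subgroup SL(2, A)} (hΓ : Γ = Subgroup.zpowers ρ) :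
    NormalizerIsExtension U Γ := by
  classical
  subst hΓ
  have hne := hT.ne_inv hρ
  have hcen : ∀ g : SL(2, A), g ∈ j.range ↔ g * ρ * g⁻¹ = ρ := fun g => by
    rw [hrange, Subgroup.mem_centralizer_singleton_iff, mul_inv_eq_iff_eq_mul]
  have hN := hT.mem_normalizer_iff hρ
  let N := Subgroup.normalizer (Subgroup.zpowers ρ : Set SL(2, A))
  have hmul : ∀ g h : SL(2, A), g * h * ρ * (g * h)⁻¹ = g * (h * ρ * h⁻¹) * g⁻¹ := by
    intro g h; group
  have hginv : ∀ g : SL(2, A), g * ρ⁻¹ * g⁻¹ = (g * ρ * g⁻¹)⁻¹ := by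
    intro g; group
  let π : N →* Multiplicative (ZMod 2) :=
    { toFun := fun n => if n.1 * ρ * n.1⁻¹ = ρ then 1 else Multiplicative.ofAdd 1
      map_one' := by simp
      map_mul' := by
        intro m n
        have h11 : (Multiplicative.ofAdd (1 : ZMod 2)) * Multiplicative.ofAdd 1 = 1 := by decide
        rw [Subgroup.coe_mul, hmul]
        rcases (hN m).1 m.2 with hm | hm <;> rcases (hN n).1 n.2 with hn | hn
        · simp [hm, hn]
        · simp [hm, hn, hginv, hne.symm]
        · simp [hm, hn, hne.symm]
        · simp [hm, hn, hginv, hne.symm, h11] }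
  have hπ : ∀ n : N, π n = if n.1 * ρ * n.1⁻¹ = ρ then 1 else Multiplicative.ofAdd 1 :=
    fun _ => rfl
  have h10 : (Multiplicative.ofAdd (1 : ZMod 2)) ≠ 1 := by decide
  have hπ1 : ∀ n : N, π n = 1 ↔ n.1 * ρ * n.1⁻¹ = ρ := by
    intro n
    rw [hπ]
    split_ifs with h
    · simp [h]
    · simp [h, h10]
  let i : U →* N := j.codRestrict N fun u =>
    (hN _).2 (Or.inl ((hcen _).1 ⟨u, rfl⟩))
  refine ⟨i, π, fun u v h => hj (congrArg Subtype.val h), ?_, ?_, ?_⟩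
  · obtain ⟨g, hg⟩ := isConj_iff.1 hconj
    intro x
    have hx : x = 1 ∨ x = Multiplicative.ofAdd 1 := by revert x; decide
    rcases hx with rfl | rfl
    · exact ⟨1, map_one π⟩
    · refine ⟨⟨g, (hN g).2 (Or.inr hg)⟩, ?_⟩
      rw [hπ, hg, if_neg hne.symm]
  · ext n
    rw [MonoidHom.mem_ker, hπ1, ← hcen]
    constructor
    · rintro ⟨u, rfl⟩
      exact ⟨u, rfl⟩
    · rintro ⟨u, hu⟩
      exact ⟨u, Subtype.ext hu⟩
  · intro n hn
    have hn' : n.1 * ρ * n.1⁻¹ = ρ⁻¹ := ((hN n).1 n.2).resolve_left fun h => hn ((hπ1 n).2 h)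
    exact ⟨sq_eq_neg_one_of_conj_eq_inv hT.disc_ne_zero hρ hn', fun u =>
      Subtype.ext (hinv n.1 u hn')⟩

/-- The normalizer of `⟨ρ⟩` when `ρ` is not conjugate to its inverse. -/
theorem nonempty_normalizer_mulEquiv {U : Type*} [CommGroup U] {ρ : SL(2, A)} (hρ : ρ.1.trace = t)
    (j : U →* SL(2, A)) (hj : Function.Injective j) (hrange : j.range = Subgroup.centralizer {ρ})
    (hconj : ¬ IsConj ρ ρ⁻¹) {Γ : Subgroup SL(2, A)} (hΓ : Γ = Subgroup.zpowers ρ) :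
    Nonempty (Subgroup.normalizer (Γ : Set SL(2, A)) ≃* U) := by
  subst hΓ
  have h : Subgroup.normalizer (Subgroup.zpowers ρ : Set SL(2, A)) = j.range := by
    ext g
    rw [hT.mem_normalizer_iff hρ, hrange, Subgroup.mem_centralizer_singleton_iff,
      ← mul_inv_eq_iff_eq_mul, or_iff_left fun h => hconj (isConj_iff.2 ⟨g, h⟩)]
  exact ⟨(MulEquiv.subgroupCongr h).trans (MonoidHom.ofInjective hj).symm⟩

/-- The center of `SL₂` consists of elements of order at most two. -/
theorem pow_eq_one_of_mem_center {c : SL(2, A)} (hc : c ∈ Subgroup.center SL(2, A))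
    (hcℓ : c ^ ℓ = 1) : c = 1 := by
  obtain ⟨r, hr, hrc⟩ := Matrix.SpecialLinearGroup.mem_center_iff.1 hc
  have hc2 : c ^ 2 = 1 := by
    apply Subtype.ext
    rw [Fintype.card_fin] at hr
    change (c ^ 2).1 = 1
    rw [Matrix.SpecialLinearGroup.coe_pow]
    change c.1 ^ 2 = 1
    rw [show c.1 = Matrix.scalar (Fin 2) r from hrc.symm, ← map_pow, hr, map_one]
  obtain ⟨k, hk⟩ := hT.odd
  rw [hk, pow_succ, pow_mul, hc2, one_pow, one_mul] at hcℓ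
  exact hcℓ

end IsOrderTrace

/-- The homomorphism from a dihedral group determined by a rotation and a reflection. -/
def dihedralHom {G : Type*} [Group G] {n : ℕ} (x y : G) (hx : x ^ n = 1) (hy : y * y = 1)
    (hxy : y * x * y⁻¹ = x⁻¹) : DihedralGroup n →* G :=
  let χ : ZMod n →+ Additive G := ZMod.lift n ⟨zmultiplesHom (Additive G) (Additive.ofMul x), by
    simp [← ofMul_pow, hx]⟩
  have hχ : ∀ i : ZMod n, y * (χ i).toMul = (χ (-i)).toMul * y := by
    intro i
    obtain ⟨k, rfl⟩ := ZMod.intCast_surjective i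
    rw [← Int.cast_neg]
    simp only [χ, ZMod.lift_coe]
    have h1 : y * x ^ k * y⁻¹ = x⁻¹ ^ k := by rw [← hxy, conj_zpow]
    rw [mul_inv_eq_iff_eq_mul] at h1
    simpa using h1
  { toFun := fun d => match d with
      | DihedralGroup.r i => (χ i).toMul
      | DihedralGroup.sr i => y * (χ i).toMul
    map_one' := by
      rw [DihedralGroup.one_def]
      simp
    map_mul' := by
      rintro (i | i) (j | j)
      · simp
      · simp only [DihedralGroup.r_mul_sr]
        rw [show j - i = -i + j by ring, map_add, toMul_add, ← mul_assoc, ← mul_assoc, hχ (-i),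
          neg_neg]
      · simp [mul_assoc]
      · simp only [DihedralGroup.sr_mul_sr]
        rw [hχ i, mul_assoc, ← mul_assoc y, hy, one_mul, sub_eq_neg_add]
        simp }

theorem dihedralHom_r {G : Type*} [Group G] {n : ℕ} (x y : G) (hx : x ^ n = 1) (hy : y * y = 1)
    (hxy : y * x * y⁻¹ = x⁻¹) (k : ℤ) :
    dihedralHom x y hx hy hxy (DihedralGroup.r k) = x ^ k := by
  change Additive.toMul (ZMod.lift n _ (k : ZMod n)) = _
  simp

theorem dihedralHom_sr {G : Type*} [Group G] {n : ℕ} (x y : G) (hx : x ^ n = 1) (hy : y * y = 1)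
    (hxy : y * x * y⁻¹ = x⁻¹) (k : ℤ) :
    dihedralHom x y hx hy hxy (DihedralGroup.sr k) = y * x ^ k := by
  change y * Additive.toMul (ZMod.lift n _ (k : ZMod n)) = _
  simp

/-- The subgroup generated by `ρ` has a dihedral overgroup if and only if `ρ` is conjugate to its
inverse. A reflection of the dihedral group inverts the image of `ρ` in `PSL₂`, hence `ρ` up to a
central factor `c`, and `c² = c^ℓ = 1`; conversely an element inverting `ρ` has square `-1`. -/
theorem IsOrderTrace.hasDihedralOvergroup_iff [IsDomain A] (hT : IsOrderTrace ℓ t) {ρ : SL(2, A)}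
    (hρ : ρ.1.trace = t) {Γ : Subgroup SL(2, A)} (hΓ : Γ = Subgroup.zpowers ρ) :
    HasDihedralOvergroup Γ ↔ IsConj ρ ρ⁻¹ := by
  subst hΓ
  have hord := hT.orderOf_eq ρ hρ
  let mk := QuotientGroup.mk' (Subgroup.center SL(2, A))
  have hmk : ∀ g, mk g = 1 ↔ g ∈ Subgroup.center SL(2, A) := fun g =>
    QuotientGroup.eq_one_iff g
  have hsurj : Function.Surjective mk := QuotientGroup.mk'_surjective _
  constructor
  · rintro ⟨D, hD, n, -, ⟨ψ⟩⟩
    let x : D.map mk := ⟨mk ρ, Subgroup.mem_map_of_mem mk (hD (Subgroup.mem_zpowers ρ))⟩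
    obtain ⟨y, hy⟩ : ∃ y : D.map mk, y * x * y⁻¹ = x⁻¹ := by
      refine ⟨ψ.symm (DihedralGroup.sr 0), ψ.injective ?_⟩
      have hx : ψ x ^ ℓ = 1 := by
        rw [← map_pow]
        have : x ^ ℓ = 1 := by
          apply Subtype.ext
          change mk ρ ^ ℓ = 1
          rw [← map_pow, ← hord, pow_orderOf_eq_one, map_one]
        rw [this, map_one]
      rw [map_mul, map_mul, map_inv, map_inv, MulEquiv.apply_symm_apply]
      generalize ψ x = d at hx ⊢
      rcases d with i | i
      · simp
      · exfalso
        have h1 := orderOf_dvd_of_pow_eq_one hx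
        rw [DihedralGroup.orderOf_sr] at h1
        exact (Nat.not_even_iff_odd.2 hT.odd) (even_iff_two_dvd.2 h1)
    obtain ⟨h, hh⟩ := hsurj y.1
    have h1 : mk (h * ρ * h⁻¹) = mk ρ⁻¹ := by
      rw [map_mul, map_mul, map_inv, map_inv, hh]
      exact congrArg Subtype.val hy
    have hc : ρ * (h * ρ * h⁻¹) ∈ Subgroup.center SL(2, A) := by
      rw [← hmk, map_mul, h1, map_inv, mul_inv_cancel]
    obtain ⟨c, hcd⟩ : ∃ c, c = ρ * (h * ρ * h⁻¹) := ⟨_, rfl⟩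
    rw [← hcd] at hc
    have h2 : h * ρ * h⁻¹ = ρ⁻¹ * c := by rw [hcd, inv_mul_cancel_left]
    have hcomm : Commute ρ⁻¹ c := (Subgroup.mem_center_iff.1 hc ρ⁻¹)
    have hc1 : c = 1 := by
      refine hT.pow_eq_one_of_mem_center hc ?_
      have h3 := congrArg (· ^ ℓ) h2
      rw [conj_pow, hcomm.mul_pow, inv_pow, ← hord, pow_orderOf_eq_one, hord] at h3
      simpa using h3.symm
    rw [hc1, mul_one] at h2
    exact isConj_iff.2 ⟨h, h2⟩
  · intro hconj
    obtain ⟨g, hg⟩ := isConj_iff.1 hconj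
    have hg2 := sq_eq_neg_one_of_conj_eq_inv hT.disc_ne_zero hρ hg
    have hneg : (-1 : SL(2, A)) ∈ Subgroup.center SL(2, A) := by
      rw [Subgroup.mem_center_iff]
      intro h
      apply Subtype.ext
      change h.1 * -1 = -1 * h.1
      simp
    have hx : mk ρ ^ ℓ = 1 := by rw [← map_pow, ← hord, pow_orderOf_eq_one, map_one]
    have hy : mk g * mk g = 1 := by rw [← map_mul, ← pow_two, hg2, hmk]; exact hneg
    have hxy : mk g * mk ρ * (mk g)⁻¹ = (mk ρ)⁻¹ := by
      rw [← map_inv, ← map_inv, ← map_mul, ← map_mul, hg]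
    let f := dihedralHom (mk ρ) (mk g) hx hy hxy
    have hf : Function.Injective f := by
      rw [injective_iff_map_eq_one]
      rintro (i | i) h
      · obtain ⟨k, rfl⟩ := ZMod.intCast_surjective i
        rw [dihedralHom_r, ← map_zpow, hmk] at h
        have h1 := hT.pow_eq_one_of_mem_center h (by
          rw [← zpow_natCast, ← zpow_mul, mul_comm, zpow_mul, zpow_natCast, ← hord,
            pow_orderOf_eq_one, one_zpow])
        have h2 : (k : ZMod ℓ) = 0 := by
          rw [ZMod.intCast_zmod_eq_zero_iff_dvd, ← hord]
          exact orderOf_dvd_iff_zpow_eq_one.2 h1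
        rw [h2]; rfl
      · exfalso
        obtain ⟨k, rfl⟩ := ZMod.intCast_surjective i
        rw [dihedralHom_sr, ← map_zpow, ← map_mul, hmk] at h
        have h1 : ρ * (g * ρ ^ k) = g * ρ ^ k * ρ := Subgroup.mem_center_iff.1 h ρ
        have h2 : ρ * g = g * ρ := by
          have h3 : g * ρ ^ k * ρ = g * ρ * ρ ^ k := by
            rw [mul_assoc, mul_assoc, ← zpow_add_one, ← zpow_one_add, add_comm]
          rw [h3, ← mul_assoc] at h1
          exact mul_right_cancel h1
        apply hT.ne_inv hρ
        rw [← hg, ← h2, mul_inv_cancel_right]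
    refine ⟨f.range.comap mk, ?_, ℓ, hT.prime.ne_zero, ⟨?_⟩⟩
    · rw [Subgroup.zpowers_le, Subgroup.mem_comap]
      exact ⟨DihedralGroup.r ((1 : ℤ) : ZMod ℓ), by rw [dihedralHom_r, zpow_one]⟩
    · refine (MulEquiv.subgroupCongr ?_).trans (MonoidHom.ofInjective hf).symm
      exact Subgroup.map_comap_eq_self_of_surjective hsurj _

/-- Two subgroups `⟨ρ⟩` and `⟨σ⟩` are conjugate exactly when `σ` is conjugate to `ρ` or `ρ⁻¹`. -/
theorem IsOrderTrace.gen_cls_eq_iff (hT : IsOrderTrace ℓ t) [Nontrivial A] (ρ σ : OrderElt ℓ t) :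
    ρ.gen.cls = σ.gen.cls ↔ IsConj ρ.1 σ.1 ∨ IsConj ρ.1⁻¹ σ.1 := by
  have hρ := (charpoly_eq_iff_trace_eq ρ.1).1 ρ.2.2
  have hσ := (charpoly_eq_iff_trace_eq σ.1).1 σ.2.2
  have key : ρ.gen.cls = σ.gen.cls ↔
      ∃ g : SL(2, A), ∀ h, g * h * g⁻¹ ∈ Subgroup.zpowers σ.1 ↔ h ∈ Subgroup.zpowers ρ.1 :=
    Quotient.eq (r := subgroupSetoid A ℓ)
  rw [key]
  constructor
  · rintro ⟨g, hg⟩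
    have h1 := (hg ρ.1).2 (Subgroup.mem_zpowers _)
    rcases hT.eq_or_eq_inv σ.1 _ hσ (by rw [trace_conj, hρ]) h1 with h2 | h2
    · exact Or.inl (isConj_iff.2 ⟨g, h2⟩)
    · exact Or.inr (isConj_iff.2 ⟨g, by rw [← conj_inv, h2, inv_inv]⟩)
  · intro h
    obtain ⟨g, hg⟩ : ∃ g : SL(2, A), Subgroup.zpowers (g * ρ.1 * g⁻¹) = Subgroup.zpowers σ.1 := by
      rcases h with h | h
      · obtain ⟨g, hg⟩ := isConj_iff.1 h
        exact ⟨g, by rw [hg]⟩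
      · obtain ⟨g, hg⟩ := isConj_iff.1 h
        exact ⟨g, by rw [← hg, ← conj_inv, Subgroup.zpowers_inv]⟩
    refine ⟨g, fun h => ?_⟩
    have h2 : (Subgroup.zpowers ρ.1).map (MulAut.conj g).toMonoidHom =
        Subgroup.zpowers (g * ρ.1 * g⁻¹) := by
      rw [MonoidHom.map_zpowers]; rfl
    refine Iff.trans ?_ (Subgroup.mem_map_iff_mem (f := (MulAut.conj g).toMonoidHom)
      (MulAut.conj g).injective)
    rw [h2, hg]
    rfl

theorem IsOrderTrace.exists_gen_cls_eq (hT : IsOrderTrace ℓ t) [Nontrivial A]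
    (C : SubgroupClasses A ℓ) : ∃ ρ : OrderElt ℓ t, ρ.gen.cls = C := by
  induction C using Quotient.inductionOn with | _ Γ
  obtain ⟨ρ, hρΓ, hρ⟩ := hT.exists_mem Γ.1 Γ.2
  refine ⟨⟨ρ, hT.orderOf_eq ρ hρ, (charpoly_eq_iff_trace_eq ρ).2 hρ⟩, ?_⟩
  exact congrArg (Quotient.mk _) (Subtype.ext (hT.eq_zpowers Γ.2 hρ hρΓ).symm)

/-- Classes of subgroups of order `ℓ` are the classes of elements of trace `t`, up to inversion;
the classes of elements are parametrized here by an arbitrary type `X`. -/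
theorem IsOrderTrace.exists_quotient_equiv (hT : IsOrderTrace ℓ t) [Nontrivial A] {X : Type*}
    (s : Setoid X) (F : OrderElt ℓ t → X) (hF : Function.Surjective F)
    (hs : ∀ ρ σ, s (F ρ) (F σ) ↔ IsConj ρ.1 σ.1 ∨ IsConj ρ.1⁻¹ σ.1) :
    ∃ e : Quotient s ≃ SubgroupClasses A ℓ, ∀ ρ, e (Quotient.mk s (F ρ)) = ρ.gen.cls := by
  have hs' : ∀ ρ σ, s (F ρ) (F σ) ↔ ρ.gen.cls = σ.gen.cls := fun ρ σ =>
    (hs ρ σ).trans (hT.gen_cls_eq_iff ρ σ).symm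
  let e : Quotient s → SubgroupClasses A ℓ :=
    Quotient.lift (fun x => (Classical.choose (hF x)).gen.cls) fun x y hxy => by
      rw [← hs', Classical.choose_spec (hF x), Classical.choose_spec (hF y)]
      exact hxy
  have he : ∀ ρ, e (Quotient.mk s (F ρ)) = ρ.gen.cls := by
    intro ρ
    change (Classical.choose (hF (F ρ))).gen.cls = _
    rw [← hs', Classical.choose_spec (hF (F ρ))]
  refine ⟨Equiv.ofBijective e ⟨?_, fun C => ?_⟩, he⟩
  · intro c d h
    induction c using Quotient.inductionOn with | _ x
    induction d using Quotient.inductionOn with | _ y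
    obtain ⟨ρ, rfl⟩ := hF x
    obtain ⟨σ, rfl⟩ := hF y
    rw [he, he, ← hs'] at h
    exact Quotient.sound h
  · obtain ⟨ρ, rfl⟩ := hT.exists_gen_cls_eq C
    exact ⟨_, he ρ⟩

end Normalizer

/-! ### Ideal norms -/

section IdealNorm

open scoped QuadraticAlgebra
open QuadraticAlgebra (omega)

variable {A K : Type*} [CommRing A] [Field K] [Algebra A K] {t : A}

/-- The norm of an `A[T]/(Ψ)`-submodule of `K(Ψ)`: the `A`-module generated by norms of elements. -/
def normSpan (M : Submodule (QOrder A t) (QAlg A K t)) : Submodule A K :=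
  Submodule.span A {w | ∃ z ∈ M, w = Algebra.norm K z}

variable (t) in
/-- The extension `V·A[T]/(Ψ) = V ⊕ V·T` of an `A`-submodule `V` of `K`. -/
def extendSubmodule (V : Submodule A K) : Submodule (QOrder A t) (QAlg A K t) where
  carrier := {z | z.re ∈ V ∧ z.im ∈ V}
  zero_mem' := ⟨V.zero_mem, V.zero_mem⟩
  add_mem' hx hy := ⟨V.add_mem hx.1 hy.1, V.add_mem hx.2 hy.2⟩
  smul_mem' r z hz := by
    rw [qOrder_smul_eq]
    have h1 : (qMap A K t r * z).re = r.re • z.re + (-r.im) • z.im := by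
      simp [Algebra.smul_def]
    have h2 : (qMap A K t r * z).im = r.re • z.im + r.im • z.re + (t * r.im) • z.im := by
      simp [Algebra.smul_def]
    constructor
    · rw [h1]
      exact V.add_mem (V.smul_mem _ hz.1) (V.smul_mem _ hz.2)
    · rw [h2]
      exact V.add_mem (V.add_mem (V.smul_mem _ hz.2) (V.smul_mem _ hz.1)) (V.smul_mem _ hz.2)

/-- The conjugate of an `A[T]/(Ψ)`-submodule of `K(Ψ)`. -/
def starSubmodule (M : Submodule (QOrder A t) (QAlg A K t)) :
    Submodule (QOrder A t) (QAlg A K t) where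
  carrier := {z | star z ∈ M}
  zero_mem' := by simp
  add_mem' {x y} hx hy := by
    change star (x + y) ∈ M
    rw [star_add]
    exact M.add_mem hx hy
  smul_mem' r z hz := by
    have h : star (r • z) = star r • star z := by
      rw [qOrder_smul_eq, qOrder_smul_eq, star_mul, mul_comm]
      congr 1
      ext <;> simp
    change star (r • z) ∈ M
    rw [h]
    exact M.smul_mem _ hz

theorem mem_extendSubmodule {V : Submodule A K} {z : QAlg A K t} :
    z ∈ extendSubmodule t V ↔ z.re ∈ V ∧ z.im ∈ V := Iff.rfl

theorem mem_starSubmodule {M : Submodule (QOrder A t) (QAlg A K t)} {z : QAlg A K t} :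
    z ∈ starSubmodule M ↔ star z ∈ M := Iff.rfl

theorem mk_zero_mem_extendSubmodule {V : Submodule A K} {v : K} :
    (⟨v, 0⟩ : QAlg A K t) ∈ extendSubmodule t V ↔ v ∈ V :=
  ⟨fun h => h.1, fun h => ⟨h, V.zero_mem⟩⟩

theorem extendSubmodule_le {V : Submodule A K} {M : Submodule (QOrder A t) (QAlg A K t)}
    (h : ∀ v ∈ V, (⟨v, 0⟩ : QAlg A K t) ∈ M) : extendSubmodule t V ≤ M := by
  intro z hz
  have h1 : z = ⟨z.re, 0⟩ + (omega : QOrder A t) • (⟨z.im, 0⟩ : QAlg A K t) := by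
    rw [qOrder_smul_eq]
    ext <;> simp
  rw [h1]
  exact M.add_mem (h _ hz.1) (M.smul_mem _ (h _ hz.2))

theorem extendSubmodule_mul (V W : Submodule A K) :
    extendSubmodule t (V * W) = extendSubmodule t V * extendSubmodule t W := by
  apply le_antisymm
  · apply extendSubmodule_le
    intro u hu
    refine Submodule.mul_induction_on hu (fun v hv w hw => ?_) (fun x y hx hy => ?_)
    · have h1 : (⟨v * w, 0⟩ : QAlg A K t) = ⟨v, 0⟩ * ⟨w, 0⟩ := by ext <;> simp
      rw [h1]
      exact Submodule.mul_mem_mul (mk_zero_mem_extendSubmodule.2 hv)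
        (mk_zero_mem_extendSubmodule.2 hw)
    · have h1 : (⟨x + y, 0⟩ : QAlg A K t) = ⟨x, 0⟩ + ⟨y, 0⟩ := by ext <;> simp
      rw [h1]
      exact Submodule.add_mem _ hx hy
  · rw [Submodule.mul_le]
    intro x hx y hy
    have h1 : (x * y).re = x.re * y.re + (-1 : A) • (x.im * y.im) := by simp
    have h2 : (x * y).im = x.re * y.im + x.im * y.re + t • (x.im * y.im) := by
      simp [Algebra.smul_def]; ring
    refine ⟨?_, ?_⟩
    · rw [h1]
      exact Submodule.add_mem _ (Submodule.mul_mem_mul hx.1 hy.1)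
        (Submodule.smul_mem _ _ (Submodule.mul_mem_mul hx.2 hy.2))
    · rw [h2]
      exact Submodule.add_mem _ (Submodule.add_mem _ (Submodule.mul_mem_mul hx.1 hy.2)
        (Submodule.mul_mem_mul hx.2 hy.1))
        (Submodule.smul_mem _ _ (Submodule.mul_mem_mul hx.2 hy.2))

theorem extendSubmodule_one : extendSubmodule t (1 : Submodule A K) = 1 := by
  ext z
  rw [mem_extendSubmodule, Submodule.mem_one, Submodule.mem_one, Submodule.mem_one]
  constructor
  · rintro ⟨⟨a, ha⟩, ⟨b, hb⟩⟩
    exact ⟨⟨a, b⟩, QuadraticAlgebra.ext ha hb⟩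
  · rintro ⟨r, rfl⟩
    exact ⟨⟨r.re, rfl⟩, ⟨r.im, rfl⟩⟩

theorem extendSubmodule_injective :
    Function.Injective (extendSubmodule t : Submodule A K → _) := by
  intro V W h
  ext v
  rw [← mk_zero_mem_extendSubmodule (t := t), h, mk_zero_mem_extendSubmodule]

theorem starSubmodule_mul (M N : Submodule (QOrder A t) (QAlg A K t)) :
    starSubmodule (M * N) = starSubmodule M * starSubmodule N := by
  have hss : ∀ M : Submodule (QOrder A t) (QAlg A K t), starSubmodule (starSubmodule M) = M := by
    intro M; ext z; simp [mem_starSubmodule]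
  have key : ∀ M N : Submodule (QOrder A t) (QAlg A K t),
      starSubmodule M * starSubmodule N ≤ starSubmodule (M * N) := by
    intro M N
    rw [Submodule.mul_le]
    intro x hx y hy
    rw [mem_starSubmodule, star_mul, mul_comm (star y)]
    exact Submodule.mul_mem_mul hx hy
  refine le_antisymm ?_ (key M N)
  intro z hz
  have h1 := key (starSubmodule M) (starSubmodule N)
  rw [hss, hss] at h1
  have h2 := h1 hz
  rwa [mem_starSubmodule, star_star] at h2

theorem norm_mem_normSpan {M : Submodule (QOrder A t) (QAlg A K t)} {z : QAlg A K t} (hz : z ∈ M) :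
    Algebra.norm K z ∈ normSpan M := Submodule.subset_span ⟨z, hz, rfl⟩

/-- Polarization of the norm form. -/
theorem norm_add_sub (x y : QAlg A K t) :
    Algebra.norm K (x + y) - Algebra.norm K x - Algebra.norm K y =
      2 * (x * star y).re + algebraMap A K t * (x * star y).im := by
  simp only [qNorm_eq]
  simp
  ring

theorem norm_star (x : QAlg A K t) : Algebra.norm K (star x) = Algebra.norm K x := by
  simp only [qNorm_eq]
  simp
  ring

theorem wedge_eq_im (x y : QAlg A K t) : wedge x y = (y * star x).im := by
  simp [wedge]
  ring

/-- If `W` is the inverse of `V`, then `V` contains every `r` with `W·r ⊆ A`. -/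
theorem mem_of_mul_mem_one {V W : Submodule A K} (h : V * W = 1) {r : K}
    (hr : ∀ c ∈ W, c * r ∈ (1 : Submodule A K)) : r ∈ V := by
  have h1 : Submodule.span A {r} * W ≤ 1 := by
    rw [Submodule.mul_le]
    intro x hx w hw
    obtain ⟨a, rfl⟩ := Submodule.mem_span_singleton.1 hx
    rw [smul_mul_assoc, mul_comm]
    exact Submodule.smul_mem _ _ (hr w hw)
  have h2 : Submodule.span A {r} ≤ V := by
    calc Submodule.span A {r} = Submodule.span A {r} * W * V := by
          rw [mul_assoc, mul_comm W, h, mul_one]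
      _ ≤ 1 * V := mul_le_mul' h1 le_rfl
      _ = V := one_mul V
  exact h2 (Submodule.mem_span_singleton_self r)

/-- `A[T]/(Ψ)` contains the elements of `K(Ψ)` with trace and norm in `A`. -/
def QIntegral (K : Type*) [Field K] [Algebra A K] (t : A) : Prop :=
  ∀ x y : K, 2 * x + algebraMap A K t * y ∈ (algebraMap A K).range →
    x ^ 2 + algebraMap A K t * x * y + y ^ 2 ∈ (algebraMap A K).range →
    x ∈ (algebraMap A K).range ∧ y ∈ (algebraMap A K).range

/-- The fundamental relation `𝔞·𝔞̄ = N(𝔞)`: if `c ∈ N(𝔞)⁻¹` and `x, y ∈ 𝔞`, then `c x ȳ` has trace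
and norm in `A`. -/
theorem mul_starSubmodule (hH : QIntegral K t) {M : Submodule (QOrder A t) (QAlg A K t)}
    (hM : IsUnit (normSpan M)) : M * starSubmodule M = extendSubmodule t (normSpan M) := by
  obtain ⟨W, hW⟩ := hM.exists_right_inv
  apply le_antisymm
  · rw [Submodule.mul_le]
    intro x hx y' hy'
    obtain ⟨y, rfl⟩ : ∃ y, y' = star y := ⟨star y', (star_star y').symm⟩
    rw [mem_starSubmodule, star_star] at hy'
    have key : ∀ c ∈ W, c * (x * star y).re ∈ (1 : Submodule A K) ∧
        c * (x * star y).im ∈ (1 : Submodule A K) := by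
      intro c hc
      have hcN : ∀ v ∈ normSpan M, c * v ∈ (1 : Submodule A K) := by
        intro v hv
        rw [← hW, mul_comm c]
        exact Submodule.mul_mem_mul hv hc
      have htr : c * (Algebra.norm K (x + y) - Algebra.norm K x - Algebra.norm K y) ∈
          (1 : Submodule A K) :=
        hcN _ (Submodule.sub_mem _ (Submodule.sub_mem _ (norm_mem_normSpan (M.add_mem hx hy'))
          (norm_mem_normSpan hx)) (norm_mem_normSpan hy'))
      obtain ⟨a, ha⟩ := Submodule.mem_one.1 htr
      obtain ⟨b, hb⟩ := Submodule.mem_one.1 (hcN _ (norm_mem_normSpan hx))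
      obtain ⟨d, hd⟩ := Submodule.mem_one.1 (hcN _ (norm_mem_normSpan hy'))
      rw [norm_add_sub] at ha
      have hn : Algebra.norm K (x * star y) = Algebra.norm K x * Algebra.norm K y := by
        rw [map_mul, norm_star]
      rw [qNorm_eq] at hn
      obtain ⟨⟨e, he⟩, ⟨f, hf⟩⟩ := hH (c * (x * star y).re) (c * (x * star y).im)
        ⟨a, by rw [ha]; ring⟩ ⟨b * d, by
          rw [map_mul, hb, hd]
          linear_combination -c ^ 2 * hn⟩
      exact ⟨Submodule.mem_one.2 ⟨e, he⟩, Submodule.mem_one.2 ⟨f, hf⟩⟩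
    exact ⟨mem_of_mul_mem_one hW fun c hc => (key c hc).1,
      mem_of_mul_mem_one hW fun c hc => (key c hc).2⟩
  · apply extendSubmodule_le
    intro v hv
    induction hv using Submodule.span_induction with
    | mem w hw =>
      obtain ⟨z, hz, rfl⟩ := hw
      have h1 : (⟨Algebra.norm K z, 0⟩ : QAlg A K t) = z * star z := by
        rw [← algebraMap_qNorm]
        ext <;> simp
      rw [h1]
      exact Submodule.mul_mem_mul hz (by rwa [mem_starSubmodule, star_star])
    | zero => exact Submodule.zero_mem _
    | add x y _ _ hx hy =>
      have h1 : (⟨x + y, 0⟩ : QAlg A K t) = ⟨x, 0⟩ + ⟨y, 0⟩ := by ext <;> simp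
      rw [h1]
      exact Submodule.add_mem _ hx hy
    | smul a x _ hx =>
      have h1 : (⟨a • x, 0⟩ : QAlg A K t) = algebraMap A (QOrder A t) a • ⟨x, 0⟩ := by
        rw [← smul_eq_algebraMap_smul]
        ext <;> simp
      rw [h1]
      exact Submodule.smul_mem _ _ hx

theorem isUnit_of_isUnit_normSpan (hH : QIntegral K t) {M : Submodule (QOrder A t) (QAlg A K t)}
    (hM : IsUnit (normSpan M)) : IsUnit M := by
  obtain ⟨W, hW⟩ := hM.exists_right_inv
  refine IsUnit.of_mul_eq_one (starSubmodule M * extendSubmodule t W) ?_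
  rw [← mul_assoc, mul_starSubmodule hH hM, ← extendSubmodule_mul, hW, extendSubmodule_one]

/-- Multiplicativity of the ideal norm. -/
theorem normSpan_mul (hH : QIntegral K t) {M N : Submodule (QOrder A t) (QAlg A K t)}
    (hM : IsUnit (normSpan M)) (hN : IsUnit (normSpan N)) (hMN : IsUnit (normSpan (M * N))) :
    normSpan (M * N) = normSpan M * normSpan N := by
  apply extendSubmodule_injective (t := t)
  rw [← mul_starSubmodule hH hMN, extendSubmodule_mul, ← mul_starSubmodule hH hM,
    ← mul_starSubmodule hH hN, starSubmodule_mul, mul_mul_mul_comm]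

/-- The ideal norm is the image of the exterior square. -/
theorem span_wedge_eq_normSpan (hH : QIntegral K t) {M : Submodule (QOrder A t) (QAlg A K t)}
    (hM : IsUnit (normSpan M)) :
    Submodule.span A {w : K | ∃ x ∈ M, ∃ y ∈ M, w = wedge x y} = normSpan M := by
  apply le_antisymm
  · rw [Submodule.span_le]
    rintro _ ⟨x, hx, y, hy, rfl⟩
    have h1 : y * star x ∈ extendSubmodule t (normSpan M) := by
      rw [← mul_starSubmodule hH hM]
      exact Submodule.mul_mem_mul hy (by rwa [mem_starSubmodule, star_star])
    rw [wedge_eq_im]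
    exact h1.2
  · refine Submodule.span_mono ?_
    rintro _ ⟨z, hz, rfl⟩
    refine ⟨z, hz, omega * z, ?_, ?_⟩
    · rw [omega_mul_eq_smul]
      exact M.smul_mem _ hz
    · simp [wedge, qNorm_eq]; ring

theorem normSpan_span_singleton (τ : QAlg A K t) :
    normSpan (Submodule.span (QOrder A t) {τ}) = Submodule.span A {Algebra.norm K τ} := by
  apply le_antisymm
  · rw [normSpan, Submodule.span_le]
    rintro _ ⟨z, hz, rfl⟩
    obtain ⟨r, rfl⟩ := Submodule.mem_span_singleton.1 hz
    refine Submodule.mem_span_singleton.2 ⟨Algebra.norm A r, ?_⟩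
    rw [qOrder_smul_eq, map_mul, Algebra.smul_def, algebraNorm_qOrder, qNorm_eq (qMap A K t r)]
    simp
  · rw [Submodule.span_singleton_le_iff_mem]
    exact norm_mem_normSpan (Submodule.mem_span_singleton_self τ)

section Dedekind

variable [IsDedekindDomain A] [IsFractionRing A K]

/-- The norm of a fractional ideal containing an element of nonzero norm is a nonzero fractional
ideal of the Dedekind domain `A`. -/
theorem isUnit_normSpan {M : Submodule (QOrder A t) (QAlg A K t)}
    (hM : IsFractional (QOrder A t)⁰ M) {z : QAlg A K t} (hz : z ∈ M)
    (hz0 : Algebra.norm K z ≠ 0) : IsUnit (normSpan M) := by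
  obtain ⟨r, hr, h⟩ := hM
  have hr' : r.norm ∈ A⁰ := QuadraticAlgebra.norm_mem_nonZeroDivisors_iff.2 hr
  let J : FractionalIdeal A⁰ K := ⟨normSpan M, r.norm ^ 2, pow_mem hr' 2, by
    intro w hw
    induction hw using Submodule.span_induction with
    | mem w hw =>
      obtain ⟨z, hz, rfl⟩ := hw
      obtain ⟨s, hs⟩ := h z hz
      have h1 : qMap A K t (star r * s) = algebraMap A K r.norm • z := by
        rw [map_mul, show qMap A K t s = r • z from hs, ← qOrder_smul_eq, smul_smul,
          algebraMap_smul, smul_eq_algebraMap_smul,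
          QuadraticAlgebra.algebraMap_norm_eq_mul_star, mul_comm]
      refine ⟨Algebra.norm A (star r * s), ?_⟩
      have h2 := congrArg (Algebra.norm K) h1
      rw [Algebra.smul_def, map_mul (Algebra.norm K) (algebraMap K (QAlg A K t) _) z,
        Algebra.norm_algebraMap,
        QuadraticAlgebra.finrank_eq_two, qNorm_eq] at h2
      rw [algebraNorm_qOrder, Algebra.smul_def, map_pow, ← h2]
      simp only [re_qMap, im_qMap, ← map_pow, ← map_mul (algebraMap A K), ← map_add]
    | zero => exact ⟨0, by simp⟩
    | add x y _ _ hx hy =>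
      rw [smul_add]
      exact IsLocalization.isInteger_add hx hy
    | smul a x _ hx =>
      rw [smul_comm]
      exact IsLocalization.isInteger_smul hx⟩
  have hJ : J ≠ 0 := by
    intro h0
    have : Algebra.norm K z ∈ J := norm_mem_normSpan hz
    rw [h0, FractionalIdeal.mem_zero_iff] at this
    exact hz0 this
  refine IsUnit.of_mul_eq_one (J⁻¹ : FractionalIdeal A⁰ K) ?_
  have := congrArg (fun I : FractionalIdeal A⁰ K => (I : Submodule A K)) (mul_inv_cancel₀ hJ)
  simp only [FractionalIdeal.coe_mul, FractionalIdeal.coe_one] at this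
  exact this

end Dedekind

end IdealNorm

/-! ### The group of oriented relative ideals -/

section OrientedGroup

open scoped QuadraticAlgebra
open QuadraticAlgebra (omega)
open Submodule (unitsToPic)

variable {A K : Type*} [CommRing A] [Field K] [Algebra A K] {t : A}

theorem norm_ne_zero_of_ne_zero (hroot : ∀ r : K, r ^ 2 - algebraMap A K t * r + 1 ≠ 0)
    {z : QAlg A K t} (hz : z ≠ 0) : Algebra.norm K z ≠ 0 := by
  intro h
  rw [qNorm_eq] at h
  by_cases him : z.im = 0
  · rw [him] at h
    have hre : z.re = 0 := by simpa using h
    exact hz (QuadraticAlgebra.ext hre him)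
  · apply hroot (-z.re / z.im)
    field_simp
    linear_combination h

theorem isUnit_iff_norm_ne_zero {z : QAlg A K t} : IsUnit z ↔ Algebra.norm K z ≠ 0 := by
  rw [QuadraticAlgebra.isUnit_iff_norm_isUnit, ← algebraNorm_eq, isUnit_iff_ne_zero]

theorem isLocalRing_qAlg (hroot : ∀ r : K, r ^ 2 - algebraMap A K t * r + 1 ≠ 0) :
    IsLocalRing (QAlg A K t) := by
  refine IsLocalRing.of_isUnit_or_isUnit_one_sub_self fun z => ?_
  by_cases hz : z = 0
  · right
    simp [hz]
  · left
    exact isUnit_iff_norm_ne_zero.2 (norm_ne_zero_of_ne_zero hroot hz)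

/-- Every class in the Picard group of `A[T]/(Ψ)` comes from an invertible fractional ideal when
`K(Ψ)` is a field. -/
theorem unitsToPic_qOrder_surjective [FaithfulSMul A K]
    (hroot : ∀ r : K, r ^ 2 - algebraMap A K t * r + 1 ≠ 0) :
    Function.Surjective (unitsToPic (QOrder A t) (QAlg A K t)) := by
  have := isLocalRing_qAlg hroot
  rw [← MonoidHom.range_eq_top, Submodule.range_unitsToPic]
  exact CommRing.relPic_eq_top _ _

/-- The principal fractional ideal generated by a unit. -/
noncomputable def principal (R : Type*) {L : Type*} [CommRing R] [CommRing L] [Algebra R L] :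
    Lˣ →* (Submodule R L)ˣ :=
  Units.map (Submodule.spanSingleton R : L →*₀ Submodule R L).toMonoidHom

theorem coe_principal (R : Type*) {L : Type*} [CommRing R] [CommRing L] [Algebra R L] (x : Lˣ) :
    (principal R x : Submodule R L) = Submodule.span R {(x : L)} := rfl

theorem unitsToPic_eq_one_iff {R L : Type*} [CommRing R] [CommRing L] [Algebra R L]
    [FaithfulSMul R L] {U : (Submodule R L)ˣ} :
    unitsToPic R L U = 1 ↔ ∃ x : Lˣ, principal R x = U := by
  rw [← MonoidHom.mem_ker, Submodule.ker_unitsToPic]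
  rfl

theorem isFractional_of_fg [IsDomain A] [IsFractionRing A K]
    {M : Submodule (QOrder A t) (QAlg A K t)} (hM : M.FG) : IsFractional (QOrder A t)⁰ M := by
  classical
  obtain ⟨s, rfl⟩ := hM
  obtain ⟨d, hd⟩ := IsLocalization.exist_integer_multiples_of_finset A⁰
    (s.image QuadraticAlgebra.re ∪ s.image QuadraticAlgebra.im : Finset K)
  refine ⟨algebraMap A (QOrder A t) d,
    QuadraticAlgebra.algebraMap_mem_nonZeroDivisors_iff.2 d.2, fun z hz => ?_⟩
  induction hz using Submodule.span_induction with
  | mem z hz =>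
    obtain ⟨a, ha⟩ := hd z.re (Finset.mem_union_left _ (Finset.mem_image_of_mem _ hz))
    obtain ⟨b, hb⟩ := hd z.im (Finset.mem_union_right _ (Finset.mem_image_of_mem _ hz))
    refine ⟨⟨a, b⟩, ?_⟩
    rw [← smul_eq_algebraMap_smul]
    ext
    · rw [re_smul_eq]
      exact ha.trans (Algebra.smul_def _ _)
    · rw [im_smul_eq]
      exact hb.trans (Algebra.smul_def _ _)
  | zero => exact ⟨0, by simp⟩
  | add x y _ _ hx hy =>
    rw [smul_add]
    exact IsLocalization.isInteger_add hx hy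
  | smul a x _ hx =>
    rw [smul_comm]
    exact IsLocalization.isInteger_smul hx

variable [IsDedekindDomain A] [IsFractionRing A K]

theorem isUnit_normSpan_of_fg (hroot : ∀ r : K, r ^ 2 - algebraMap A K t * r + 1 ≠ 0)
    {M : Submodule (QOrder A t) (QAlg A K t)} (hM : M.FG) (hM0 : M ≠ ⊥) : IsUnit (normSpan M) := by
  obtain ⟨z, hz, hz0⟩ := (Submodule.ne_bot_iff M).1 hM0
  exact isUnit_normSpan (isFractional_of_fg hM) hz (norm_ne_zero_of_ne_zero hroot hz0)

theorem isUnit_normSpan_coe (hroot : ∀ r : K, r ^ 2 - algebraMap A K t * r + 1 ≠ 0)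
    (U : (Submodule (QOrder A t) (QAlg A K t))ˣ) :
    IsUnit (normSpan (U : Submodule (QOrder A t) (QAlg A K t))) := by
  refine isUnit_normSpan_of_fg hroot (Submodule.fg_unit U) fun h => ?_
  have h1 := U.mul_inv
  rw [h, Submodule.bot_mul] at h1
  have h2 : (1 : QAlg A K t) ∈ (⊥ : Submodule (QOrder A t) (QAlg A K t)) := by
    rw [h1]; exact Submodule.one_le.1 le_rfl
  exact one_ne_zero ((Submodule.mem_bot _).1 h2)

/-- The ideal norm on invertible fractional ideals. -/
noncomputable def idealNorm (hH : QIntegral K t)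
    (hroot : ∀ r : K, r ^ 2 - algebraMap A K t * r + 1 ≠ 0) :
    (Submodule (QOrder A t) (QAlg A K t))ˣ →* (Submodule A K)ˣ :=
  MonoidHom.mk' (fun U => (isUnit_normSpan_coe hroot U).unit) fun U V => Units.ext <| by
    have h := isUnit_normSpan_coe hroot (U * V)
    rw [Units.val_mul] at h
    exact normSpan_mul hH (isUnit_normSpan_coe hroot U) (isUnit_normSpan_coe hroot V) h

theorem coe_idealNorm (hH : QIntegral K t)
    (hroot : ∀ r : K, r ^ 2 - algebraMap A K t * r + 1 ≠ 0)
    (U : (Submodule (QOrder A t) (QAlg A K t))ˣ) :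
    (idealNorm hH hroot U : Submodule A K) = normSpan (U : Submodule (QOrder A t) (QAlg A K t)) :=
  rfl

theorem idealNorm_principal (hH : QIntegral K t)
    (hroot : ∀ r : K, r ^ 2 - algebraMap A K t * r + 1 ≠ 0) (τ : (QAlg A K t)ˣ) :
    idealNorm hH hroot (principal (QOrder A t) τ) =
      principal A (Units.map (Algebra.norm K : QAlg A K t →* K) τ) :=
  Units.ext (normSpan_span_singleton (τ : QAlg A K t))

/-- The group of pairs of an invertible fractional ideal of `A[T]/(Ψ)` and a generator of its
norm. -/
noncomputable def orientedGroup (hH : QIntegral K t)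
    (hroot : ∀ r : K, r ^ 2 - algebraMap A K t * r + 1 ≠ 0) :
    Subgroup ((Submodule (QOrder A t) (QAlg A K t))ˣ × Kˣ) :=
  ((idealNorm hH hroot).comp (MonoidHom.fst _ _)).eqLocus
    ((principal A).comp (MonoidHom.snd _ _))

variable {hH : QIntegral K t} {hroot : ∀ r : K, r ^ 2 - algebraMap A K t * r + 1 ≠ 0}

theorem mem_orientedGroup {g : (Submodule (QOrder A t) (QAlg A K t))ˣ × Kˣ} :
    g ∈ orientedGroup hH hroot ↔ idealNorm hH hroot g.1 = principal A g.2 := Iff.rfl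

/-- The oriented relative ideal of an element of `orientedGroup`. -/
noncomputable def toOrientedIdeal (g : orientedGroup hH hroot) : OrientedIdeal A K t where
  ideal := ⟨(g.1.1 : Submodule (QOrder A t) (QAlg A K t)), isFractional_of_fg (Submodule.fg_unit _)⟩
  orient := g.1.2
  span_orient := by
    have h1 := congrArg Units.val (mem_orientedGroup.1 g.2)
    rw [coe_idealNorm, coe_principal] at h1
    rw [← h1]
    exact (span_wedge_eq_normSpan hH (isUnit_normSpan_coe hroot _)).symm

theorem coe_toOrientedIdeal (g : orientedGroup hH hroot) :
    ((toOrientedIdeal g).ideal : Submodule (QOrder A t) (QAlg A K t)) = g.1.1 := rfl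

/-- Every oriented relative ideal is invertible and its orientation generates its norm. -/
theorem exists_toOrientedIdeal_eq (hH : QIntegral K t)
    (hroot : ∀ r : K, r ^ 2 - algebraMap A K t * r + 1 ≠ 0) (I : OrientedIdeal A K t) :
    ∃ g : orientedGroup hH hroot, toOrientedIdeal g = I := by
  obtain ⟨x, hx, hw⟩ := I.exists_wedge_eq
  have hx0 : x 0 ≠ 0 := by
    intro h
    rw [h] at hw
    apply I.orient.ne_zero
    rw [← hw]
    simp [wedge]
  have hN : IsUnit (normSpan (I.ideal : Submodule (QOrder A t) (QAlg A K t))) :=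
    isUnit_normSpan I.ideal.isFractional (hx 0) (norm_ne_zero_of_ne_zero hroot hx0)
  have hI := isUnit_of_isUnit_normSpan hH hN
  refine ⟨⟨(hI.unit, I.orient), mem_orientedGroup.2 (Units.ext ?_)⟩, ?_⟩
  · rw [coe_idealNorm, coe_principal, I.span_orient]
    exact (span_wedge_eq_normSpan hH hN).symm
  · cases I
    rfl

/-- The homomorphism `τ ↦ ((τ), N(τ))`. -/
noncomputable def principalOriented (hH : QIntegral K t)
    (hroot : ∀ r : K, r ^ 2 - algebraMap A K t * r + 1 ≠ 0) :
    (QAlg A K t)ˣ →* orientedGroup hH hroot :=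
  ((principal (QOrder A t)).prod (Units.map (Algebra.norm K : QAlg A K t →* K))).codRestrict _
    fun τ => mem_orientedGroup.2 (idealNorm_principal hH hroot τ)

theorem toOrientedIdeal_equivalent_iff (g h : orientedGroup hH hroot) :
    (toOrientedIdeal g).Equivalent (toOrientedIdeal h) ↔
      ∃ τ, h = principalOriented hH hroot τ * g := by
  refine exists_congr fun τ => ?_
  have h1 : ∀ z, (τ : QAlg A K t) * z ∈
      ((principal (QOrder A t) τ * g.1.1 : (Submodule (QOrder A t) (QAlg A K t))ˣ) :
        Submodule (QOrder A t) (QAlg A K t)) ↔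
        z ∈ (g.1.1 : Submodule (QOrder A t) (QAlg A K t)) := by
    intro z
    rw [Units.val_mul, coe_principal, Submodule.mem_span_singleton_mul]
    constructor
    · rintro ⟨y, hy, hyz⟩
      rwa [← τ.mul_right_inj.1 hyz]
    · intro hz
      exact ⟨z, hz, rfl⟩
  constructor
  · rintro ⟨hz, ho⟩
    refine Subtype.ext (Prod.ext (Units.ext (Submodule.ext fun z => ?_)) (Units.ext ho))
    have h2 := (hz (↑τ⁻¹ * z)).trans (h1 (↑τ⁻¹ * z)).symm
    rw [Units.mul_inv_cancel_left] at h2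
    exact h2
  · rintro rfl
    exact ⟨h1, rfl⟩

end OrientedGroup

section ExactSequence

open scoped QuadraticAlgebra
open QuadraticAlgebra (omega)
open Submodule (unitsToPic)

variable {A K : Type*} [CommRing A] [Field K] [Algebra A K] {t : A}
variable [IsDedekindDomain A] [IsFractionRing A K]

theorem unitsToPic_ker_le [FaithfulSMul A K] (hH : QIntegral K t)
    (hroot : ∀ r : K, r ^ 2 - algebraMap A K t * r + 1 ≠ 0) :
    (unitsToPic (QOrder A t) (QAlg A K t)).ker ≤
      ((unitsToPic A K).comp (idealNorm hH hroot)).ker := by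
  intro U hU
  obtain ⟨τ, rfl⟩ := unitsToPic_eq_one_iff.1 hU
  rw [MonoidHom.mem_ker, MonoidHom.comp_apply, idealNorm_principal, unitsToPic_eq_one_iff]
  exact ⟨_, rfl⟩

/-- The norm homomorphism on Picard groups. -/
noncomputable def picNorm [FaithfulSMul A K] (hH : QIntegral K t)
    (hroot : ∀ r : K, r ^ 2 - algebraMap A K t * r + 1 ≠ 0) :
    CommRing.Pic (QOrder A t) →* CommRing.Pic A :=
  (unitsToPic (QOrder A t) (QAlg A K t)).liftOfSurjective (unitsToPic_qOrder_surjective hroot)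
    ⟨(unitsToPic A K).comp (idealNorm hH hroot), unitsToPic_ker_le hH hroot⟩

theorem picNorm_unitsToPic [FaithfulSMul A K] (hH : QIntegral K t)
    (hroot : ∀ r : K, r ^ 2 - algebraMap A K t * r + 1 ≠ 0)
    (U : (Submodule (QOrder A t) (QAlg A K t))ˣ) :
    picNorm hH hroot (unitsToPic (QOrder A t) (QAlg A K t) U) =
      unitsToPic A K (idealNorm hH hroot U) :=
  MonoidHom.liftOfRightInverse_comp_apply _ _ _ _ _

theorem isPicNorm_picNorm [FaithfulSMul A K] (hH : QIntegral K t)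
    (hroot : ∀ r : K, r ^ 2 - algebraMap A K t * r + 1 ≠ 0) :
    IsPicNorm A K t (picNorm hH hroot) := fun U =>
  ⟨idealNorm hH hroot U, rfl, picNorm_unitsToPic hH hroot U⟩

theorem orientedGroup_mul_comm {hH : QIntegral K t}
    {hroot : ∀ r : K, r ^ 2 - algebraMap A K t * r + 1 ≠ 0} (g h : orientedGroup hH hroot) :
    g * h = h * g := by
  refine Subtype.ext (Prod.ext (Units.ext ?_) ?_)
  · exact mul_comm (g.1.1 : Submodule (QOrder A t) (QAlg A K t)) h.1.1
  · exact mul_comm g.1.2 h.1.2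

/-- Subgroups of `orientedGroup` are normal, as it is commutative. -/
instance {hH : QIntegral K t} {hroot : ∀ r : K, r ^ 2 - algebraMap A K t * r + 1 ≠ 0}
    (N : Subgroup (orientedGroup hH hroot)) : N.Normal :=
  ⟨fun n hn g => by rwa [orientedGroup_mul_comm g n, mul_inv_cancel_right]⟩

/-- Quotients of `orientedGroup` are commutative. -/
noncomputable instance {hH : QIntegral K t}
    {hroot : ∀ r : K, r ^ 2 - algebraMap A K t * r + 1 ≠ 0}
    (N : Subgroup (orientedGroup hH hroot)) : CommGroup (orientedGroup hH hroot ⧸ N) :=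
  { (inferInstance : Group (orientedGroup hH hroot ⧸ N)) with
    mul_comm := by
      intro x y
      induction x using QuotientGroup.induction_on with | _ g
      induction y using QuotientGroup.induction_on with | _ h
      exact congrArg QuotientGroup.mk (orientedGroup_mul_comm g h) }

/-- Oriented ideals up to equivalence are the quotient of `orientedGroup` by principal ones. -/
theorem exists_orientedGroup_quotient_equiv (hH : QIntegral K t)
    (hroot : ∀ r : K, r ^ 2 - algebraMap A K t * r + 1 ≠ 0) :
    ∃ e : (orientedGroup hH hroot ⧸ (principalOriented hH hroot).range) ≃ OrientedClasses A K t,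
      ∀ g, e (QuotientGroup.mk g) = (toOrientedIdeal g).cls := by
  have hiff : ∀ g h : orientedGroup hH hroot,
      (toOrientedIdeal g).cls = (toOrientedIdeal h).cls ↔
        g⁻¹ * h ∈ (principalOriented hH hroot).range := by
    intro g h
    have h1 : (toOrientedIdeal g).cls = (toOrientedIdeal h).cls ↔
      (toOrientedIdeal g).Equivalent (toOrientedIdeal h) :=
      Quotient.eq (r := orientedSetoid A K t)
    rw [h1, toOrientedIdeal_equivalent_iff]
    refine exists_congr fun τ => ?_
    rw [eq_inv_mul_iff_mul_eq, orientedGroup_mul_comm g, eq_comm]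
  let e : (orientedGroup hH hroot ⧸ (principalOriented hH hroot).range) → OrientedClasses A K t :=
    Quotient.lift (fun g => (toOrientedIdeal g).cls) fun g h hgh =>
      (hiff g h).2 (QuotientGroup.leftRel_apply.1 hgh)
  refine ⟨Equiv.ofBijective e ⟨?_, ?_⟩, fun g => rfl⟩
  · intro c d h
    induction c using QuotientGroup.induction_on with | _ g
    induction d using QuotientGroup.induction_on with | _ k
    exact QuotientGroup.eq.2 ((hiff g k).1 h)
  · intro C
    induction C using Quotient.inductionOn with | _ I
    obtain ⟨g, rfl⟩ := exists_toOrientedIdeal_eq hH hroot I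
    exact ⟨QuotientGroup.mk g, rfl⟩

/-- The oriented ideals with underlying ideal `A[T]/(Ψ)`. -/
noncomputable def unitOriented (hH : QIntegral K t)
    (hroot : ∀ r : K, r ^ 2 - algebraMap A K t * r + 1 ≠ 0) : Aˣ →* orientedGroup hH hroot :=
  ((1 : Aˣ →* (Submodule (QOrder A t) (QAlg A K t))ˣ).prod
    (Units.map (algebraMap A K : A →* K))).codRestrict _ fun u => by
      rw [mem_orientedGroup]
      change idealNorm hH hroot 1 = principal A (Units.map (algebraMap A K : A →* K) u)
      rw [map_one, eq_comm]
      apply Units.ext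
      rw [coe_principal]
      exact Submodule.span_singleton_eq_one_iff.2 ⟨u, rfl⟩

/-- The exact sequence for oriented classes: an oriented ideal with principal underlying ideal is
equivalent to some `(R, u)`, where the unit `u` matters up to norms of units. -/
theorem exists_commGroup_exact [FaithfulSMul A K] (hH : QIntegral K t)
    (hroot : ∀ r : K, r ^ 2 - algebraMap A K t * r + 1 ≠ 0) {E : Type*}
    (Φ : E ≃ OrientedClasses A K t) :
    ∃ (_ : CommGroup E) (N₀ : CommRing.Pic (QOrder A t) →* CommRing.Pic A)
      (i : (Aˣ ⧸ (normUnits A t).range) →* E) (p : E →* N₀.ker),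
      (∀ (c d : E) (I J : OrientedIdeal A K t),
        Φ c = I.cls → Φ d = J.cls → ∃ P, I.IsProd J P ∧ Φ (c * d) = P.cls) ∧
      IsPicNorm A K t N₀ ∧
      (∀ u : Aˣ, ∃ I : OrientedIdeal A K t,
        I.ideal = 1 ∧ (I.orient : K) = algebraMap A K u ∧ Φ (i (QuotientGroup.mk u)) = I.cls) ∧
      (∀ (c : E) (I : OrientedIdeal A K t), Φ c = I.cls →
        ∃ U : (Submodule (QOrder A t) (QAlg A K t))ˣ,
          (U : Submodule (QOrder A t) (QAlg A K t)) = I.ideal ∧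
          (p c : CommRing.Pic (QOrder A t)) = unitsToPic _ _ U) ∧
      Function.Injective i ∧ i.range = p.ker ∧ Function.Surjective p := by
  obtain ⟨e, he⟩ := exists_orientedGroup_quotient_equiv hH hroot
  let κ := principalOriented hH hroot
  let f : E ≃ (orientedGroup hH hroot ⧸ κ.range) := Φ.trans e.symm
  let _ : CommGroup E := f.commGroup
  let F : E ≃* (orientedGroup hH hroot ⧸ κ.range) := f.mulEquiv
  let q : orientedGroup hH hroot →* E := F.symm.toMonoidHom.comp (QuotientGroup.mk' κ.range)
  have hΦq : ∀ g, Φ (q g) = (toOrientedIdeal g).cls := by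
    intro g
    rw [← he]
    change Φ (Φ.symm (e (QuotientGroup.mk g))) = _
    rw [Equiv.apply_symm_apply]
  have hq_surj : Function.Surjective q :=
    F.symm.surjective.comp (QuotientGroup.mk'_surjective _)
  have hq1 : ∀ g, q g = 1 ↔ ∃ τ, κ τ = g := by
    intro g
    change F.symm (QuotientGroup.mk g) = 1 ↔ _
    rw [EmbeddingLike.map_eq_one_iff, QuotientGroup.eq_one_iff]
    rfl
  have hqI : ∀ c (I : OrientedIdeal A K t), Φ c = I.cls →
      ∃ g, toOrientedIdeal g = I ∧ q g = c := by
    intro c I h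
    obtain ⟨g, rfl⟩ := exists_toOrientedIdeal_eq hH hroot I
    exact ⟨g, rfl, Φ.injective (by rw [hΦq, h])⟩
  -- the map to the Picard group
  let π : orientedGroup hH hroot →* CommRing.Pic (QOrder A t) :=
    (unitsToPic (QOrder A t) (QAlg A K t)).comp
      ((MonoidHom.fst _ _).comp (orientedGroup hH hroot).subtype)
  have hπκ : κ.range ≤ π.ker := by
    rintro _ ⟨τ, rfl⟩
    exact unitsToPic_eq_one_iff.2 ⟨τ, rfl⟩
  let p₀ : E →* CommRing.Pic (QOrder A t) := (QuotientGroup.lift κ.range π hπκ).comp F.toMonoidHom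
  have hp₀ : ∀ g, p₀ (q g) = unitsToPic (QOrder A t) (QAlg A K t) g.1.1 := by
    intro g
    change QuotientGroup.lift κ.range π hπκ (F (F.symm (QuotientGroup.mk g))) = _
    rw [MulEquiv.apply_symm_apply]
    rfl
  have hp₀N : ∀ c, p₀ c ∈ (picNorm hH hroot).ker := by
    intro c
    obtain ⟨g, rfl⟩ := hq_surj c
    rw [MonoidHom.mem_ker, hp₀, picNorm_unitsToPic, mem_orientedGroup.1 g.2, unitsToPic_eq_one_iff]
    exact ⟨_, rfl⟩
  let p : E →* (picNorm hH hroot).ker := p₀.codRestrict _ hp₀N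
  have hp1 : ∀ g, p (q g) = 1 ↔ ∃ τ, principal (QOrder A t) τ = g.1.1 := by
    intro g
    rw [← unitsToPic_eq_one_iff, ← hp₀, ← Subtype.coe_inj]
    rfl
  -- the map from units
  let υ := unitOriented hH hroot
  have hυ1 : ∀ u, q (υ u) = 1 ↔ u ∈ (normUnits A t).range := by
    intro u
    rw [hq1]
    constructor
    · rintro ⟨τ, hτ⟩
      have h1 : Submodule.span (QOrder A t) {(τ : QAlg A K t)} = 1 :=
        congrArg (fun g : orientedGroup hH hroot =>
          (g.1.1 : Submodule (QOrder A t) (QAlg A K t))) hτ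
      have h2 : Algebra.norm K (τ : QAlg A K t) = algebraMap A K u :=
        congrArg (fun g : orientedGroup hH hroot => (g.1.2 : K)) hτ
      obtain ⟨r, hr⟩ := Submodule.span_singleton_eq_one_iff.1 h1
      refine ⟨r, Units.ext (FaithfulSMul.algebraMap_injective A K ?_)⟩
      rw [← h2, hr, qNorm_eq]
      change algebraMap A K (Algebra.norm A (r : QOrder A t)) = _
      rw [algebraNorm_qOrder]
      simp only [map_add, map_mul, map_pow]
      rfl
    · rintro ⟨r, rfl⟩
      refine ⟨Units.map (algebraMap (QOrder A t) (QAlg A K t) : QOrder A t →* QAlg A K t) r, ?_⟩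
      refine Subtype.ext (Prod.ext (Units.ext ?_) (Units.ext ?_))
      · exact Submodule.span_singleton_eq_one_iff.2 ⟨r, rfl⟩
      · change Algebra.norm K (qMap A K t r) = algebraMap A K (Algebra.norm A (r : QOrder A t))
        rw [qNorm_eq, algebraNorm_qOrder]
        simp only [map_add, map_mul, map_pow]
        rfl
  let i : (Aˣ ⧸ (normUnits A t).range) →* E :=
    QuotientGroup.lift (normUnits A t).range (q.comp υ) fun u hu => (hυ1 u).2 hu
  have hi : ∀ u, i (QuotientGroup.mk u) = q (υ u) := fun u => rfl
  refine ⟨inferInstance, picNorm hH hroot, i, p, ?_, isPicNorm_picNorm hH hroot, ?_, ?_, ?_, ?_, ?_⟩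
  · intro c d I J hI hJ
    obtain ⟨g, rfl, rfl⟩ := hqI c I hI
    obtain ⟨k, rfl, rfl⟩ := hqI d J hJ
    refine ⟨toOrientedIdeal (g * k), ⟨?_, rfl⟩, by rw [← map_mul, hΦq]⟩
    apply FractionalIdeal.coeToSubmodule_injective
    beta_reduce
    rw [FractionalIdeal.coe_mul, coe_toOrientedIdeal, coe_toOrientedIdeal, coe_toOrientedIdeal]
    rfl
  · intro u
    refine ⟨toOrientedIdeal (υ u), ?_, rfl, by rw [hi, hΦq]⟩
    apply FractionalIdeal.coeToSubmodule_injective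
    beta_reduce
    rw [coe_toOrientedIdeal, FractionalIdeal.coe_one]
    rfl
  · intro c I hI
    obtain ⟨g, rfl, rfl⟩ := hqI c I hI
    exact ⟨g.1.1, rfl, hp₀ g⟩
  · rw [injective_iff_map_eq_one]
    intro x hx
    induction x using QuotientGroup.induction_on with | _ u
    rw [hi, hυ1] at hx
    exact (QuotientGroup.eq_one_iff u).2 hx
  · ext c
    rw [MonoidHom.mem_ker]
    constructor
    · rintro ⟨x, rfl⟩
      induction x using QuotientGroup.induction_on with | _ u
      rw [hi, hp1]
      exact ⟨1, map_one _⟩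
    · intro hc
      obtain ⟨g, rfl⟩ := hq_surj c
      obtain ⟨τ, hτ⟩ := (hp1 g).1 hc
      -- dividing by `τ` makes the ideal trivial; the orientation then generates `A`
      have h1 : q g = q ((κ τ)⁻¹ * g) := by
        rw [map_mul, map_inv, (hq1 (κ τ)).2 ⟨τ, rfl⟩, inv_one, one_mul]
      have h2 : ((κ τ)⁻¹ * g).1.1 = 1 := by
        change (principal (QOrder A t) τ)⁻¹ * g.1.1 = 1
        rw [hτ, inv_mul_cancel]
      rw [h1]
      generalize (κ τ)⁻¹ * g = k at h2
      have h3 := mem_orientedGroup.1 k.2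
      rw [h2, map_one] at h3
      obtain ⟨u, hu⟩ := Submodule.span_singleton_eq_one_iff.1 (congrArg Units.val h3).symm
      refine ⟨QuotientGroup.mk u, ?_⟩
      rw [hi]
      congr 1
      exact Subtype.ext (Prod.ext h2.symm (Units.ext hu.symm))
  · rintro ⟨x, hx⟩
    obtain ⟨U, rfl⟩ := unitsToPic_qOrder_surjective hroot x
    rw [MonoidHom.mem_ker, picNorm_unitsToPic, unitsToPic_eq_one_iff] at hx
    obtain ⟨o, ho⟩ := hx
    let g : orientedGroup hH hroot := ⟨(U, o), mem_orientedGroup.2 ho.symm⟩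
    exact ⟨q g, Subtype.ext (hp₀ g)⟩

end ExactSequence

/-! ### The Galois action -/

section Inversion

variable {A : Type*} [CommRing A] {ℓ : ℕ} {t : A}

theorem OrderElt.trace_eq [Nontrivial A] (ρ : OrderElt ℓ t) : ρ.1.1.trace = t :=
  (charpoly_eq_iff_trace_eq ρ.1).1 ρ.2.2

/-- The inverse of an element of order `ℓ` and trace `t`. -/
def OrderElt.inverse [Nontrivial A] (ρ : OrderElt ℓ t) : OrderElt ℓ t :=
  ⟨ρ.1⁻¹, by rw [orderOf_inv, ρ.2.1],
    (charpoly_eq_iff_trace_eq _).2 (by rw [trace_inv, ρ.trace_eq])⟩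

theorem isConj_inv_inv {G : Type*} [Group G] {a b : G} (h : IsConj a b) : IsConj a⁻¹ b⁻¹ := by
  obtain ⟨g, rfl⟩ := isConj_iff.1 h
  exact isConj_iff.2 ⟨g, conj_inv.symm⟩

theorem OrderElt.cls_eq_iff (ρ σ : OrderElt ℓ t) : ρ.cls = σ.cls ↔ IsConj ρ.1 σ.1 :=
  Quotient.eq (r := eltSetoid ℓ t)

/-- Inversion on conjugacy classes. -/
def EltClasses.inverse [Nontrivial A] (c : EltClasses ℓ t) : EltClasses ℓ t :=
  Quotient.map OrderElt.inverse (fun _ _ h => isConj_inv_inv h) c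

theorem OrderElt.cls_inverse [Nontrivial A] (ρ : OrderElt ℓ t) :
    ρ.inverse.cls = EltClasses.inverse ρ.cls := rfl

theorem EltClasses.inverse_inverse [Nontrivial A] (c : EltClasses ℓ t) :
    c.inverse.inverse = c := by
  induction c using Quotient.inductionOn with | _ ρ
  exact congrArg OrderElt.cls (Subtype.ext (inv_inv ρ.1))

end Inversion

section Galois

open scoped QuadraticAlgebra
open QuadraticAlgebra (omega)

variable {A K : Type*} [CommRing A] [Field K] [Algebra A K] {t : A}

variable (A K t) in
/-- The conjugation of `K(Ψ)` over `K`. -/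
def starGal : QGal A K t where
  toFun := star
  invFun := star
  left_inv := star_star
  right_inv := star_star
  map_mul' x y := by rw [star_mul, mul_comm]
  map_add' := star_add
  commutes' r := by ext <;> simp

theorem starGal_apply (z : QAlg A K t) : starGal A K t z = star z := rfl

/-- The Galois group of `K(Ψ)` over `K` consists of the identity and the conjugation. -/
theorem gal_eq_one_or_eq_starGal (hroot : ∀ r : K, r ^ 2 - algebraMap A K t * r + 1 ≠ 0)
    (s : QGal A K t) : s = 1 ∨ s = starGal A K t := by
  have hω : (omega : QAlg A K t) * omega = algebraMap A K t • omega - 1 := by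
    ext <;> simp [Algebra.smul_def (A := K)]
  have hs : s omega * s omega = algebraMap A K t • s omega - 1 := by
    rw [← map_mul, hω, map_sub, map_one, map_smul]
  have hst : star (omega : QAlg A K t) = algebraMap A K t • 1 - omega := by
    ext <;> simp [Algebra.smul_def (A := K)]
  have hprod : (s omega - omega) * (s omega - star omega) = 0 := by
    rw [hst]
    have : (s omega - omega) * (s omega - (algebraMap A K t • 1 - omega)) =
        s omega * s omega - omega * omega - algebraMap A K t • (s omega - omega) := by
      rw [mul_sub, mul_sub, mul_smul_comm, mul_one]
      ring
    rw [this, hs, hω, smul_sub]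
    abel
  have hcases : s omega = omega ∨ s omega = star omega := by
    by_contra! h
    have h1 := norm_ne_zero_of_ne_zero hroot (sub_ne_zero.2 h.1)
    have h2 := norm_ne_zero_of_ne_zero hroot (sub_ne_zero.2 h.2)
    apply mul_ne_zero h1 h2
    rw [← map_mul, hprod, Algebra.norm_zero]
  have hz : ∀ z : QAlg A K t, z = z.re • 1 + z.im • omega := fun z => by ext <;> simp
  have hsz : ∀ z, s z = z.re • 1 + z.im • s omega := fun z => by
    conv_lhs => rw [hz z]
    rw [map_add, map_smul, map_smul, map_one]
  rcases hcases with h | h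
  · left
    ext1 z
    rw [hsz, h, ← hz]
    rfl
  · right
    ext1 z
    rw [hsz, h, starGal_apply, hst]
    ext <;> simp [Algebra.smul_def (A := K)]
    ring

theorem starGal_ne_one (ht : t ^ 2 - 4 ≠ 0) [FaithfulSMul A K] : starGal A K t ≠ 1 := by
  intro h
  have h1 : star (omega : QAlg A K t) = omega := congrArg (fun s : QGal A K t => s omega) h
  have hre := congrArg QuadraticAlgebra.re h1
  have him := congrArg QuadraticAlgebra.im h1
  simp at hre him
  apply ht
  apply FaithfulSMul.algebraMap_injective A K
  rw [map_sub, map_pow, hre, map_ofNat, map_zero]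
  linear_combination 2 * him

theorem starGal_mul_self : starGal A K t * starGal A K t = 1 := by
  ext1 z
  exact star_star z

/-- The conjugate `(𝔞̄, -a)` of an oriented ideal `(𝔞, a)`. -/
noncomputable def OrientedIdeal.conj (I : OrientedIdeal A K t) : OrientedIdeal A K t where
  ideal := ⟨starSubmodule (I.ideal : Submodule (QOrder A t) (QAlg A K t)), by
    obtain ⟨r, hr, h⟩ := I.ideal.isFractional
    refine ⟨star r, ?_, fun z hz => ?_⟩
    · rw [← QuadraticAlgebra.norm_mem_nonZeroDivisors_iff] at hr ⊢
      rwa [QuadraticAlgebra.norm_star]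
    · obtain ⟨s, hs⟩ := h _ hz
      refine ⟨star s, ?_⟩
      have h1 : ∀ u : QOrder A t, qMap A K t (star u) = star (qMap A K t u) := fun u => by
        ext <;> simp
      change qMap A K t (star s) = star r • z
      rw [h1, show qMap A K t s = r • star z from hs, qOrder_smul_eq, qOrder_smul_eq, star_mul,
        star_star, h1, mul_comm]⟩
  orient := -I.orient
  span_orient := by
    have h1 : {w : K | ∃ x ∈ starSubmodule (I.ideal : Submodule (QOrder A t) (QAlg A K t)),
        ∃ y ∈ starSubmodule (I.ideal : Submodule (QOrder A t) (QAlg A K t)), w = wedge x y} =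
        {w : K | ∃ x ∈ I.ideal, ∃ y ∈ I.ideal, w = wedge x y} := by
      have hw : ∀ x y : QAlg A K t, wedge x y = wedge (star y) (star x) := fun x y => by
        simp [wedge]; ring
      ext w
      constructor
      · rintro ⟨x, hx, y, hy, rfl⟩
        exact ⟨star y, hy, star x, hx, hw x y⟩
      · rintro ⟨x, hx, y, hy, rfl⟩
        refine ⟨star y, ?_, star x, ?_, hw x y⟩
        · rwa [mem_starSubmodule, star_star]
        · rwa [mem_starSubmodule, star_star]
    refine Eq.trans ?_ (congrArg (Submodule.span A) h1).symm
    rw [← I.span_orient, Units.val_neg, ← Set.neg_singleton, Submodule.span_neg]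

theorem OrientedIdeal.mem_conj (I : OrientedIdeal A K t) (z : QAlg A K t) :
    z ∈ I.conj.ideal ↔ star z ∈ I.ideal := Iff.rfl

theorem OrientedIdeal.orient_conj (I : OrientedIdeal A K t) :
    (I.conj.orient : K) = - I.orient := rfl

variable [IsDomain A] [FaithfulSMul A K] {ℓ : ℕ}

/-- The Galois action on classes, orbits of classes, and normalizers. The conjugation of `K(Ψ)` acts
on classes of matrices by inversion. -/
theorem exists_mulAction_gal (hH : QIntegral K t) (hT : IsOrderTrace ℓ t)
    (hroot : ∀ r : K, r ^ 2 - algebraMap A K t * r + 1 ≠ 0)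
    (Φ : EltClasses ℓ t ≃ OrientedClasses A K t)
    (hΦ : ∀ (ρ : OrderElt ℓ t) (I : OrientedIdeal A K t), Φ ρ.cls = I.cls ↔ Represents ρ.1 I) :
    ∃ _ : MulAction (QGal A K t) (EltClasses ℓ t),
      (∀ (s : QGal A K t) (c : EltClasses ℓ t) (I : OrientedIdeal A K t), Φ c = I.cls →
        ∃ J, I.IsConjugate s J ∧ Φ (s • c) = J.cls) ∧
      (∃ e : MulAction.orbitRel.Quotient (QGal A K t) (EltClasses ℓ t) ≃ SubgroupClasses A ℓ,
        ∀ ρ : OrderElt ℓ t, e (Quotient.mk _ ρ.cls) = ρ.gen.cls) ∧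
      ∀ (Γ : OrderSubgroup A ℓ) (ρ : OrderElt ℓ t), ρ.1 ∈ Γ.1 →
        (HasDihedralOvergroup Γ.1 ↔ ∀ s : QGal A K t, s • ρ.cls = ρ.cls) ∧
        ((∀ s : QGal A K t, s • ρ.cls = ρ.cls) →
          NormalizerIsExtension (normUnits A t).ker Γ.1) ∧
        ((¬ ∀ s : QGal A K t, s • ρ.cls = ρ.cls) →
          Nonempty (Subgroup.normalizer (Γ.1 : Set SL(2, A)) ≃* (normUnits A t).ker)) := by
  classical
  have hne := starGal_ne_one (K := K) hT.disc_ne_zero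
  have hgal := gal_eq_one_or_eq_starGal (K := K) hroot
  let act : MulAction (QGal A K t) (EltClasses ℓ t) :=
    { smul := fun s c => if s = 1 then c else c.inverse
      one_smul := fun c => if_pos rfl
      mul_smul := by
        intro s u c
        change (if s * u = 1 then c else c.inverse) =
          if s = 1 then (if u = 1 then c else c.inverse)
          else (if u = 1 then c else c.inverse).inverse
        rcases hgal s with rfl | rfl <;> rcases hgal u with rfl | rfl
        · simp
        · simp
        · simp [hne]
        · simp [hne, starGal_mul_self, EltClasses.inverse_inverse] }
  have hstar : ∀ c : EltClasses ℓ t, starGal A K t • c = c.inverse := fun c => if_neg hne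
  have hinv : ∀ ρ : OrderElt ℓ t, (∀ s : QGal A K t, s • ρ.cls = ρ.cls) ↔ IsConj ρ.1 ρ.1⁻¹ := by
    intro ρ
    constructor
    · intro h
      have h1 := h (starGal A K t)
      rw [hstar, ← OrderElt.cls_inverse, eq_comm, OrderElt.cls_eq_iff] at h1
      exact h1
    · intro h s
      rcases hgal s with rfl | rfl
      · exact one_smul _ _
      · rw [hstar, ← OrderElt.cls_inverse, eq_comm, OrderElt.cls_eq_iff]
        exact h
  refine ⟨act, ?_, ?_, ?_⟩
  · intro s c I hI
    rcases hgal s with rfl | rfl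
    · exact ⟨I, ⟨fun z => Iff.rfl, fun x y h => h⟩, by rw [one_smul, hI]⟩
    · refine ⟨I.conj, ⟨fun z => ?_, fun x y h => ?_⟩, ?_⟩
      · rw [I.mem_conj, starGal_apply, star_star]
      · rw [I.orient_conj, ← h, starGal_apply, starGal_apply]
        simp [wedge]; ring
      · rw [hstar]
        induction c using Quotient.inductionOn with | _ ρ
        exact (hΦ ρ.inverse I.conj).2 (((hΦ ρ I).1 hI).inv_of_star I.mem_conj I.orient_conj)
  · refine hT.exists_quotient_equiv (MulAction.orbitRel (QGal A K t) (EltClasses ℓ t))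
      OrderElt.cls Quotient.mk_surjective fun ρ σ => ?_
    rw [MulAction.orbitRel_apply, ← OrderElt.cls_eq_iff]
    have h1 : IsConj ρ.1⁻¹ σ.1 ↔ ρ.cls = starGal A K t • σ.cls := by
      rw [hstar, ← OrderElt.cls_inverse, OrderElt.cls_eq_iff]
      constructor
      · intro h
        have := isConj_inv_inv h
        rwa [inv_inv] at this
      · intro h
        have := isConj_inv_inv h
        rwa [OrderElt.inverse, inv_inv] at this
    rw [h1]
    constructor
    · rintro ⟨s, hs⟩
      change s • σ.cls = ρ.cls at hs
      rcases hgal s with rfl | rfl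
      · left; rw [← hs, one_smul]
      · right; rw [hs]
    · rintro (h | h)
      · rw [h]; exact MulAction.mem_orbit_self _
      · exact ⟨starGal A K t, h.symm⟩
  · intro Γ ρ hρΓ
    have hρ := ρ.trace_eq
    have hΓ := hT.eq_zpowers Γ.2 hρ hρΓ
    have hj := centralizerHom_injective hT.disc_ne_zero ρ.1 hρ
    have hrange := range_centralizerHom hT.disc_ne_zero hH ρ.1 hρ
    rw [hinv]
    exact ⟨hT.hasDihedralOvergroup_iff hρ hΓ,
      fun h => hT.normalizerIsExtension hρ _ hj hrange
        (fun g u hg => conj_centralizerHom hρ hg u) h hΓ,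
      fun h => hT.nonempty_normalizer_mulEquiv hρ _ hj hrange h hΓ⟩

end Galois

/-! ### The split case -/

section Split

open scoped QuadraticAlgebra
open QuadraticAlgebra (omega)
open Submodule (unitsToPic)

/-- Evaluation `T ↦ z` at a root `z` of `T² - sT + 1`. -/
def evalRoot {B : Type*} [CommRing B] {s : B} (z : B) (hz : z ^ 2 - s * z + 1 = 0) :
    QuadraticAlgebra B (-1) s →+* B where
  toFun w := w.re + w.im * z
  map_one' := by simp [QuadraticAlgebra.re_one, QuadraticAlgebra.im_one]
  map_zero' := by simp
  map_add' x y := by simp; ring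
  map_mul' x y := by
    simp
    linear_combination -x.im * y.im * hz

theorem evalRoot_apply {B : Type*} [CommRing B] {s : B} (z : B) (hz : z ^ 2 - s * z + 1 = 0)
    (w : QuadraticAlgebra B (-1) s) : evalRoot z hz w = w.re + w.im * z := rfl

/-- `s - z` is the other root. -/
theorem other_root {B : Type*} [CommRing B] {s z : B} (hz : z ^ 2 - s * z + 1 = 0) :
    (s - z) ^ 2 - s * (s - z) + 1 = 0 := by
  linear_combination hz

theorem evalRoot_mul_evalRoot {B : Type*} [CommRing B] {s : B} (z : B)
    (hz : z ^ 2 - s * z + 1 = 0) (w : QuadraticAlgebra B (-1) s) :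
    evalRoot z hz w * evalRoot (s - z) (other_root hz) w =
      w.re ^ 2 + s * w.re * w.im + w.im ^ 2 := by
  simp only [evalRoot_apply]
  linear_combination -w.im ^ 2 * hz

/-- When the discriminant is a unit, `B[T]/(T² - sT + 1)` splits: values at both roots are
arbitrary. -/
theorem existsUnique_evalRoot {B : Type*} [CommRing B] {s : B} (z : B)
    (hz : z ^ 2 - s * z + 1 = 0) (hu : IsUnit (2 * z - s)) (a b : B) :
    ∃! w : QuadraticAlgebra B (-1) s,
      evalRoot z hz w = a ∧ evalRoot (s - z) (other_root hz) w = b := by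
  obtain ⟨d, hd⟩ := hu.exists_right_inv
  refine ⟨⟨a - d * (a - b) * z, d * (a - b)⟩, ⟨?_, ?_⟩, ?_⟩
  · simp only [evalRoot_apply]; ring
  · simp only [evalRoot_apply]
    linear_combination (b - a) * hd
  · rintro w ⟨rfl, rfl⟩
    simp only [evalRoot_apply]
    apply QuadraticAlgebra.ext
    · linear_combination w.im * z * hd
    · linear_combination -w.im * hd

variable {A : Type*} [CommRing A] {t : A}

theorem isUnit_two_mul_sub {z : A} (hz : z ^ 2 - t * z + 1 = 0) (hd : IsUnit (t ^ 2 - 4)) :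
    IsUnit (2 * z - t) := by
  refine isUnit_of_dvd_unit ⟨2 * z - t, ?_⟩ hd
  linear_combination -4 * hz

/-- In the split case the elements of norm one are the pairs `(u, u⁻¹)`. -/
theorem nonempty_ker_normUnits_mulEquiv {z : A} (hz : z ^ 2 - t * z + 1 = 0)
    (hd : IsUnit (t ^ 2 - 4)) : Nonempty (Aˣ ≃* (normUnits A t).ker) := by
  have hu := isUnit_two_mul_sub hz hd
  have hnorm : ∀ w : QOrder A t, Algebra.norm A w =
      evalRoot z hz w * evalRoot (t - z) (other_root hz) w := fun w => by
    rw [evalRoot_mul_evalRoot, algebraNorm_qOrder]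
  let f : (normUnits A t).ker →* Aˣ :=
    (Units.map (evalRoot z hz : QOrder A t →* A)).comp (normUnits A t).ker.subtype
  have hf : ∀ u, (f u : A) = evalRoot z hz (u.1 : QOrder A t) := fun _ => rfl
  refine ⟨(MulEquiv.ofBijective f ⟨?_, ?_⟩).symm⟩
  · intro u v huv
    have hval := congrArg Units.val huv
    rw [hf, hf] at hval
    have h1 := mem_ker_normUnits.1 u.2
    have h2 := mem_ker_normUnits.1 v.2
    rw [hnorm] at h1 h2
    have h3 : evalRoot (t - z) (other_root hz) (u.1 : QOrder A t) =
        evalRoot (t - z) (other_root hz) (v.1 : QOrder A t) := by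
      rw [hval] at h1
      exact (IsUnit.of_mul_eq_one _ h2).mul_left_cancel (h1.trans h2.symm)
    exact Subtype.ext (Units.ext ((existsUnique_evalRoot z hz hu _ _).unique ⟨hval, h3⟩ ⟨rfl, rfl⟩))
  · intro u
    obtain ⟨w, ⟨h1, h2⟩, -⟩ := existsUnique_evalRoot z hz hu (u : A) (↑u⁻¹ : A)
    have hw : Algebra.norm A w = 1 := by rw [hnorm, h1, h2, Units.mul_inv]
    have hwu : IsUnit w := by
      rw [QuadraticAlgebra.isUnit_iff_norm_isUnit, QuadraticAlgebra.norm_def]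
      rw [algebraNorm_qOrder] at hw
      exact IsUnit.of_mul_eq_one 1 (by linear_combination hw)
    exact ⟨⟨hwu.unit, mem_ker_normUnits.2 hw⟩, Units.ext h1⟩

variable {K : Type*} [Field K] [Algebra A K]

theorem algebraMap_root {z : A} (hz : z ^ 2 - t * z + 1 = 0) :
    algebraMap A K z ^ 2 - algebraMap A K t * algebraMap A K z + 1 = 0 := by
  rw [← map_pow, ← map_mul, ← map_sub, ← map_one (algebraMap A K), ← map_add, hz, map_zero]

/-- Evaluation `K(Ψ) → K` at a root of `Ψ` in `A`. -/
def evalAlg (K : Type*) [Field K] [Algebra A K] (z : A) (hz : z ^ 2 - t * z + 1 = 0) :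
    QAlg A K t →+* K := evalRoot (algebraMap A K z) (algebraMap_root hz)

theorem evalAlg_apply (z : A) (hz : z ^ 2 - t * z + 1 = 0) (w : QAlg A K t) :
    evalAlg K z hz w = w.re + w.im * algebraMap A K z := rfl

theorem evalAlg_smul (z : A) (hz : z ^ 2 - t * z + 1 = 0) (r : QOrder A t) (w : QAlg A K t) :
    evalAlg K z hz (r • w) = evalRoot z hz r • evalAlg K z hz w := by
  rw [qOrder_smul_eq, map_mul, Algebra.smul_def, evalRoot_apply, evalAlg_apply]
  simp

theorem evalAlg_star (z : A) (hz : z ^ 2 - t * z + 1 = 0) (w : QAlg A K t) :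
    evalAlg K z hz (star w) = evalAlg K (t - z) (other_root hz) w := by
  simp [evalAlg_apply]; ring

theorem norm_eq_evalAlg_mul (z : A) (hz : z ^ 2 - t * z + 1 = 0) (w : QAlg A K t) :
    Algebra.norm K w = evalAlg K z hz w * evalAlg K (t - z) (other_root hz) w := by
  have h := algebraMap_root (K := K) hz
  rw [qNorm_eq]
  simp only [evalAlg_apply, map_sub]
  linear_combination w.im ^ 2 * h

theorem wedge_eq_evalAlg (z : A) (hz : z ^ 2 - t * z + 1 = 0) (x y : QAlg A K t) :
    algebraMap A K (2 * z - t) * wedge x y =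
      evalAlg K (t - z) (other_root hz) x * evalAlg K z hz y -
        evalAlg K z hz x * evalAlg K (t - z) (other_root hz) y := by
  simp only [evalAlg_apply, map_sub, map_mul, map_ofNat, wedge]
  ring

theorem existsUnique_evalAlg {z : A} (hz : z ^ 2 - t * z + 1 = 0) (hu : IsUnit (2 * z - t))
    (a b : K) : ∃! w : QAlg A K t,
      evalAlg K z hz w = a ∧ evalAlg K (t - z) (other_root hz) w = b := by
  have h := existsUnique_evalRoot (algebraMap A K z) (algebraMap_root hz)
    (by have := hu.map (algebraMap A K); rwa [map_sub, map_mul, map_ofNat] at this) a b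
  simpa only [evalAlg_apply, evalRoot_apply, map_sub] using h

/-- The image of a submodule of `K(Ψ)` under evaluation at a root of `Ψ`. -/
def evalSubmodule (z : A) (hz : z ^ 2 - t * z + 1 = 0)
    (M : Submodule (QOrder A t) (QAlg A K t)) : Submodule A K where
  carrier := {w | ∃ x ∈ M, w = evalAlg K z hz x}
  zero_mem' := ⟨0, M.zero_mem, (map_zero _).symm⟩
  add_mem' := by
    rintro _ _ ⟨x, hx, rfl⟩ ⟨y, hy, rfl⟩
    exact ⟨x + y, M.add_mem hx hy, (map_add _ _ _).symm⟩
  smul_mem' := by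
    rintro c _ ⟨x, hx, rfl⟩
    refine ⟨algebraMap A (QOrder A t) c • x, M.smul_mem _ hx, ?_⟩
    rw [evalAlg_smul, evalRoot_apply]
    simp

/-- Submodules of `K(Ψ)` split as products. -/
theorem exists_mem_evalAlg {z : A} (hz : z ^ 2 - t * z + 1 = 0) (hu : IsUnit (2 * z - t))
    {M : Submodule (QOrder A t) (QAlg A K t)} {a b : K} (ha : a ∈ evalSubmodule z hz M)
    (hb : b ∈ evalSubmodule (t - z) (other_root hz) M) :
    ∃ x ∈ M, evalAlg K z hz x = a ∧ evalAlg K (t - z) (other_root hz) x = b := by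
  obtain ⟨x, hx, rfl⟩ := ha
  obtain ⟨y, hy, rfl⟩ := hb
  obtain ⟨e, ⟨he1, he2⟩, -⟩ := existsUnique_evalRoot z hz hu 1 0
  obtain ⟨f, ⟨hf1, hf2⟩, -⟩ := existsUnique_evalRoot z hz hu 0 1
  refine ⟨e • x + f • y, M.add_mem (M.smul_mem _ hx) (M.smul_mem _ hy), ?_, ?_⟩
  · rw [map_add, evalAlg_smul, evalAlg_smul, he1, hf1, one_smul, zero_smul, add_zero]
  · rw [map_add, evalAlg_smul, evalAlg_smul, he2, hf2, one_smul, zero_smul, zero_add]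

theorem mem_iff_evalAlg_mem {z : A} (hz : z ^ 2 - t * z + 1 = 0) (hu : IsUnit (2 * z - t))
    {M : Submodule (QOrder A t) (QAlg A K t)} {x : QAlg A K t} :
    x ∈ M ↔ evalAlg K z hz x ∈ evalSubmodule z hz M ∧
      evalAlg K (t - z) (other_root hz) x ∈ evalSubmodule (t - z) (other_root hz) M := by
  constructor
  · intro hx
    exact ⟨⟨x, hx, rfl⟩, ⟨x, hx, rfl⟩⟩
  · rintro ⟨h1, h2⟩
    obtain ⟨y, hy, h3⟩ := exists_mem_evalAlg hz hu h1 h2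
    have h4 := (existsUnique_evalAlg hz hu (evalAlg K z hz x)
      (evalAlg K (t - z) (other_root hz) x)).unique ⟨rfl, rfl⟩ h3
    rwa [h4]

/-- In the split case the exterior square is the product of the two components. -/
theorem span_wedge_eq_evalSubmodule_mul {z : A} (hz : z ^ 2 - t * z + 1 = 0)
    (hu : IsUnit (2 * z - t)) (M : Submodule (QOrder A t) (QAlg A K t)) :
    Submodule.span A {w : K | ∃ x ∈ M, ∃ y ∈ M, w = wedge x y} =
      evalSubmodule z hz M * evalSubmodule (t - z) (other_root hz) M := by
  obtain ⟨d, hd⟩ := hu.exists_right_inv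
  have hdK : algebraMap A K d * algebraMap A K (2 * z - t) = 1 := by
    rw [← map_mul, mul_comm, hd, map_one]
  have hw : ∀ x y : QAlg A K t, wedge x y = d • (
      evalAlg K (t - z) (other_root hz) x * evalAlg K z hz y -
        evalAlg K z hz x * evalAlg K (t - z) (other_root hz) y) := by
    intro x y
    rw [← wedge_eq_evalAlg, Algebra.smul_def, ← mul_assoc, hdK, one_mul]
  apply le_antisymm
  · rw [Submodule.span_le]
    rintro _ ⟨x, hx, y, hy, rfl⟩
    rw [hw]
    refine Submodule.smul_mem _ _ (Submodule.sub_mem _ ?_ ?_)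
    · rw [mul_comm (evalAlg K (t - z) _ x)]
      exact Submodule.mul_mem_mul ⟨y, hy, rfl⟩ ⟨x, hx, rfl⟩
    · exact Submodule.mul_mem_mul ⟨x, hx, rfl⟩ ⟨y, hy, rfl⟩
  · rw [Submodule.mul_le]
    intro a ha b hb
    obtain ⟨x, hx, h1, h2⟩ := exists_mem_evalAlg hz hu ha (Submodule.zero_mem _)
    obtain ⟨y, hy, h3, h4⟩ := exists_mem_evalAlg hz hu (Submodule.zero_mem _) hb
    have h5 : a * b = (2 * z - t) • wedge y x := by
      rw [Algebra.smul_def, wedge_eq_evalAlg z hz, h1, h2, h3, h4]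
      ring
    rw [h5]
    exact Submodule.smul_mem _ _ (Submodule.subset_span ⟨y, hy, x, hx, rfl⟩)

theorem OrientedIdeal.evalSubmodule_mul {z : A} (hz : z ^ 2 - t * z + 1 = 0)
    (hu : IsUnit (2 * z - t)) (I : OrientedIdeal A K t) :
    evalSubmodule z hz (I.ideal : Submodule (QOrder A t) (QAlg A K t)) *
      evalSubmodule (t - z) (other_root hz) (I.ideal : Submodule (QOrder A t) (QAlg A K t)) =
      (principal A I.orient : Submodule A K) := by
  rw [coe_principal, I.span_orient]
  exact (span_wedge_eq_evalSubmodule_mul hz hu _).symm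

/-- The image of an oriented ideal under evaluation at a root, as an invertible submodule. -/
noncomputable def OrientedIdeal.evalUnit (I : OrientedIdeal A K t) {z : A}
    (hz : z ^ 2 - t * z + 1 = 0) (hu : IsUnit (2 * z - t)) : (Submodule A K)ˣ :=
  ⟨evalSubmodule z hz (I.ideal : Submodule (QOrder A t) (QAlg A K t)),
    evalSubmodule (t - z) (other_root hz) (I.ideal : Submodule (QOrder A t) (QAlg A K t)) *
      ((principal A I.orient)⁻¹ : (Submodule A K)ˣ),
    by rw [← mul_assoc, I.evalSubmodule_mul hz hu, Units.mul_inv],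
    by rw [mul_comm, ← mul_assoc, I.evalSubmodule_mul hz hu, Units.mul_inv]⟩

theorem OrientedIdeal.coe_evalUnit (I : OrientedIdeal A K t) {z : A}
    (hz : z ^ 2 - t * z + 1 = 0) (hu : IsUnit (2 * z - t)) :
    (I.evalUnit hz hu : Submodule A K) =
      evalSubmodule z hz (I.ideal : Submodule (QOrder A t) (QAlg A K t)) := rfl

theorem isUnit_other {z : A} (hu : IsUnit (2 * z - t)) : IsUnit (2 * (t - z) - t) := by
  have : 2 * (t - z) - t = -(2 * z - t) := by ring
  rw [this]
  exact hu.neg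

theorem OrientedIdeal.evalUnit_mul (I : OrientedIdeal A K t) {z : A}
    (hz : z ^ 2 - t * z + 1 = 0) (hu : IsUnit (2 * z - t)) :
    I.evalUnit hz hu * I.evalUnit (other_root hz) (isUnit_other hu) = principal A I.orient :=
  Units.ext (I.evalSubmodule_mul hz hu)

theorem OrientedIdeal.unitsToPic_evalUnit_other [FaithfulSMul A K] (I : OrientedIdeal A K t)
    {z : A} (hz : z ^ 2 - t * z + 1 = 0) (hu : IsUnit (2 * z - t)) :
    unitsToPic A K (I.evalUnit (other_root hz) (isUnit_other hu)) =
      (unitsToPic A K (I.evalUnit hz hu))⁻¹ := by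
  rw [eq_inv_iff_mul_eq_one, mul_comm, ← map_mul, I.evalUnit_mul, unitsToPic_eq_one_iff]
  exact ⟨_, rfl⟩

theorem OrientedIdeal.unitsToPic_evalUnit_conj [FaithfulSMul A K] (I : OrientedIdeal A K t)
    {z : A} (hz : z ^ 2 - t * z + 1 = 0) (hu : IsUnit (2 * z - t)) :
    unitsToPic A K (I.conj.evalUnit hz hu) = (unitsToPic A K (I.evalUnit hz hu))⁻¹ := by
  rw [← I.unitsToPic_evalUnit_other]
  congr 1
  apply Units.ext
  ext w
  constructor
  · rintro ⟨x, hx, rfl⟩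
    exact ⟨star x, hx, by rw [← evalAlg_star z hz, star_star]⟩
  · rintro ⟨x, hx, rfl⟩
    exact ⟨star x, (I.mem_conj _).2 (by rwa [star_star]), by rw [evalAlg_star z hz]⟩

/-- Two oriented ideals are equivalent exactly when their images under evaluation at `z` have the
same class: the orientations determine the images at the other root. -/
theorem OrientedIdeal.equivalent_iff_unitsToPic_eq [FaithfulSMul A K] (I J : OrientedIdeal A K t)
    {z : A} (hz : z ^ 2 - t * z + 1 = 0) (hu : IsUnit (2 * z - t)) :
    I.Equivalent J ↔ unitsToPic A K (I.evalUnit hz hu) = unitsToPic A K (J.evalUnit hz hu) := by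
  have hpic : unitsToPic A K (I.evalUnit hz hu) = unitsToPic A K (J.evalUnit hz hu) ↔
      ∃ a : Kˣ, J.evalUnit hz hu = principal A a * I.evalUnit hz hu := by
    rw [eq_comm, ← div_eq_one, ← map_div, unitsToPic_eq_one_iff]
    refine exists_congr fun a => ?_
    rw [eq_div_iff_mul_eq', eq_comm]
  have hmem : ∀ (a : Kˣ) (V : Submodule A K) (w : K),
      (a : K) * w ∈ (principal A a : Submodule A K) * V ↔ w ∈ V := by
    intro a V w
    rw [coe_principal, Submodule.mem_span_singleton_mul]
    constructor
    · rintro ⟨y, hy, hyw⟩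
      rwa [← mul_left_cancel₀ a.ne_zero hyw]
    · intro hw
      exact ⟨w, hw, rfl⟩
  rw [hpic]
  constructor
  · rintro ⟨τ, hτ, -⟩
    refine ⟨Units.map (evalAlg K z hz : QAlg A K t →* K) τ, Units.ext ?_⟩
    ext w
    rw [Units.val_mul, coe_principal, Submodule.mem_span_singleton_mul]
    constructor
    · rintro ⟨x, hx, rfl⟩
      refine ⟨evalAlg K z hz (↑τ⁻¹ * x), ⟨_, ?_, rfl⟩, ?_⟩
      · refine (hτ _).1 ?_
        rwa [Units.mul_inv_cancel_left]
      · change evalAlg K z hz τ * _ = _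
        rw [← map_mul, Units.mul_inv_cancel_left]
    · rintro ⟨_, ⟨x, hx, rfl⟩, rfl⟩
      exact ⟨τ * x, (hτ _).2 hx, (map_mul (evalAlg K z hz) _ _).symm⟩
  · rintro ⟨a, ha⟩
    obtain ⟨b, hb⟩ : ∃ b : Kˣ, b = J.orient / (I.orient * a) := ⟨_, rfl⟩
    have hJ' : J.evalUnit (other_root hz) (isUnit_other hu) =
        principal A b * I.evalUnit (other_root hz) (isUnit_other hu) := by
      have h1 := I.evalUnit_mul hz hu
      have h2 := J.evalUnit_mul hz hu
      rw [ha] at h2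
      have h3 : J.orient = b * (a * I.orient) := by
        rw [hb, mul_comm I.orient, div_mul_cancel]
      rw [h3, map_mul, map_mul, ← h1] at h2
      refine mul_left_cancel (h2.trans ?_)
      simp only [mul_assoc, mul_comm, mul_left_comm]
    obtain ⟨τ, ⟨hτ1, hτ2⟩, -⟩ := existsUnique_evalAlg hz hu (a : K) (b : K)
    have hN : Algebra.norm K τ = a * b := by rw [norm_eq_evalAlg_mul z hz, hτ1, hτ2]
    have hτu : IsUnit τ := by
      rw [isUnit_iff_norm_ne_zero, hN]
      exact mul_ne_zero a.ne_zero b.ne_zero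
    refine ⟨hτu.unit, fun x => ?_, ?_⟩
    · rw [IsUnit.unit_spec]
      refine (mem_iff_evalAlg_mem hz hu
        (M := (J.ideal : Submodule (QOrder A t) (QAlg A K t)))).trans
        (Iff.trans ?_ (mem_iff_evalAlg_mem hz hu
          (M := (I.ideal : Submodule (QOrder A t) (QAlg A K t)))).symm)
      rw [map_mul, map_mul, hτ1, hτ2]
      have h1 := congrArg Units.val ha
      have h2 := congrArg Units.val hJ'
      rw [Units.val_mul, OrientedIdeal.coe_evalUnit, OrientedIdeal.coe_evalUnit] at h1 h2
      rw [h1, h2, hmem, hmem]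
    · rw [IsUnit.unit_spec, hN, hb]
      push_cast
      field_simp

section Dedekind

variable [IsFractionRing A K]

/-- Every invertible submodule `V` of `K` arises: take the ideal with components `V` and `V⁻¹`. -/
theorem exists_evalUnit_eq {z : A} (hz : z ^ 2 - t * z + 1 = 0) (hu : IsUnit (2 * z - t))
    (V : (Submodule A K)ˣ) : ∃ I : OrientedIdeal A K t, I.evalUnit hz hu = V := by
  let M : Submodule (QOrder A t) (QAlg A K t) :=
    { carrier := {x | evalAlg K z hz x ∈ (V : Submodule A K) ∧
        evalAlg K (t - z) (other_root hz) x ∈ ((V⁻¹ : (Submodule A K)ˣ) : Submodule A K)}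
      zero_mem' := by simp
      add_mem' := by
        rintro x y ⟨h1, h2⟩ ⟨h3, h4⟩
        refine ⟨?_, ?_⟩
        · rw [map_add]; exact Submodule.add_mem _ h1 h3
        · rw [map_add]; exact Submodule.add_mem _ h2 h4
      smul_mem' := by
        rintro r x ⟨h1, h2⟩
        refine ⟨?_, ?_⟩
        · rw [evalAlg_smul]; exact Submodule.smul_mem _ _ h1
        · rw [evalAlg_smul]; exact Submodule.smul_mem _ _ h2 }
  have hM1 : evalSubmodule z hz M = V := by
    ext w
    constructor
    · rintro ⟨x, hx, rfl⟩
      exact hx.1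
    · intro hw
      obtain ⟨x, ⟨h1, h2⟩, -⟩ := existsUnique_evalAlg (K := K) hz hu w 0
      exact ⟨x, ⟨by rwa [h1], by rw [h2]; exact Submodule.zero_mem _⟩, h1.symm⟩
  have hM2 : evalSubmodule (t - z) (other_root hz) M = (V⁻¹ : (Submodule A K)ˣ) := by
    ext w
    constructor
    · rintro ⟨x, hx, rfl⟩
      exact hx.2
    · intro hw
      obtain ⟨x, ⟨h1, h2⟩, -⟩ := existsUnique_evalAlg (K := K) hz hu 0 w
      exact ⟨x, ⟨by rw [h1]; exact Submodule.zero_mem _, by rwa [h2]⟩, h2.symm⟩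
  have hfrac : IsFractional (QOrder A t)⁰ M := by
    obtain ⟨c, hc, h1⟩ := FractionalIdeal.isFractional_of_fg (S := A⁰) (Submodule.fg_unit V)
    obtain ⟨d, hd, h2⟩ := FractionalIdeal.isFractional_of_fg (S := A⁰) (Submodule.fg_unit V⁻¹)
    refine ⟨algebraMap A (QOrder A t) (c * d),
      QuadraticAlgebra.algebraMap_mem_nonZeroDivisors_iff.2 (mul_mem hc hd), ?_⟩
    rintro x ⟨hx1, hx2⟩
    obtain ⟨a, ha⟩ := h1 _ hx1
    obtain ⟨b, hb⟩ := h2 _ hx2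
    obtain ⟨r, ⟨hr1, hr2⟩, -⟩ := existsUnique_evalRoot z hz hu (d * a) (c * b)
    refine ⟨r, (existsUnique_evalAlg (K := K) hz hu
      (algebraMap A K (d * a)) (algebraMap A K (c * b))).unique ⟨?_, ?_⟩ ⟨?_, ?_⟩⟩
    · rw [← hr1, Algebra.algebraMap_eq_smul_one r, evalAlg_smul, map_one, Algebra.smul_def, mul_one]
    · rw [← hr2, Algebra.algebraMap_eq_smul_one r, evalAlg_smul, map_one, Algebra.smul_def, mul_one]
    · rw [evalAlg_smul, map_mul (algebraMap A K), ha, evalRoot_apply]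
      simp [Algebra.smul_def]
      ring
    · rw [evalAlg_smul, map_mul (algebraMap A K), hb, evalRoot_apply]
      simp [Algebra.smul_def]
      ring
  refine ⟨⟨⟨M, hfrac⟩, 1, ?_⟩, Units.ext hM1⟩
  refine Eq.trans ?_ (span_wedge_eq_evalSubmodule_mul hz hu M).symm
  rw [hM1, hM2, Units.mul_inv, Units.val_one, Submodule.one_eq_span]

end Dedekind

end Split

/-! ### Picard group and conjugacy classes in the split case -/

section SplitClasses

open Submodule (unitsToPic)

variable {A : Type*} [CommRing A] {K : Type*} [Field K] [Algebra A K] {t : A} {ℓ : ℕ}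

/-- If the discriminant `t² - 4` is a unit, no prime can divide it twice. -/
theorem qIntegral_of_isUnit [IsDedekindDomain A] [IsFractionRing A K]
    (hd : IsUnit (t ^ 2 - 4)) : QIntegral K t :=
  fun _ _ h1 h2 => mem_range_of_trace_norm (fun P hP _ hmem =>
    hP.ne_top (Ideal.eq_top_of_isUnit_mem P (Ideal.pow_le_self two_ne_zero hmem) hd)) h1 h2

/-- The split case: evaluation at a root of `Ψ` in `A` identifies the classes of matrices with the
Picard group of `A`, inversion of matrices becoming inversion in the Picard group. -/
theorem exists_equiv_pic [IsDedekindDomain A] [IsFractionRing A K] (hT : IsOrderTrace ℓ t) {z : A}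
    (hz : z ^ 2 - t * z + 1 = 0) (hd : IsUnit (t ^ 2 - 4))
    (Φ : EltClasses ℓ t ≃ OrientedClasses A K t)
    (hΦ : ∀ (ρ : OrderElt ℓ t) (I : OrientedIdeal A K t), Φ ρ.cls = I.cls ↔ Represents ρ.1 I) :
    ∃ e : EltClasses ℓ t ≃ CommRing.Pic A,
      (∀ (c : EltClasses ℓ t) (I : OrientedIdeal A K t), Φ c = I.cls →
        ∃ V : (Submodule A K)ˣ,
          (∀ w : K, w ∈ (V : Submodule A K) ↔
            ∃ x ∈ I.ideal, w = x.re + x.im * algebraMap A K z) ∧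
          e c = unitsToPic A K V) ∧
      (∃ f : Quotient (inversionSetoid (CommRing.Pic A)) ≃ SubgroupClasses A ℓ,
        ∀ ρ : OrderElt ℓ t, f (Quotient.mk _ (e ρ.cls)) = ρ.gen.cls) ∧
      ∀ (Γ : OrderSubgroup A ℓ) (ρ : OrderElt ℓ t), ρ.1 ∈ Γ.1 →
        (HasDihedralOvergroup Γ.1 ↔ (e ρ.cls)⁻¹ = e ρ.cls) ∧
        ((e ρ.cls)⁻¹ = e ρ.cls → NormalizerIsExtension Aˣ Γ.1) ∧
        ((e ρ.cls)⁻¹ ≠ e ρ.cls →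
          Nonempty (Subgroup.normalizer (Γ.1 : Set SL(2, A)) ≃* Aˣ)) := by
  have hu := isUnit_two_mul_sub hz hd
  let e₀ : OrientedClasses A K t → CommRing.Pic A :=
    Quotient.lift (fun I => unitsToPic A K (I.evalUnit hz hu))
      fun I J h => (I.equivalent_iff_unitsToPic_eq J hz hu).1 h
  have he₀ : ∀ I : OrientedIdeal A K t, e₀ I.cls = unitsToPic A K (I.evalUnit hz hu) :=
    fun _ => rfl
  have hbij : Function.Bijective e₀ := by
    constructor
    · intro c d h
      induction c using Quotient.inductionOn with | _ I
      induction d using Quotient.inductionOn with | _ J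
      exact Quotient.sound ((I.equivalent_iff_unitsToPic_eq J hz hu).2 h)
    · intro p
      obtain ⟨V, rfl⟩ : p ∈ (unitsToPic A K).range := by
        rw [Submodule.range_unitsToPic, CommRing.relPic_eq_top]
        trivial
      obtain ⟨I, rfl⟩ := exists_evalUnit_eq hz hu V
      exact ⟨I.cls, rfl⟩
  obtain ⟨e, he⟩ : ∃ e : EltClasses ℓ t ≃ CommRing.Pic A, ∀ c, e c = e₀ (Φ c) :=
    ⟨Φ.trans (Equiv.ofBijective e₀ hbij), fun _ => rfl⟩
  have hinv : ∀ ρ : OrderElt ℓ t, e ρ.inverse.cls = (e ρ.cls)⁻¹ := by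
    intro ρ
    obtain ⟨I, hI⟩ : ∃ I : OrientedIdeal A K t, Φ ρ.cls = I.cls :=
      (Quotient.exists_rep (Φ ρ.cls)).imp fun _ h => h.symm
    have hJ : Φ ρ.inverse.cls = I.conj.cls :=
      (hΦ ρ.inverse I.conj).2 (((hΦ ρ I).1 hI).inv_of_star I.mem_conj I.orient_conj)
    rw [he, he, hI, hJ, he₀, he₀, I.unitsToPic_evalUnit_conj]
  have hconj : ∀ ρ : OrderElt ℓ t, (e ρ.cls)⁻¹ = e ρ.cls ↔ IsConj ρ.1 ρ.1⁻¹ := by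
    intro ρ
    rw [← hinv, e.injective.eq_iff, eq_comm, OrderElt.cls_eq_iff]
    rfl
  refine ⟨e, ?_, ?_, ?_⟩
  · intro c I hI
    exact ⟨I.evalUnit hz hu, fun w => Iff.rfl, by rw [he, hI, he₀]⟩
  · refine hT.exists_quotient_equiv (inversionSetoid (CommRing.Pic A)) (fun ρ => e ρ.cls)
      (e.surjective.comp Quotient.mk_surjective) fun ρ σ => ?_
    have h1 : IsConj ρ.1⁻¹ σ.1 ↔ e ρ.cls = (e σ.cls)⁻¹ := by
      rw [← inv_eq_iff_eq_inv, ← hinv, e.injective.eq_iff, OrderElt.cls_eq_iff]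
      rfl
    rw [h1, ← OrderElt.cls_eq_iff, ← e.injective.eq_iff]
    rfl
  · intro Γ ρ hρΓ
    have hρ := ρ.trace_eq
    have hΓ := hT.eq_zpowers Γ.2 hρ hρΓ
    obtain ⟨ε⟩ := nonempty_ker_normUnits_mulEquiv hz hd
    have hj : Function.Injective ((centralizerHom ρ.1 hρ).comp ε.toMonoidHom) :=
      (centralizerHom_injective hT.disc_ne_zero ρ.1 hρ).comp ε.injective
    have hrange : ((centralizerHom ρ.1 hρ).comp ε.toMonoidHom).range =
        Subgroup.centralizer {ρ.1} := by
      rw [MonoidHom.range_comp, MonoidHom.range_eq_top.2 ε.surjective, ← MonoidHom.range_eq_map,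
        range_centralizerHom hT.disc_ne_zero (qIntegral_of_isUnit (K := K) hd) ρ.1 hρ]
    rw [ne_eq, hconj]
    refine ⟨hT.hasDihedralOvergroup_iff hρ hΓ,
      fun h => hT.normalizerIsExtension hρ _ hj hrange (fun g u hg => ?_) h hΓ,
      fun h => hT.nonempty_normalizer_mulEquiv hρ _ hj hrange h hΓ⟩
    rw [MonoidHom.comp_apply, conj_centralizerHom hρ hg, MonoidHom.comp_apply, map_inv, map_inv]
    simp

end SplitClasses

/-! ### `S`-integrality of `ℓ⁻¹` and of the roots of `T² - tT + 1` -/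

section SIntegers

variable {K : Type*} [Field K] {S : Set (Place K)}

/-- If `S` contains the places above `ℓ`, then `ℓ` is an `S`-unit. -/
theorem isUnit_natCast_of_containsPlacesAbove {ℓ : ℕ} (hℓ : (ℓ : K) ≠ 0)
    (hS : ContainsPlacesAbove S ℓ) : IsUnit (ℓ : sIntegers K S) := by
  have hmem : (ℓ : K)⁻¹ ∈ sIntegers K S := by
    refine (mem_sIntegers S).2 fun v hv => ?_
    have h1 : ¬ v.1.valuation (ℓ : K) < 1 := fun h => hv (hS v h)
    rw [← ValuationSubring.valuation_le_one_iff, map_inv₀]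
    exact inv_le_one_of_one_le₀ (not_lt.1 h1)
  refine IsUnit.of_mul_eq_one ⟨(ℓ : K)⁻¹, hmem⟩ (Subtype.ext ?_)
  simp [hℓ]

/-- Roots of `T² - tT + 1` in `K` are `S`-integral. -/
theorem mem_sIntegers_of_root {t : sIntegers K S} {z : K} (hz : z ^ 2 - t * z + 1 = 0) :
    z ∈ sIntegers K S := by
  refine (mem_sIntegers S).2 fun v hv => ?_
  refine mem_valuationSubring_of_isIntegral v.1 (R := sIntegers K S)
    (fun r => (mem_sIntegers S).1 r.2 v hv) ?_
  refine ⟨Polynomial.X ^ 2 - Polynomial.C t * Polynomial.X + 1, by monicity!, ?_⟩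
  have h : z ^ 2 - algebraMap (sIntegers K S) K t * z + 1 = 0 := hz
  simpa using h

end SIntegers

end SL2Conj

theorem mainTheorem2
    {K Ω : Type*} [Field K] [Field Ω] [Algebra K Ω] (hK : IsGlobalField K)
    -- the nonarchimedean places in `S`; for function fields `S` must be nonempty
    (S : Set (Place K)) (hS : NumberField K ∨ S.Nonempty)
    (ℓ : ℕ) (hℓ : ℓ.Prime) (hodd : Odd ℓ) (hchar : (ℓ : K) ≠ 0)
    (ζ : Ω) (hζ : IsPrimitiveRoot ζ ℓ)
    -- `ζ + ζ⁻¹` lies in `K`; being integral over `ℤ` it then lies in the ring of `S`-integers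
    (t : sIntegers K S) (ht : algebraMap K Ω t = ζ + ζ⁻¹) :
    -- identification of conjugacy classes of elements with oriented relative ideal classes
    ∃ Φ : EltClasses ℓ t ≃ OrientedClasses (sIntegers K S) K t,
      (∀ (ρ : OrderElt ℓ t) (I : OrientedIdeal (sIntegers K S) K t),
        Φ ρ.cls = I.cls ↔ Represents ρ.1 I) ∧
      -- Part (1): condition (R1)
      (ζ ∉ (algebraMap K Ω).range → UnramifiedAtEll t →
        Nonempty (EltClasses ℓ t) ∧
        -- the group structure and the extension
        (∃ (_ : CommGroup (EltClasses ℓ t))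
          (N₀ : CommRing.Pic (QOrder (sIntegers K S) t) →*
            CommRing.Pic (sIntegers K S))
          (i : ((sIntegers K S)ˣ ⧸
              (normUnits (sIntegers K S) t).range) →* EltClasses ℓ t)
          (p : EltClasses ℓ t →* N₀.ker),
          (∀ (c d : EltClasses ℓ t)
            (I J : OrientedIdeal (sIntegers K S) K t),
            Φ c = I.cls → Φ d = J.cls → ∃ P, I.IsProd J P ∧ Φ (c * d) = P.cls) ∧
          IsPicNorm (sIntegers K S) K t N₀ ∧
          (∀ u : (sIntegers K S)ˣ,
            ∃ I : OrientedIdeal (sIntegers K S) K t,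
              I.ideal = 1 ∧ (I.orient : K) = ((u : sIntegers K S) : K) ∧
              Φ (i (QuotientGroup.mk u)) = I.cls) ∧
          (∀ (c : EltClasses ℓ t)
            (I : OrientedIdeal (sIntegers K S) K t), Φ c = I.cls →
            ∃ U : (Submodule (QOrder (sIntegers K S) t)
                (QAlg (sIntegers K S) K t))ˣ,
              (U : Submodule (QOrder (sIntegers K S) t)
                (QAlg (sIntegers K S) K t)) = I.ideal ∧
              (p c : CommRing.Pic (QOrder (sIntegers K S) t)) =
                Submodule.unitsToPic _ _ U) ∧
          Function.Injective i ∧ i.range = p.ker ∧ Function.Surjective p) ∧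
        -- the Galois action, subgroup classes, dihedral overgroups and normalizers
        (∃ _ : MulAction (QGal (sIntegers K S) K t) (EltClasses ℓ t),
          (∀ (s : QGal (sIntegers K S) K t) (c : EltClasses ℓ t)
            (I : OrientedIdeal (sIntegers K S) K t), Φ c = I.cls →
            ∃ J, I.IsConjugate s J ∧ Φ (s • c) = J.cls) ∧
          (∃ e : MulAction.orbitRel.Quotient (QGal (sIntegers K S) K t) (EltClasses ℓ t) ≃
              SubgroupClasses (sIntegers K S) ℓ,
            ∀ ρ : OrderElt ℓ t, e (Quotient.mk _ ρ.cls) = ρ.gen.cls) ∧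
          ∀ (Γ : OrderSubgroup (sIntegers K S) ℓ) (ρ : OrderElt ℓ t),
            ρ.1 ∈ Γ.1 →
            (HasDihedralOvergroup Γ.1 ↔
              ∀ s : QGal (sIntegers K S) K t, s • ρ.cls = ρ.cls) ∧
            ((∀ s : QGal (sIntegers K S) K t, s • ρ.cls = ρ.cls) →
              NormalizerIsExtension
                (normUnits (sIntegers K S) t).ker Γ.1) ∧
            ((¬ ∀ s : QGal (sIntegers K S) K t, s • ρ.cls = ρ.cls) →
              Nonempty (Subgroup.normalizer (Γ.1 : Set SL(2, sIntegers K S)) ≃*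
                (normUnits (sIntegers K S) t).ker)))) ∧
      -- Part (2): condition (R2), where `z ∈ K` is `ζ`
      (∀ z : K, algebraMap K Ω z = ζ → ContainsPlacesAbove S ℓ →
        ∃ e : EltClasses ℓ t ≃ CommRing.Pic (sIntegers K S),
          -- the class of `(𝔞, a)` goes to the class of the image of `𝔞` under `T ↦ ζ`
          (∀ (c : EltClasses ℓ t)
            (I : OrientedIdeal (sIntegers K S) K t), Φ c = I.cls →
            ∃ V : (Submodule (sIntegers K S) K)ˣ,
              (∀ w : K, w ∈ (V : Submodule (sIntegers K S) K) ↔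
                ∃ x ∈ I.ideal, w = x.re + x.im * z) ∧
              e c = Submodule.unitsToPic _ _ V) ∧
          (∃ f : Quotient (inversionSetoid (CommRing.Pic (sIntegers K S))) ≃
              SubgroupClasses (sIntegers K S) ℓ,
            ∀ ρ : OrderElt ℓ t, f (Quotient.mk _ (e ρ.cls)) = ρ.gen.cls) ∧
          ∀ (Γ : OrderSubgroup (sIntegers K S) ℓ) (ρ : OrderElt ℓ t),
            ρ.1 ∈ Γ.1 →
            (HasDihedralOvergroup Γ.1 ↔ (e ρ.cls)⁻¹ = e ρ.cls) ∧
            ((e ρ.cls)⁻¹ = e ρ.cls →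
              NormalizerIsExtension (sIntegers K S)ˣ Γ.1) ∧
            ((e ρ.cls)⁻¹ ≠ e ρ.cls →
              Nonempty (Subgroup.normalizer (Γ.1 : Set SL(2, sIntegers K S)) ≃* (sIntegers K S)ˣ))) := by
  obtain ⟨_, _⟩ := isDedekindDomain_and_isFractionRing_sIntegers S hK hS
  obtain ⟨φ, hφt⟩ : ∃ φ : sIntegers K S →+* Ω, ∀ a : sIntegers K S, φ a = algebraMap K Ω a :=
    ⟨(algebraMap K Ω).comp (sIntegers K S).subtype, fun _ => rfl⟩
  have hφ : Function.Injective φ := fun a b h => by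
    rw [hφt, hφt] at h
    exact Subtype.ext ((algebraMap K Ω).injective h)
  have htφ : φ t = ζ + ζ⁻¹ := (hφt t).trans ht
  have hℓ0 : (ℓ : Ω) ≠ 0 := by
    rw [← map_natCast (algebraMap K Ω)]
    exact (map_ne_zero _).2 hchar
  have hT : IsOrderTrace ℓ t := isOrderTrace_of_isPrimitiveRoot hφ hℓ hodd hℓ0 hζ htφ
  have hζ0 : ζ ≠ 0 := hζ.ne_zero hℓ.ne_zero
  -- the roots of `Ψ` in `Ω` are `ζ` and `ζ⁻¹`
  have hfactor : ∀ r : K, algebraMap K Ω (r ^ 2 - t * r + 1) =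
      (algebraMap K Ω r - ζ) * (algebraMap K Ω r - ζ⁻¹) := by
    intro r
    rw [map_add, map_sub, map_mul, map_pow, map_one, ht]
    linear_combination -mul_inv_cancel₀ hζ0
  obtain ⟨Φ, hΦ⟩ := exists_equiv_represents (sIntegers K S) K t hT.disc_ne_zero hT.orderOf_eq
  refine ⟨Φ, hΦ, fun hζK hun => ?_, fun z hzζ hSℓ => ?_⟩
  · have hroot : ∀ r : K, r ^ 2 - algebraMap (sIntegers K S) K t * r + 1 ≠ 0 := by
      intro r hr
      have h := hfactor r
      rw [show r ^ 2 - (t : K) * r + 1 = 0 from hr, map_zero, eq_comm, mul_eq_zero, sub_eq_zero,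
        sub_eq_zero] at h
      rcases h with h | h
      · exact hζK ⟨r, h⟩
      · exact hζK ⟨r⁻¹, by rw [map_inv₀, h, inv_inv]⟩
    have hH : QIntegral K t := fun x y h1 h2 => mem_range_of_trace_norm
      (fun P hP hP0 => notMem_sq_of_unramifiedAtEll hφ hℓ hodd hζ htφ hun P hP0) h1 h2
    have hgroup := exists_commGroup_exact hH hroot Φ
    refine ⟨?_, hgroup, exists_mulAction_gal hH hT hroot Φ hΦ⟩
    obtain ⟨_, -⟩ := hgroup
    exact ⟨1⟩
  · have hz : z ^ 2 - (t : K) * z + 1 = 0 := by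
      apply (algebraMap K Ω).injective
      rw [hfactor, hzζ, sub_self, zero_mul, map_zero]
    have hd : IsUnit (t ^ 2 - 4) := isUnit_sq_sub_four hφ hℓ hodd hζ htφ
      (isUnit_natCast_of_containsPlacesAbove hchar hSℓ)
    exact exists_equiv_pic (z := ⟨z, mem_sIntegers_of_root hz⟩) hT (Subtype.ext hz) hd Φ hΦ
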